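/- **Setting.** For integers $0<p<N$ let $\Omega_{N,p}$ be the set of configurations $\eta\in\{0,1\}^{\mathbb Z/N\mathbb Z}$ with $\sum_x\eta_x=p$. For $\gamma\in\mathbb R$ let $M_\gamma$ be the matrix of the operator $$L_\gamma g(\eta)=\sum_{x}\eta_{x+1}(1-\eta_x)\big(e^{\gamma}g(\eta^{x,x+1})-g(\eta)\big)$$ on functions on $\Omega_{N,p}$, where $\eta^{x,x+1}$ is $\eta$ with $\eta_x$ and $\eta_{x+1}$ exchanged (the tilted generator of the totally asymmetric simple exclusion process on a ring). Let $\lambda_1(\gamma)=\lambda_1(\gamma;N,p)$ be the eigenvalue of $M_\gamma$ with the largest real part. For $C\in\mathbb C$ label the $N$ roots $u_1(C),\dots,u_N(C)$ of $(1-u)^p(1+u)^{N-p}=C$ as follows, with $\arg\in(-\pi,\pi]$ and $F(u)=\frac p\pi\arg(u-1)+\frac{N-p}\pi\arg(u+1)$. If $C\notin[0,\infty)$, $u_j(C)$ is the unique root such that $F(u_j)$ lies, modulo $2N$, in $(-p+2(j-1),-p+2j]$. If $C>0$, $u_j(C)=\lim_{\delta\uparrow0}u_j(Ce^{i\delta})$.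 Finally $u_j(0)=1$ for $j\le p$ and $u_j(0)=-1$ for $j>p$. For a set $A\subseteq\{1,\dots,N\}$ with $|A|=p$, the consistency equation in the unknown $C\in\mathbb C$ is $$2^Ne^{\gamma N}\prod_{j\in A}\frac{u_j(C)-1}{u_j(C)+1}+C=0\qquad(u_j(C)\ne-1\text{ for }j\in A),\tag{1}$$ and for $A=\{1,\dots,p-1,N\}$ its logarithmic form is $$\frac1p\log\frac{u_N(C)+1}{u_p(C)+1}+G_N(C)=\gamma,\qquad G_N(C)=\frac1p\sum_{j=1}^p\log(1+u_j(C))-\log2,\tag{2}$$ with principal logarithms. **Proposition.** Fix $\gamma<0$ and a rational $\rho\in(0,1)$, and let $N\to\infty$ along the pairs $(N,p)$ with $p=\rho N$. (a) For all large $N$, equation (1) with $A=\{1,\dots,p-1,N\}$ and equation (2) each have exactly one solution in $\mathbb C$; it is the same number $C^*_{N,\gamma}$ for both, and it is real and positive. It tends to zero exponentially fast ($C^*_{N,\gamma}=O(e^{-cN})$ for some $c>0$), and $$C^*_{N,\gamma}=2^Ne^{N^2\gamma\rho(1-\rho)}+o\big(2^Ne^{N^2\gamma\rho(1-\rho)}\big).$$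 (b) Assume that for all large $N$ the largest eigenvalue is achieved by the selection $A=\{1,\dots,p-1,N\}$, that is, $\lambda_1(\gamma)=\frac12\sum_{j\in A}(u_j(C)-1)$ for some solution $C$ of (1) with this $A$. Then $$\lambda_1(\gamma)=-1+e^{N\gamma\rho}+e^{N\gamma(1-\rho)}+o\big(e^{N\gamma\rho}+e^{N\gamma(1-\rho)}\big).$$ -/

import Mathlib

open Filter Asymptotics
open scoped Topology

noncomputable section

namespace TASEP

/-! ### The tilted generator of the periodic TASEP -/

/-- Configurations of `p` particles on the ring of `N` sites; `true` means occupied. -/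
abbrev Config (N p : ℕ) : Type :=
  {η : Fin N → Bool // (Finset.univ.filter fun x => η x = true).card = p}

/-- The right neighbour `x + 1` of the site `x` on the ring. -/
def next {N : ℕ} (x : Fin N) : Fin N := finRotate N x

/-- The occupation numbers `η^{x,x+1}`: those of `η` with `η_x` and `η_{x+1}` exchanged. -/
def exchange {N : ℕ} (η : Fin N → Bool) (x : Fin N) : Fin N → Bool :=
  fun y => η (Equiv.swap x (next x) y)

/-- The matrix `M_γ` of the operator
`L_γ g(η) = ∑ₓ η_{x+1} (1 - η_x) (e^γ g(η^{x,x+1}) - g(η))`. -/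
def tiltedMatrix (N p : ℕ) (γ : ℝ) : Matrix (Config N p) (Config N p) ℂ :=
  fun η η' => ∑ x : Fin N,
    if η.1 (next x) = true ∧ η.1 x = false then
      (if η'.1 = exchange η.1 x then Complex.exp γ else 0) - (if η' = η then 1 else 0)
    else 0

/-- `l` is an eigenvalue of `M_γ` with the largest real part. -/
def IsLargestEigenvalue (N p : ℕ) (γ : ℝ) (l : ℂ) : Prop :=
  Module.End.HasEigenvalue (Matrix.toLin' (tiltedMatrix N p γ)) l ∧
    ∀ μ : ℂ, Module.End.HasEigenvalue (Matrix.toLin' (tiltedMatrix N p γ)) μ → μ.re ≤ l.re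

/-! ### The labelled roots `u_1(C), …, u_N(C)` of `(1 - u)^p (1 + u)^(N - p) = C` -/

/-- `F(u) = (p/π) arg(u - 1) + ((N - p)/π) arg(u + 1)`. -/
def rootPhase (N p : ℕ) (u : ℂ) : ℝ :=
  (p : ℝ) / Real.pi * Complex.arg (u - 1) + ((N : ℝ) - p) / Real.pi * Complex.arg (u + 1)

/-- `x` lies, modulo `2N`, in the interval `(-p + 2(j - 1), -p + 2j]`. -/
def InPhaseInterval (N p j : ℕ) (x : ℝ) : Prop :=
  ∃ k : ℤ, x + 2 * (N : ℝ) * k ∈ Set.Ioc (-(p : ℝ) + 2 * ((j : ℝ) - 1)) (-(p : ℝ) + 2 * j)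

/-- For `C` outside `[0, ∞)`: the root whose phase lies in the `j`-th interval. -/
def slitRoot (N p j : ℕ) (C : ℂ) : ℂ :=
  Classical.epsilon fun u : ℂ =>
    (1 - u) ^ p * (1 + u) ^ (N - p) = C ∧ InPhaseInterval N p j (rootPhase N p u)

open Classical in
/-- The root `u_j(C)`, `1 ≤ j ≤ N`. On `(0, ∞)` it is the continuous extension from the lower
half-plane; at `C = 0` there are the `p`-fold root `1` and the `(N - p)`-fold root `-1`. -/
def root (N p j : ℕ) (C : ℂ) : ℂ :=
  if C = 0 then (if j ≤ p then 1 else -1)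
  else if 0 < C.re ∧ C.im = 0 then
    limUnder (𝓝[<] (0 : ℝ)) fun δ : ℝ => slitRoot N p j (C * Complex.exp (δ * Complex.I))
  else slitRoot N p j C

/-! ### Bethe equations for a selected set of roots -/

/-- The consistency condition for the selection `A`, with all its fractions well defined. -/
def Consistency (N p : ℕ) (γ : ℝ) (A : Finset ℕ) (C : ℂ) : Prop :=
  (∀ j ∈ A, root N p j C + 1 ≠ 0) ∧
    2 ^ N * Complex.exp (γ * N) * ∏ j ∈ A, (root N p j C - 1) / (root N p j C + 1) + C = 0

/-- The eigenvalue `(1/2) ∑_{j ∈ A} (u_j(C) - 1)` produced by the selection `A`. -/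
def betheEigenvalue (N p : ℕ) (A : Finset ℕ) (C : ℂ) : ℂ :=
  1 / 2 * ∑ j ∈ A, (root N p j C - 1)

/-- The selection `{1, …, p - 1, N}`. -/
def negSelection (N p : ℕ) : Finset ℕ := insert N (Finset.Icc 1 (p - 1))

/-- `G_N(C) = (1/p) ∑_{j=1}^p log(1 + u_j(C)) - log 2`. -/
def G (N p : ℕ) (C : ℂ) : ℂ :=
  1 / (p : ℂ) * ∑ j ∈ Finset.Icc 1 p, Complex.log (1 + root N p j C) - Complex.log 2

/-- The logarithmic form of the consistency condition for the selection `{1, …, p - 1, N}`. -/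
def LogConsistency (N p : ℕ) (γ : ℝ) (C : ℂ) : Prop :=
  1 / (p : ℂ) * Complex.log ((root N p N C + 1) / (root N p p C + 1)) + G N p C = γ

/-! ### Thermodynamic limit and the assumption on the selection of roots -/

/-- The limit `N → ∞` over the pairs `(N, p)` with `p = ρ N`. -/
def thermodynamicLimit (ρ : ℚ) : Filter (ℕ × ℕ) :=
  comap Prod.fst atTop ⊓ 𝓟 {q : ℕ × ℕ | (q.2 : ℚ) = ρ * q.1}

/-- For all large `N`, the largest eigenvalue of `M_γ` is achieved by the
selection `{1, …, p - 1, N}`. -/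
def RootSelection (γ : ℝ) (ρ : ℚ) : Prop :=
  ∀ᶠ q in thermodynamicLimit ρ, ∀ l : ℂ, IsLargestEigenvalue q.1 q.2 γ l →
    ∃ C : ℂ, Consistency q.1 q.2 γ (negSelection q.1 q.2) C ∧
      l = betheEigenvalue q.1 q.2 (negSelection q.1 q.2) C

end TASEP

end

/-!
On a level line `|1 - u|^p |1 + u|^(N - p) = |C|` the phase is monotone in `|1 + u|`, so the labels
order the roots: `u_1, …, u_p` are the `p` roots with the largest `|1 + u|`. Either consistency
condition forces `|1 + u_N| / |1 + u_p| * ∏_{j ≤ p} |1 + u_j| = 2^p e^(γ p)`. On the other hand the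
symmetric functions of all products of `p` factors `1 + u_j` are polynomials in `C`, so by the
maximum principle some such product has modulus at least `2^p` on every circle, and the interlacing
of the roots as `arg C` varies carries this bound over to `∏_{j ≤ p} |1 + u_j|` at every point of
the circle, up to a bounded number of factors. Hence `|1 + u_N|` is exponentially small in `N`, and
the Bethe equation gives `log |C| ≤ -c N^2` for every solution `C`.

For such `C = e^τ` the roots near `±1` are the values of two fixed analytic germs, the inverses of
`x (1 - x/2)^a`, at the `p`-th and `(N - p)`-th roots of `C` up to powers of `2`. Both consistency
conditions then become the same equation `τ = γ p (N - p) + N log 2 + g(τ)`, where `g` is a small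
contraction commuting with conjugation, so there is exactly one solution, and it is real. In the
eigenvalue the first-order terms cancel over the roots of unity except for the two roots that the
selection exchanges, `u_p` and `u_N`.
-/

noncomputable section

namespace TASEP

open scoped Real ComplexConjugate

/-! ### Monotonicity of the phase along the level lines -/

lemma continuousWithinAt_clog_upper {z : ℂ} (hz : z ≠ 0) :
    ContinuousWithinAt Complex.log {w : ℂ | 0 ≤ w.im} z := by
  by_cases h : z ∈ Complex.slitPlane
  · exact (continuousAt_clog h).continuousWithinAt
  · rw [Complex.mem_slitPlane_iff, not_or, not_lt, not_not] at h
    have hre : z.re < 0 := lt_of_le_of_ne h.1 fun h0 => hz (Complex.ext h0 h.2)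
    exact Complex.continuousWithinAt_log_of_re_neg_of_im_zero hre h.2

lemma im_sub_mul_conj_neg {f f' : ℂ → ℂ} {a b : ℂ} (hab : a ≠ b)
    (hf : ContinuousOn f (segment ℝ a b))
    (hf' : ∀ z ∈ openSegment ℝ a b, HasDerivAt f (f' z) z)
    (him : ∀ z ∈ openSegment ℝ a b, (f' z).im < 0) :
    ((f b - f a) * conj (b - a)).im < 0 := by
  set β : ℝ → ℂ := ⇑(AffineMap.lineMap a b : ℝ →ᵃ[ℝ] ℂ) with hβ
  set q : ℝ → ℝ := fun t => (f (β t) * conj (b - a)).im with hq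
  have hmem : ∀ t ∈ Set.Ioo (0 : ℝ) 1, β t ∈ openSegment ℝ a b := fun t ht =>
    openSegment_eq_image_lineMap ℝ a b ▸ Set.mem_image_of_mem _ ht
  have hderiv : ∀ t ∈ Set.Ioo (0 : ℝ) 1,
      HasDerivAt q (Complex.normSq (b - a) * (f' (β t)).im) t := by
    intro t ht
    have hcomp :=
      ((hf' _ (hmem t ht)).scomp t AffineMap.hasDerivAt_lineMap).mul_const (conj (b - a))
    refine (Complex.imCLM.hasFDerivAt.comp_hasDerivAt t hcomp).congr_deriv ?_
    rw [smul_eq_mul, mul_right_comm, Complex.mul_conj]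
    exact Complex.im_ofReal_mul _ _
  have hcont : ContinuousOn q (Set.Icc 0 1) := by
    refine Complex.continuous_im.comp_continuousOn (ContinuousOn.mul ?_ continuousOn_const)
    refine hf.comp AffineMap.lineMap_continuous.continuousOn fun t ht => ?_
    exact segment_eq_image_lineMap ℝ a b ▸ Set.mem_image_of_mem _ ht
  have hanti : StrictAntiOn q (Set.Icc 0 1) := by
    refine strictAntiOn_of_deriv_neg (convex_Icc 0 1) hcont fun t ht => ?_
    rw [interior_Icc] at ht
    rw [(hderiv t ht).deriv]
    exact mul_neg_of_pos_of_neg (Complex.normSq_pos.2 (sub_ne_zero.2 hab.symm)) (him _ (hmem t ht))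
  have hlt := hanti (Set.left_mem_Icc.2 zero_le_one) (Set.right_mem_Icc.2 zero_le_one) one_pos
  simp only [hq, hβ, AffineMap.lineMap_apply_zero, AffineMap.lineMap_apply_one] at hlt
  rw [sub_mul, Complex.sub_im]
  linarith

lemma im_exp_sub_two_pos {z : ℂ} (h0 : 0 < z.im) (hπ : z.im < π) :
    0 < (Complex.exp z - 2).im := by
  simpa [Complex.exp_im] using mul_pos (Real.exp_pos z.re) (Real.sin_pos_of_pos_of_lt_pi h0 hπ)

/-- In the coordinate `z = log (u + 1)`, the function below is `p log (u - 1) + n log (u + 1)`. -/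
lemma im_log_exp_sub_two_mul_conj_neg {p n : ℝ} (hp : 0 < p) {a b : ℂ} (hab : a ≠ b)
    (hstrip : ∀ z ∈ openSegment ℝ a b, 0 < z.im ∧ z.im < π)
    (ha : 0 ≤ (Complex.exp a - 2).im) (hb : 0 ≤ (Complex.exp b - 2).im)
    (ha' : Complex.exp a - 2 ≠ 0) (hb' : Complex.exp b - 2 ≠ 0) :
    (((p * Complex.log (Complex.exp b - 2) + n * b) -
      (p * Complex.log (Complex.exp a - 2) + n * a)) * conj (b - a)).im < 0 := by
  have hpos : ∀ z ∈ openSegment ℝ a b, 0 < (Complex.exp z - 2).im := fun z hz =>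
    im_exp_sub_two_pos (hstrip z hz).1 (hstrip z hz).2
  have hseg : ∀ z ∈ segment ℝ a b, 0 ≤ (Complex.exp z - 2).im ∧ Complex.exp z - 2 ≠ 0 := by
    intro z hz
    rw [← insert_endpoints_openSegment] at hz
    rcases hz with rfl | rfl | hz
    · exact ⟨ha, ha'⟩
    · exact ⟨hb, hb'⟩
    · exact ⟨(hpos z hz).le, fun h => (hpos z hz).ne' (by rw [h, Complex.zero_im])⟩
  refine im_sub_mul_conj_neg (f := fun z => p * Complex.log (Complex.exp z - 2) + n * z)
    (f' := fun z => p * (Complex.exp z / (Complex.exp z - 2)) + n) hab ?_ ?_ ?_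
  · refine (continuousOn_const.mul ?_).add (continuousOn_const.mul continuousOn_id)
    intro z hz
    exact (continuousWithinAt_clog_upper (hseg z hz).2).comp (f := fun z => Complex.exp z - 2)
      (by fun_prop) fun w hw => (hseg w hw).1
  · intro z hz
    have hexp := ((Complex.hasDerivAt_exp z).sub_const 2).clog
      (Complex.mem_slitPlane_iff.2 (.inr (hpos z hz).ne'))
    simpa using (hexp.const_mul (p : ℂ)).fun_add ((hasDerivAt_id z).const_mul (n : ℂ))
  · intro z hz
    set E := Complex.exp z - 2 with hE
    have hne : E ≠ 0 := (hseg z (openSegment_subset_segment ℝ a b hz)).2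
    have hrew : p * (Complex.exp z / E) + n = ((p + n : ℝ) : ℂ) + ((2 * p : ℝ) : ℂ) * E⁻¹ := by
      rw [show Complex.exp z = E + 2 by rw [hE]; ring]
      push_cast
      field_simp
      ring
    rw [hrew, Complex.add_im, Complex.ofReal_im, Complex.im_ofReal_mul, Complex.inv_im, zero_add]
    exact mul_neg_of_pos_of_neg (by positivity)
      (div_neg_of_neg_of_pos (neg_neg_of_pos (hpos z hz)) (Complex.normSq_pos.2 hne))

/-- The map `u ↦ (1 - u) ^ p * (1 + u) ^ (N - p)`, whose fibre over `C` consists of the roots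
`u_j(C)`. -/
def betheMap (N p : ℕ) (u : ℂ) : ℂ := (1 - u) ^ p * (1 + u) ^ (N - p)

/-- `u` does not lie on the segment `[-1, 1]`; this holds for all roots when `C ∉ [0, ∞)`. -/
def OffSegment (u : ℂ) : Prop := u.im ≠ 0 ∨ 1 < u.re ∨ u.re < -1

variable {N p : ℕ} {u v : ℂ}

lemma norm_one_sub_le_two_add (u : ℂ) : ‖1 - u‖ ≤ 2 + ‖1 + u‖ := by
  calc ‖1 - u‖ = ‖2 - (1 + u)‖ := by ring_nf
    _ ≤ ‖(2 : ℂ)‖ + ‖1 + u‖ := norm_sub_le _ _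
    _ = 2 + ‖1 + u‖ := by rw [Complex.norm_ofNat]

lemma norm_betheMap (N p : ℕ) (u : ℂ) :
    ‖betheMap N p u‖ = ‖1 - u‖ ^ p * ‖1 + u‖ ^ (N - p) := by
  rw [betheMap, norm_mul, norm_pow, norm_pow]

lemma betheMap_conj (N p : ℕ) (u : ℂ) : betheMap N p (conj u) = conj (betheMap N p u) := by
  simp [betheMap]

lemma norm_betheMap_lt (hp : 0 < p) (hpN : p < N) (h₁ : ‖1 - u‖ < ‖1 - v‖)
    (h₂ : ‖1 + u‖ < ‖1 + v‖) : ‖betheMap N p u‖ < ‖betheMap N p v‖ := by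
  rw [norm_betheMap, norm_betheMap]
  exact mul_lt_mul'' (pow_lt_pow_left₀ h₁ (norm_nonneg _) hp.ne')
    (pow_lt_pow_left₀ h₂ (norm_nonneg _) (Nat.sub_pos_of_lt hpN).ne') (by positivity)
    (by positivity)

lemma log_norm_betheMap (hpN : p ≤ N) (h₁ : u ≠ 1) (h₂ : u ≠ -1) :
    Real.log (‖betheMap N p u‖) = p * Real.log ‖u - 1‖ + ((N : ℝ) - p) * Real.log ‖u + 1‖ := by
  have h₃ : ‖u - 1‖ ≠ 0 := norm_ne_zero_iff.2 (sub_ne_zero.2 h₁)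
  have h₄ : ‖u + 1‖ ≠ 0 := norm_ne_zero_iff.2 fun h => h₂ (eq_neg_of_add_eq_zero_left h)
  rw [norm_betheMap, norm_sub_rev, add_comm 1 u, Real.log_mul (pow_ne_zero _ h₃) (pow_ne_zero _ h₄),
    Real.log_pow, Real.log_pow, Nat.cast_sub hpN]

lemma rootPhase_eq_div (N p : ℕ) (u : ℂ) : rootPhase N p u =
    (p * Complex.arg (u - 1) + ((N : ℝ) - p) * Complex.arg (u + 1)) / π := by
  unfold rootPhase; ring

lemma rootPhase_sub_mul_log_neg (hp : 0 < p) (hpN : p < N) (huv : u ≠ v)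
    (hu : 0 ≤ u.im) (hv : 0 ≤ v.im) (hu1 : u ≠ 1) (hv1 : v ≠ 1) (hu2 : u ≠ -1) (hv2 : v ≠ -1)
    (h0 : 0 < Complex.arg (u + 1) ∨ 0 < Complex.arg (v + 1))
    (hπ : Complex.arg (u + 1) < π ∨ Complex.arg (v + 1) < π)
    (hlevel : ‖betheMap N p u‖ = ‖betheMap N p v‖) :
    (rootPhase N p v - rootPhase N p u) * (Real.log ‖v + 1‖ - Real.log ‖u + 1‖) < 0 := by
  have hexp : ∀ w : ℂ, w ≠ -1 → Complex.exp (Complex.log (w + 1)) - 2 = w - 1 := fun w hw => by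
    rw [Complex.exp_log fun h => hw (eq_neg_of_add_eq_zero_left h)]; ring
  have hne : Complex.log (u + 1) ≠ Complex.log (v + 1) := fun h => huv <| by
    simpa [hexp u hu2, hexp v hv2] using congrArg (fun z => Complex.exp z - 2) h
  have harg : ∀ w : ℂ, 0 ≤ w.im → 0 ≤ Complex.arg (w + 1) ∧ Complex.arg (w + 1) ≤ π := fun w hw =>
    ⟨Complex.arg_nonneg_iff.2 (by simpa using hw), Complex.arg_le_pi _⟩
  have hstrip : ∀ z ∈ openSegment ℝ (Complex.log (u + 1)) (Complex.log (v + 1)),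
      0 < z.im ∧ z.im < π := by
    rintro z ⟨s, t, hs, ht, hst, rfl⟩
    obtain ⟨hu0, huπ⟩ := harg u hu
    obtain ⟨hv0, hvπ⟩ := harg v hv
    simp only [Complex.add_im, Complex.real_smul, Complex.im_ofReal_mul, Complex.log_im]
    refine ⟨by rcases h0 with h | h <;> positivity, ?_⟩
    calc s * (u + 1).arg + t * (v + 1).arg < s * π + t * π := by
          rcases hπ with h | h
          · exact add_lt_add_of_lt_of_le (by gcongr) (by gcongr)
          · exact add_lt_add_of_le_of_lt (by gcongr) (by gcongr)
      _ = π := by rw [← add_mul, hst, one_mul]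
  have key := im_log_exp_sub_two_mul_conj_neg (p := p) (n := (N : ℝ) - p) (Nat.cast_pos.2 hp) hne
    hstrip (by simpa [hexp u hu2]) (by simpa [hexp v hv2])
    (by simpa [hexp u hu2] using sub_ne_zero.2 hu1) (by simpa [hexp v hv2] using sub_ne_zero.2 hv1)
  rw [hexp u hu2, hexp v hv2] at key
  have hlog := congrArg Real.log hlevel
  rw [log_norm_betheMap hpN.le hu1 hu2, log_norm_betheMap hpN.le hv1 hv2] at hlog
  simp only [Complex.mul_im, Complex.sub_im, Complex.add_im, Complex.sub_re, Complex.add_re,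
    Complex.mul_re, Complex.ofReal_re, Complex.ofReal_im, Complex.log_re, Complex.log_im,
    Complex.conj_re, Complex.conj_im, zero_mul, add_zero, sub_zero] at key
  rw [← hlog, sub_self, zero_mul, zero_add] at key
  rw [rootPhase_eq_div, rootPhase_eq_div, ← sub_div, div_mul_eq_mul_div]
  exact div_neg_of_neg_of_pos key Real.pi_pos

/-! ### Range, symmetry and injectivity of the phase -/

lemma rootPhase_conj (N p : ℕ) (hu : u.im ≠ 0) : rootPhase N p (conj u) = -rootPhase N p u := by
  have harg : ∀ w : ℂ, w.im ≠ 0 → Complex.arg (conj w) = -Complex.arg w := fun w hw => by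
    rw [Complex.arg_conj, if_neg fun h => hw (Complex.arg_eq_pi_iff.1 h).2]
  have h₁ : conj u - 1 = conj (u - 1) := by simp
  have h₂ : conj u + 1 = conj (u + 1) := by simp
  rw [rootPhase_eq_div, rootPhase_eq_div, h₁, h₂, harg _ (by simpa using hu),
    harg _ (by simpa using hu)]
  ring

lemma rootPhase_of_one_lt (N p : ℕ) (hu : u.im = 0) (h : 1 < u.re) : rootPhase N p u = 0 := by
  have h₁ : Complex.arg (u - 1) = 0 := Complex.arg_eq_zero_iff.2 ⟨by simpa using h.le, by simpa⟩
  have h₂ : Complex.arg (u + 1) = 0 :=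
    Complex.arg_eq_zero_iff.2 ⟨by rw [Complex.add_re, Complex.one_re]; linarith, by simpa⟩
  rw [rootPhase_eq_div, h₁, h₂, mul_zero, mul_zero, add_zero, zero_div]

lemma rootPhase_of_lt_neg_one (N p : ℕ) (hu : u.im = 0) (h : u.re < -1) :
    rootPhase N p u = N := by
  have h₁ : Complex.arg (u - 1) = π :=
    Complex.arg_eq_pi_iff.2 ⟨by rw [Complex.sub_re, Complex.one_re]; linarith, by simpa⟩
  have h₂ : Complex.arg (u + 1) = π :=
    Complex.arg_eq_pi_iff.2 ⟨by rw [Complex.add_re, Complex.one_re]; linarith, by simpa⟩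
  rw [rootPhase_eq_div, h₁, h₂, ← add_mul, add_sub_cancel, mul_div_cancel_right₀ _ Real.pi_ne_zero]

lemma arg_mem_Ioo {z : ℂ} (hz : 0 < z.im) : Complex.arg z ∈ Set.Ioo 0 π :=
  ⟨(Complex.arg_nonneg_iff.2 hz.le).lt_of_ne' fun h => hz.ne' (Complex.arg_eq_zero_iff.1 h).2,
    (Complex.arg_le_pi z).lt_of_ne fun h => hz.ne' (Complex.arg_eq_pi_iff.1 h).2⟩

lemma rootPhase_mem_Ioo (hp : 0 < p) (hpN : p < N) (hu : 0 < u.im) :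
    rootPhase N p u ∈ Set.Ioo 0 (N : ℝ) := by
  obtain ⟨h₁, h₂⟩ := arg_mem_Ioo (z := u - 1) (by simpa using hu)
  obtain ⟨h₃, h₄⟩ := arg_mem_Ioo (z := u + 1) (by simpa using hu)
  have : (0 : ℝ) < p := Nat.cast_pos.2 hp
  have : (0 : ℝ) < (N : ℝ) - p := sub_pos.2 (Nat.cast_lt.2 hpN)
  rw [rootPhase_eq_div]
  refine ⟨by positivity, (div_lt_iff₀ Real.pi_pos).2 ?_⟩
  calc p * (u - 1).arg + ((N : ℝ) - p) * (u + 1).arg < p * π + ((N : ℝ) - p) * π := by gcongr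
    _ = N * π := by ring

lemma offSegment_conj (h : OffSegment u) : OffSegment (conj u) := by
  simpa [OffSegment] using h

namespace OffSegment

lemma ne_one (h : OffSegment u) : u ≠ 1 := by
  rintro rfl; norm_num [OffSegment] at h

lemma ne_neg_one (h : OffSegment u) : u ≠ -1 := by
  rintro rfl; norm_num [OffSegment] at h

lemma rootPhase_lt_zero_iff (hp : 0 < p) (hpN : p < N) (hu : OffSegment u) :
    rootPhase N p u < 0 ↔ u.im < 0 := by
  rcases lt_trichotomy u.im 0 with h | h | h
  · have := (rootPhase_mem_Ioo hp hpN (u := conj u) (by simpa using h)).1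
    rw [rootPhase_conj N p h.ne] at this
    exact iff_of_true (by linarith) h
  · refine iff_of_false (not_lt.2 ?_) h.not_lt
    rcases hu with hu | hu | hu
    · exact absurd h hu
    · rw [rootPhase_of_one_lt N p h hu]
    · rw [rootPhase_of_lt_neg_one N p h hu]; positivity
  · exact iff_of_false (rootPhase_mem_Ioo hp hpN h).1.not_gt h.not_gt

lemma rootPhase_mem_Ioc (hp : 0 < p) (hpN : p < N) (hu : OffSegment u) :
    rootPhase N p u ∈ Set.Ioc (-(N : ℝ)) N := by
  have hN : (0 : ℝ) < N := Nat.cast_pos.2 (hp.trans hpN)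
  rcases lt_trichotomy u.im 0 with h | h | h
  · have := rootPhase_mem_Ioo hp hpN (u := conj u) (by simpa using h)
    rw [rootPhase_conj N p h.ne] at this
    exact ⟨by linarith [this.2], by linarith [this.1]⟩
  · rcases hu with hu | hu | hu
    · exact absurd h hu
    · rw [rootPhase_of_one_lt N p h hu]; exact ⟨by linarith, hN.le⟩
    · rw [rootPhase_of_lt_neg_one N p h hu]; exact ⟨by linarith, le_rfl⟩
  · have := rootPhase_mem_Ioo hp hpN h
    exact ⟨by linarith [this.1], this.2.le⟩

lemma exists_upper (hp : 0 < p) (hpN : p < N) (hu : OffSegment u) :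
    ∃ w, OffSegment w ∧ 0 ≤ w.im ∧ rootPhase N p w = |rootPhase N p u| ∧
      ‖betheMap N p w‖ = ‖betheMap N p u‖ ∧ ‖1 + w‖ = ‖1 + u‖ ∧
      u = if rootPhase N p u < 0 then conj w else w := by
  by_cases h : u.im < 0
  · have hneg := (hu.rootPhase_lt_zero_iff hp hpN).2 h
    refine ⟨conj u, offSegment_conj hu, by simpa using h.le, ?_, ?_, ?_, ?_⟩
    · rw [rootPhase_conj N p h.ne, abs_of_neg hneg]
    · rw [betheMap_conj, Complex.norm_conj]
    · rw [← Complex.norm_conj (1 + u), map_add, map_one]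
    · rw [if_pos hneg, Complex.conj_conj]
  · have hnonneg := mt (hu.rootPhase_lt_zero_iff hp hpN).1 h
    exact ⟨u, hu, not_lt.1 h, (abs_of_nonneg (not_lt.1 hnonneg)).symm, rfl, rfl,
      (if_neg hnonneg).symm⟩

end OffSegment

lemma eq_of_norm_betheMap_eq_of_im_eq_zero (hp : 0 < p) (hpN : p < N) (hu : u.im = 0)
    (hv : v.im = 0) (hlevel : ‖betheMap N p u‖ = ‖betheMap N p v‖)
    (hray : (1 < u.re ∧ 1 < v.re) ∨ (u.re < -1 ∧ v.re < -1)) : u = v := by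
  lift u to ℝ using hu
  lift v to ℝ using hv
  simp only [Complex.ofReal_re] at hray
  have hmono : ∀ x y : ℝ, |1 - x| < |1 - y| → |1 + x| < |1 + y| →
      ‖betheMap N p x‖ ≠ ‖betheMap N p y‖ := fun x y h₁ h₂ => by
    refine (norm_betheMap_lt hp hpN ?_ ?_).ne
    · exact_mod_cast h₁
    · exact_mod_cast h₂
  by_contra hne
  wlog huv : |u| < |v| generalizing u v
  · refine this v u hlevel.symm (hray.imp And.symm And.symm) (Ne.symm hne) ?_
    refine lt_of_le_of_ne (not_lt.1 huv) fun h => hne ?_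
    rcases abs_eq_abs.1 h with h | h <;> rcases hray with hr | hr
    · rw [h]
    · rw [h]
    · linarith
    · linarith
  refine hmono u v ?_ ?_ hlevel <;> rcases hray with ⟨h₁, h₂⟩ | ⟨h₁, h₂⟩
  · rw [abs_of_pos (by linarith), abs_of_pos (by linarith)] at huv
    rw [abs_of_neg (by linarith), abs_of_neg (by linarith)]; linarith
  · rw [abs_of_neg (by linarith), abs_of_neg (by linarith)] at huv
    rw [abs_of_pos (by linarith), abs_of_pos (by linarith)]; linarith
  · rw [abs_of_pos (by linarith), abs_of_pos (by linarith)] at huv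
    rw [abs_of_pos (by linarith), abs_of_pos (by linarith)]; linarith
  · rw [abs_of_neg (by linarith), abs_of_neg (by linarith)] at huv
    rw [abs_of_neg (by linarith), abs_of_neg (by linarith)]; linarith

lemma OffSegment.same_ray_or (hu : OffSegment u) (hv : OffSegment v) (hui : 0 ≤ u.im)
    (hvi : 0 ≤ v.im) :
    (u.im = 0 ∧ v.im = 0 ∧ ((1 < u.re ∧ 1 < v.re) ∨ (u.re < -1 ∧ v.re < -1))) ∨
      ((0 < Complex.arg (u + 1) ∨ 0 < Complex.arg (v + 1)) ∧
        (Complex.arg (u + 1) < π ∨ Complex.arg (v + 1) < π)) := by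
  have hint : ∀ w : ℂ, 0 ≤ w.im → w.im ≠ 0 → Complex.arg (w + 1) ∈ Set.Ioo 0 π := fun w hw hw' =>
    arg_mem_Ioo (by simpa using lt_of_le_of_ne' hw hw')
  have hzero : ∀ w : ℂ, w.im = 0 → 1 < w.re → Complex.arg (w + 1) = 0 := fun w hw h =>
    Complex.arg_eq_zero_iff.2 ⟨by rw [Complex.add_re, Complex.one_re]; linarith, by simpa⟩
  have hpi : ∀ w : ℂ, w.im = 0 → w.re < -1 → Complex.arg (w + 1) = π := fun w hw h =>
    Complex.arg_eq_pi_iff.2 ⟨by rw [Complex.add_re, Complex.one_re]; linarith, by simpa⟩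
  have := Real.pi_pos
  by_cases hu0 : u.im = 0
  · by_cases hv0 : v.im = 0
    · rcases hu.resolve_left (not_not.2 hu0) with h | h <;>
        rcases hv.resolve_left (not_not.2 hv0) with h' | h'
      · exact .inl ⟨hu0, hv0, .inl ⟨h, h'⟩⟩
      · exact .inr ⟨.inr (by rwa [hpi v hv0 h']), .inl (by rwa [hzero u hu0 h])⟩
      · exact .inr ⟨.inl (by rwa [hpi u hu0 h]), .inr (by rwa [hzero v hv0 h'])⟩
      · exact .inl ⟨hu0, hv0, .inr ⟨h, h'⟩⟩
    · exact .inr ⟨.inr (hint v hvi hv0).1, .inr (hint v hvi hv0).2⟩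
  · exact .inr ⟨.inl (hint u hui hu0).1, .inl (hint u hui hu0).2⟩

lemma norm_one_add_lt_of_abs_rootPhase_lt (hp : 0 < p) (hpN : p < N) (hu : OffSegment u)
    (hv : OffSegment v) (hlevel : ‖betheMap N p u‖ = ‖betheMap N p v‖)
    (hphase : |rootPhase N p u| < |rootPhase N p v|) : ‖1 + v‖ < ‖1 + u‖ := by
  obtain ⟨u', hu', hui, hphu, hlu, hnu, -⟩ := hu.exists_upper hp hpN
  obtain ⟨v', hv', hvi, hphv, hlv, hnv, -⟩ := hv.exists_upper hp hpN
  rw [← hphu, ← hphv] at hphase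
  rw [← hlu, ← hlv] at hlevel
  rw [← hnu, ← hnv]
  have hne : u' ≠ v' := fun h => hphase.ne (h ▸ rfl)
  rcases hu'.same_ray_or hv' hui hvi with ⟨hu0, hv0, hray⟩ | ⟨h0, hπ⟩
  · exact absurd (eq_of_norm_betheMap_eq_of_im_eq_zero hp hpN hu0 hv0 hlevel hray) hne
  have key := rootPhase_sub_mul_log_neg hp hpN hne hui hvi hu'.ne_one hv'.ne_one hu'.ne_neg_one
    hv'.ne_neg_one h0 hπ hlevel
  have hlog := sub_neg.1 (neg_of_mul_neg_right key (sub_pos.2 hphase).le)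
  rw [add_comm 1 v', add_comm 1 u']
  have hpos : ∀ w : ℂ, OffSegment w → 0 < ‖w + 1‖ := fun w hw =>
    norm_pos_iff.2 fun h => hw.ne_neg_one (eq_neg_of_add_eq_zero_left h)
  exact (Real.log_lt_log_iff (hpos v' hv') (hpos u' hu')).1 hlog

lemma eq_of_rootPhase_eq (hp : 0 < p) (hpN : p < N) (hu : OffSegment u) (hv : OffSegment v)
    (hlevel : ‖betheMap N p u‖ = ‖betheMap N p v‖)
    (hphase : rootPhase N p u = rootPhase N p v) : u = v := by
  obtain ⟨u', hu', hui, hphu, hlu, -, hueq⟩ := hu.exists_upper hp hpN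
  obtain ⟨v', hv', hvi, hphv, hlv, -, hveq⟩ := hv.exists_upper hp hpN
  suffices u' = v' by rw [hueq, hveq, hphase, this]
  have hlevel' : ‖betheMap N p u'‖ = ‖betheMap N p v'‖ := by rw [hlu, hlv, hlevel]
  rcases hu'.same_ray_or hv' hui hvi with ⟨hu0, hv0, hray⟩ | ⟨h0, hπ⟩
  · exact eq_of_norm_betheMap_eq_of_im_eq_zero hp hpN hu0 hv0 hlevel' hray
  by_contra hne
  have key := rootPhase_sub_mul_log_neg hp hpN hne hui hvi hu'.ne_one hv'.ne_one hu'.ne_neg_one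
    hv'.ne_neg_one h0 hπ hlevel'
  rw [hphu, hphv, hphase, sub_self, zero_mul] at key
  exact lt_irrefl _ key

/-! ### The labelled roots off the positive axis -/

section SlitRoot

open Polynomial

variable {j : ℕ} {C : ℂ}

lemma offSegment_of_betheMap_eq (hC : -C ∈ Complex.slitPlane) (hu : betheMap N p u = C) :
    OffSegment u := by
  by_contra h
  simp only [OffSegment, not_or, not_not, not_lt] at h
  obtain ⟨him, hle, hge⟩ := h
  lift u to ℝ using him
  rw [Complex.ofReal_re] at hle hge
  have hC' : C = ((1 - u) ^ p * (1 + u) ^ (N - p) : ℝ) := by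
    rw [← hu]; push_cast [betheMap]; rfl
  have hnonneg : 0 ≤ (1 - u) ^ p * (1 + u) ^ (N - p) :=
    mul_nonneg (pow_nonneg (by linarith) _) (pow_nonneg (by linarith) _)
  rw [hC', ← Complex.ofReal_neg, Complex.ofReal_mem_slitPlane] at hC
  linarith

/-- The normalised phase of `-C`, which lies in `(-1, 1)` off the positive axis. -/
def slitAngle (C : ℂ) : ℝ := Complex.arg (-C) / π

lemma slitAngle_mem (hC : -C ∈ Complex.slitPlane) : slitAngle C ∈ Set.Ioo (-1) 1 := by
  rw [slitAngle, Set.mem_Ioo, lt_div_iff₀ Real.pi_pos, div_lt_iff₀ Real.pi_pos, neg_one_mul,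
    one_mul]
  exact ⟨Complex.neg_pi_lt_arg _,
    (Complex.arg_le_pi _).lt_of_ne (Complex.mem_slitPlane_iff_arg.1 hC).1⟩

lemma exists_rootPhase_eq (hpN : p < N) (hC : -C ∈ Complex.slitPlane)
    (hu : betheMap N p u = C) :
    ∃ m : ℤ, rootPhase N p u = -(p : ℝ) + 1 + slitAngle C + 2 * m := by
  have hoff := offSegment_of_betheMap_eq hC hu
  have h₁ : u - 1 ≠ 0 := sub_ne_zero.2 hoff.ne_one
  have h₂ : u + 1 ≠ 0 := fun h => hoff.ne_neg_one (eq_neg_of_add_eq_zero_left h)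
  have hexp : Complex.exp (p * Complex.log (u - 1) + (N - p : ℕ) * Complex.log (u + 1))
      = Complex.exp (π * Complex.I + p * (-(π * Complex.I)) + Complex.log (-C)) := by
    rw [Complex.exp_add, Complex.exp_add, Complex.exp_add, Complex.exp_nat_mul,
      Complex.exp_nat_mul, Complex.exp_nat_mul, Complex.exp_log h₁, Complex.exp_log h₂,
      Complex.exp_log (Complex.slitPlane_ne_zero hC), Complex.exp_neg, Complex.exp_pi_mul_I, ← hu,
      betheMap, ← neg_sub u 1, neg_pow (u - 1), inv_neg, inv_one, add_comm 1 u]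
    have hsign : ((-1 : ℂ) ^ p) * (-1) ^ p = 1 := by rw [← mul_pow]; simp
    linear_combination (-(u - 1) ^ p * (u + 1) ^ (N - p)) * hsign
  obtain ⟨m, hm⟩ := Complex.exp_eq_exp_iff_exists_int.1 hexp
  have him : p * (u - 1).arg + ((N : ℝ) - p) * (u + 1).arg
      = π + -(p * π) + (-C).arg + m * (2 * π) := by
    simpa [Complex.log_im, Nat.cast_sub hpN.le] using congrArg Complex.im hm
  refine ⟨m, ?_⟩
  rw [rootPhase_eq_div, slitAngle, him]
  field_simp
  ring

lemma inPhaseInterval_iff {θ : ℝ} (hθ : θ ∈ Set.Ioo (-1 : ℝ) 1) (m : ℤ) :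
    InPhaseInterval N p j (-(p : ℝ) + 1 + θ + 2 * m) ↔ ((m + 1 : ℤ) : ZMod N) = (j : ℤ) := by
  rw [ZMod.intCast_eq_intCast_iff_dvd_sub]
  refine exists_congr fun k => ⟨fun ⟨hlo, hhi⟩ => ?_, fun h => ?_⟩
  · have h₁ : ((m + N * k : ℤ) : ℝ) < (j : ℤ) := by push_cast; linarith [hθ.1]
    have h₂ : ((j : ℤ) : ℝ) < (m + N * k + 2 : ℤ) := by push_cast; linarith [hθ.2]
    rw [Int.cast_lt] at h₁ h₂
    omega
  · have h' : (j : ℝ) = m + 1 + N * k := by exact_mod_cast eq_add_of_sub_eq' h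
    rw [h']
    constructor <;> linarith [hθ.1, hθ.2]

lemma eq_of_intCast_eq (hp : 0 < p) (hpN : p < N) (hC : -C ∈ Complex.slitPlane)
    (hu : betheMap N p u = C) (hv : betheMap N p v = C) {m n : ℤ}
    (hm : rootPhase N p u = -(p : ℝ) + 1 + slitAngle C + 2 * m)
    (hn : rootPhase N p v = -(p : ℝ) + 1 + slitAngle C + 2 * n)
    (hmn : (m : ZMod N) = n) : u = v := by
  have hou := offSegment_of_betheMap_eq hC hu
  have hov := offSegment_of_betheMap_eq hC hv
  obtain ⟨hu₁, hu₂⟩ := hou.rootPhase_mem_Ioc hp hpN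
  obtain ⟨hv₁, hv₂⟩ := hov.rootPhase_mem_Ioc hp hpN
  have hlt : |((n - m : ℤ) : ℝ)| < (N : ℤ) := by
    push_cast; rw [abs_lt]; constructor <;> linarith
  have hzero : n - m = 0 :=
    Int.eq_zero_of_abs_lt_dvd ((ZMod.intCast_eq_intCast_iff_dvd_sub m n N).1 hmn)
      (by exact_mod_cast hlt)
  refine eq_of_rootPhase_eq hp hpN hou hov (by rw [hu, hv]) ?_
  rw [hm, hn, sub_eq_zero.1 hzero]

/-- The polynomial `(1 - X) ^ p * (1 + X) ^ (N - p)` of `betheMap`. -/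
def bethePoly (N p : ℕ) : ℂ[X] := (1 - X) ^ p * (1 + X) ^ (N - p)

lemma eval_bethePoly (N p : ℕ) (u : ℂ) : (bethePoly N p).eval u = betheMap N p u := by
  simp [bethePoly, betheMap]

lemma natDegree_bethePoly (hpN : p ≤ N) : (bethePoly N p).natDegree = N := by
  have h₁ : (1 - X : ℂ[X]) = -(X - Polynomial.C 1) := by simp
  have h₂ : (1 + X : ℂ[X]) = X + Polynomial.C 1 := by simp [add_comm]
  rw [bethePoly, h₁, h₂, natDegree_mul (pow_ne_zero _ (neg_ne_zero.2 (X_sub_C_ne_zero 1)))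
    (pow_ne_zero _ (X_add_C_ne_zero 1)), natDegree_pow, natDegree_pow, natDegree_neg,
    natDegree_X_sub_C, natDegree_X_add_C, mul_one, mul_one, Nat.add_sub_cancel' hpN]

lemma bethePoly_sub_C_ne_zero (hp : 0 < p) (hpN : p < N) (C : ℂ) :
    bethePoly N p - Polynomial.C C ≠ 0 := by
  refine ne_zero_of_natDegree_gt (n := 0) ?_
  rw [natDegree_sub_C, natDegree_bethePoly hpN.le]
  exact hp.trans hpN

lemma one_sub_mul_one_add_mul_eval_derivative (hp : 0 < p) (hpN : p < N) (u : ℂ) :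
    (1 - u) * (1 + u) * (derivative (bethePoly N p)).eval u =
      betheMap N p u * (N - 2 * p - N * u) := by
  obtain ⟨q, rfl⟩ := Nat.exists_eq_add_of_lt hp
  obtain ⟨n, rfl⟩ := Nat.exists_eq_add_of_lt hpN
  rw [bethePoly, betheMap, zero_add, add_assoc (q + 1) n 1, Nat.add_sub_cancel_left]
  simp only [derivative_mul, derivative_pow, Nat.cast_add, Nat.cast_one, map_add, map_natCast,
    map_one, add_tsub_cancel_right, derivative_sub, derivative_one, derivative_X, zero_sub,
    mul_neg, mul_one, neg_mul, zero_add, eval_add, eval_neg, eval_mul,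
    eval_natCast, eval_one, eval_pow, eval_sub, eval_X]
  ring

lemma nodup_roots_bethePoly_sub_C (hp : 0 < p) (hpN : p < N) (hC : -C ∈ Complex.slitPlane) :
    (bethePoly N p - Polynomial.C C).roots.Nodup := by
  rw [Multiset.nodup_iff_count_le_one]
  intro u
  rw [count_roots]
  by_contra! hmult
  obtain ⟨hroot, hderiv⟩ :=
    (one_lt_rootMultiplicity_iff_isRoot (bethePoly_sub_C_ne_zero hp hpN C)).1 hmult
  have hu : betheMap N p u = C := by
    simpa [IsRoot, eval_bethePoly, sub_eq_zero] using hroot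
  have hC0 : C ≠ 0 := by rintro rfl; simp at hC
  have hcrit := one_sub_mul_one_add_mul_eval_derivative hp hpN u
  rw [show (derivative (bethePoly N p)).eval u = 0 by simpa [IsRoot] using hderiv, mul_zero, hu,
    zero_eq_mul, or_iff_right hC0] at hcrit
  have hN : (0 : ℝ) < N := Nat.cast_pos.2 (hp.trans hpN)
  have hN' : (N : ℂ) ≠ 0 := mod_cast hN.ne'
  have hu' : u = ((1 - 2 * (p / N) : ℝ) : ℂ) := by
    push_cast; field_simp; linear_combination -hcrit
  have hlt : (p : ℝ) / N < 1 := (div_lt_one hN).2 (Nat.cast_lt.2 hpN)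
  have hpos : 0 < (p : ℝ) / N := div_pos (Nat.cast_pos.2 hp) hN
  have hoff := offSegment_of_betheMap_eq hC hu
  rw [hu', OffSegment, Complex.ofReal_re, Complex.ofReal_im] at hoff
  rcases hoff with h | h | h
  · exact h rfl
  · linarith
  · linarith

lemma exists_betheMap_eq_of_inPhaseInterval (hp : 0 < p) (hpN : p < N)
    (hC : -C ∈ Complex.slitPlane) (j : ℕ) :
    ∃ u : ℂ, betheMap N p u = C ∧ InPhaseInterval N p j (rootPhase N p u) := by
  classical
  have : NeZero N := ⟨(hp.trans hpN).ne'⟩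
  set R := (bethePoly N p - Polynomial.C C).roots.toFinset with hR
  have hcard : R.card = N := by
    rw [hR, Multiset.toFinset_card_of_nodup (nodup_roots_bethePoly_sub_C hp hpN hC),
      IsAlgClosed.card_roots_eq_natDegree, natDegree_sub_C, natDegree_bethePoly hpN.le]
  have hmem : ∀ u ∈ R, betheMap N p u = C := fun u hu => by
    rw [hR, Multiset.mem_toFinset, mem_roots (bethePoly_sub_C_ne_zero hp hpN C)] at hu
    simpa [IsRoot, eval_bethePoly, sub_eq_zero] using hu
  choose! m hm using fun u (hu : betheMap N p u = C) => exists_rootPhase_eq hpN hC hu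
  have hinj : Set.InjOn (fun u => ((m u + 1 : ℤ) : ZMod N)) R := fun u hu v hv huv =>
    eq_of_intCast_eq hp hpN hC (hmem u hu) (hmem v hv) (hm u (hmem u hu)) (hm v (hmem v hv))
      (by simpa using huv)
  have huniv : R.image (fun u => ((m u + 1 : ℤ) : ZMod N)) = Finset.univ :=
    Finset.eq_univ_of_card _ (by rw [Finset.card_image_of_injOn hinj, hcard, ZMod.card])
  obtain ⟨u, hu, huj⟩ := Finset.mem_image.1 (huniv ▸ Finset.mem_univ ((j : ℤ) : ZMod N))
  refine ⟨u, hmem u hu, ?_⟩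
  rw [hm u (hmem u hu)]
  exact (inPhaseInterval_iff (slitAngle_mem hC) _).2 huj

lemma slitRoot_spec (hp : 0 < p) (hpN : p < N) (hC : -C ∈ Complex.slitPlane) (j : ℕ) :
    betheMap N p (slitRoot N p j C) = C ∧
      InPhaseInterval N p j (rootPhase N p (slitRoot N p j C)) :=
  Classical.epsilon_spec (exists_betheMap_eq_of_inPhaseInterval hp hpN hC j)

lemma slitRoot_eq (hp : 0 < p) (hpN : p < N) (hC : -C ∈ Complex.slitPlane)
    (hu : betheMap N p u = C) (hj : InPhaseInterval N p j (rootPhase N p u)) :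
    slitRoot N p j C = u := by
  obtain ⟨hroot, hphase⟩ := slitRoot_spec hp hpN hC j
  obtain ⟨m, hm⟩ := exists_rootPhase_eq hpN hC hroot
  obtain ⟨n, hn⟩ := exists_rootPhase_eq hpN hC hu
  rw [hm, inPhaseInterval_iff (slitAngle_mem hC)] at hphase
  rw [hn, inPhaseInterval_iff (slitAngle_mem hC)] at hj
  exact eq_of_intCast_eq hp hpN hC hroot hu hm hn (by simpa using hphase.trans hj.symm)

lemma offSegment_slitRoot (hp : 0 < p) (hpN : p < N) (hC : -C ∈ Complex.slitPlane) (j : ℕ) :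
    OffSegment (slitRoot N p j C) :=
  offSegment_of_betheMap_eq hC (slitRoot_spec hp hpN hC j).1

lemma rootPhase_slitRoot_eq_or (hp : 0 < p) (hpN : p < N) (hC : -C ∈ Complex.slitPlane)
    (hj : 1 ≤ j) (hjN : j ≤ N) :
    rootPhase N p (slitRoot N p j C) = -(p : ℝ) + 2 * j - 1 + slitAngle C ∨
      rootPhase N p (slitRoot N p j C) = -(p : ℝ) + 2 * j - 1 + slitAngle C - 2 * N := by
  obtain ⟨hroot, hphase⟩ := slitRoot_spec hp hpN hC j
  obtain ⟨m, hm⟩ := exists_rootPhase_eq hpN hC hroot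
  obtain ⟨hlo, hhi⟩ := (offSegment_slitRoot hp hpN hC j).rootPhase_mem_Ioc hp hpN
  obtain ⟨hθ₁, hθ₂⟩ := slitAngle_mem hC
  rw [hm, inPhaseInterval_iff ⟨hθ₁, hθ₂⟩, ZMod.intCast_eq_intCast_iff_dvd_sub] at hphase
  obtain ⟨k, hk⟩ := hphase
  rw [hm] at hlo hhi
  have hm₁ : ((-N - 2 + p : ℤ) : ℝ) < (2 * m : ℤ) := by push_cast; linarith
  have hm₂ : ((2 * m : ℤ) : ℝ) < (N + p : ℤ) := by push_cast; linarith
  rw [Int.cast_lt] at hm₁ hm₂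
  have : (0 : ℤ) < N := by omega
  have hk₁ : -1 < k := by nlinarith
  have hk₂ : k < 2 := by nlinarith
  have hj' : (j : ℝ) = m + 1 + N * k := by exact_mod_cast eq_add_of_sub_eq' hk
  rw [hm, hj']
  obtain rfl | rfl : k = 0 ∨ k = 1 := by omega
  · left; push_cast; ring
  · right; push_cast; ring

lemma rootPhase_slitRoot_of_le (hp : 0 < p) (hpN : p < N) (hC : -C ∈ Complex.slitPlane)
    (hj : 1 ≤ j) (hjp : j ≤ p) :
    rootPhase N p (slitRoot N p j C) = -(p : ℝ) + 2 * j - 1 + slitAngle C := by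
  refine (rootPhase_slitRoot_eq_or hp hpN hC hj (hjp.trans hpN.le)).resolve_right fun h => ?_
  have hlo := ((offSegment_slitRoot hp hpN hC j).rootPhase_mem_Ioc hp hpN).1
  have : (j : ℝ) ≤ p := Nat.cast_le.2 hjp
  have : (p : ℝ) < N := Nat.cast_lt.2 hpN
  linarith [(slitAngle_mem hC).2]

lemma abs_rootPhase_slitRoot_lt (hp : 0 < p) (hpN : p < N) (hC : -C ∈ Complex.slitPlane)
    (hj : 1 ≤ j) (hjp : j ≤ p) : |rootPhase N p (slitRoot N p j C)| < p := by
  obtain ⟨hθ₁, hθ₂⟩ := slitAngle_mem hC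
  have h₁ : (1 : ℝ) ≤ j := Nat.one_le_cast.2 hj
  have h₂ : (j : ℝ) ≤ p := Nat.cast_le.2 hjp
  rw [rootPhase_slitRoot_of_le hp hpN hC hj hjp, abs_lt]
  constructor <;> linarith

lemma lt_abs_rootPhase_slitRoot (hp : 0 < p) (hpN : p < N) (hC : -C ∈ Complex.slitPlane)
    (hj : p < j) (hjN : j ≤ N) : p < |rootPhase N p (slitRoot N p j C)| := by
  obtain ⟨hθ₁, hθ₂⟩ := slitAngle_mem hC
  have h₁ : (p : ℝ) + 1 ≤ j := by exact_mod_cast hj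
  have h₂ : (j : ℝ) ≤ N := Nat.cast_le.2 hjN
  rw [lt_abs]
  refine (rootPhase_slitRoot_eq_or hp hpN hC (by omega) hjN).imp (fun h => ?_) fun h => ?_ <;>
    rw [h] <;> linarith

lemma injOn_slitRoot (hp : 0 < p) (hpN : p < N) (hC : -C ∈ Complex.slitPlane) :
    Set.InjOn (fun j => slitRoot N p j C) (Finset.Icc 1 N : Finset ℕ) := by
  intro i hi j hj (hij : slitRoot N p i C = slitRoot N p j C)
  rw [Finset.mem_coe, Finset.mem_Icc] at hi hj
  obtain ⟨hi₁, hi₂⟩ : (1 : ℝ) ≤ i ∧ (i : ℝ) ≤ N := by exact_mod_cast hi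
  obtain ⟨hj₁, hj₂⟩ : (1 : ℝ) ≤ j ∧ (j : ℝ) ≤ N := by exact_mod_cast hj
  rw [← Nat.cast_inj (R := ℝ)]
  rcases rootPhase_slitRoot_eq_or hp hpN hC hi.1 hi.2 with h | h <;>
    rcases rootPhase_slitRoot_eq_or hp hpN hC hj.1 hj.2 with h' | h' <;>
    rw [hij, h'] at h <;> linarith

lemma exists_slitRoot_eq_of_abs_rootPhase_lt (hp : 0 < p) (hpN : p < N)
    (hC : -C ∈ Complex.slitPlane) (hu : betheMap N p u = C) (hphase : |rootPhase N p u| < p) :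
    ∃ j ∈ Finset.Icc 1 p, slitRoot N p j C = u := by
  obtain ⟨m, hm⟩ := exists_rootPhase_eq hpN hC hu
  obtain ⟨hθ₁, hθ₂⟩ := slitAngle_mem hC
  rw [abs_lt, hm] at hphase
  have hm₁ : ((-1 : ℤ) : ℝ) < m := by push_cast; linarith [hphase.1]
  have hm₂ : (m : ℝ) < (p : ℤ) := by push_cast; linarith [hphase.2]
  rw [Int.cast_lt] at hm₁ hm₂
  refine ⟨(m + 1).toNat, Finset.mem_Icc.2 ⟨by omega, by omega⟩, slitRoot_eq hp hpN hC hu ?_⟩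
  rw [hm, inPhaseInterval_iff ⟨hθ₁, hθ₂⟩, Int.toNat_of_nonneg (by omega)]

lemma norm_one_add_le (hp : 0 < p) (hpN : p < N) {R : ℝ} (hR : 0 ≤ R)
    (hu : ‖betheMap N p u‖ = R ^ N) : ‖1 + u‖ ≤ R + 2 := by
  by_contra! hlt
  have hsub : R < ‖1 - u‖ := by
    have : ‖1 + u‖ ≤ ‖(2 : ℂ)‖ + ‖1 - u‖ := by
      simpa [← sub_add, show (2 : ℂ) - 1 = 1 by norm_num] using norm_sub_le 2 (1 - u)
    rw [Complex.norm_ofNat] at this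
    linarith
  have : R ^ p * R ^ (N - p) < ‖betheMap N p u‖ := by
    rw [norm_betheMap]
    exact mul_lt_mul'' (pow_lt_pow_left₀ hsub hR hp.ne')
      (pow_lt_pow_left₀ (by linarith) hR (Nat.sub_pos_of_lt hpN).ne') (by positivity)
      (by positivity)
  rw [hu, ← pow_add, Nat.add_sub_cancel' hpN.le] at this
  exact lt_irrefl _ this

end SlitRoot

section PositiveAxis

variable {j : ℕ} {C : ℂ} {c δ : ℝ}

lemma arg_neg_mul_exp (hc : 0 < c) (hδ : δ ∈ Set.Ioo (-π) 0) :
    Complex.arg (-(c * Complex.exp (δ * Complex.I))) = δ + π := by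
  have h : -(c * Complex.exp (δ * Complex.I)) = c * Complex.exp ((δ + π : ℝ) * Complex.I) := by
    push_cast
    rw [add_mul, Complex.exp_add, Complex.exp_pi_mul_I]
    ring
  rw [h, Complex.exp_mul_I, Complex.arg_mul_cos_add_sin_mul_I hc]
  constructor <;> linarith [hδ.1, hδ.2, Real.pi_pos]

lemma neg_mul_exp_mem_slitPlane (hc : 0 < c) (hδ : δ ∈ Set.Ioo (-π) 0) :
    -(c * Complex.exp (δ * Complex.I)) ∈ Complex.slitPlane := by
  rw [Complex.mem_slitPlane_iff_arg, arg_neg_mul_exp hc hδ]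
  exact ⟨by linarith [hδ.2], neg_ne_zero.2
    (mul_ne_zero (Complex.ofReal_ne_zero.2 hc.ne') (Complex.exp_ne_zero _))⟩

lemma slitAngle_mul_exp (hc : 0 < c) (hδ : δ ∈ Set.Ioo (-π) 0) :
    slitAngle (c * Complex.exp (δ * Complex.I)) = 1 + δ / π := by
  rw [slitAngle, arg_neg_mul_exp hc hδ, add_div, div_self Real.pi_ne_zero, add_comm]

lemma norm_mul_exp (hc : 0 < c) (δ : ℝ) : ‖c * Complex.exp (δ * Complex.I)‖ = c := by
  rw [norm_mul, Complex.norm_exp_ofReal_mul_I, Complex.norm_of_nonneg hc.le, mul_one]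

lemma tendsto_of_tendsto_norm {α : Type*} {l : Filter α} {f : α → ℂ} {s t : ℝ}
    (hs : Tendsto (fun x => ‖1 + f x‖) l (𝓝 s)) (ht : Tendsto (fun x => ‖1 - f x‖) l (𝓝 t))
    (hsign : (∀ᶠ x in l, 0 ≤ (f x).im) ∨ ∀ᶠ x in l, (f x).im ≤ 0) :
    ∃ w : ℂ, Tendsto f l (𝓝 w) := by
  have hre (z : ℂ) : z.re = (‖1 + z‖ ^ 2 - ‖1 - z‖ ^ 2) / 4 := by
    rw [Complex.sq_norm, Complex.sq_norm, Complex.normSq_apply, Complex.normSq_apply]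
    simp only [Complex.add_re, Complex.sub_re, Complex.one_re, Complex.add_im, Complex.sub_im,
      Complex.one_im]
    ring
  have him (z : ℂ) : |z.im| = √(‖1 + z‖ ^ 2 - (1 + z.re) ^ 2) := by
    rw [← Real.sqrt_sq_eq_abs, Complex.sq_norm, Complex.normSq_apply]
    congr 1
    simp only [Complex.add_re, Complex.one_re, Complex.add_im, Complex.one_im]
    ring
  have hretendsto : Tendsto (fun x => (f x).re) l (𝓝 ((s ^ 2 - t ^ 2) / 4)) := by
    simpa only [hre] using ((hs.pow 2).sub (ht.pow 2)).div_const 4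
  have habs : Tendsto (fun x => |(f x).im|) l
      (𝓝 √(s ^ 2 - (1 + (s ^ 2 - t ^ 2) / 4) ^ 2)) := by
    simpa only [him] using ((hs.pow 2).sub ((hretendsto.const_add 1).pow 2)).sqrt
  obtain ⟨y, hy⟩ : ∃ y, Tendsto (fun x => (f x).im) l (𝓝 y) := by
    rcases hsign with h | h
    · exact ⟨_, habs.congr' (h.mono fun x hx => abs_of_nonneg hx)⟩
    · exact ⟨_, habs.neg.congr' (h.mono fun x hx => by rw [abs_of_nonpos hx, neg_neg])⟩
  exact ⟨_, (Complex.equivRealProdCLM.symm.continuous.tendsto _).comp (hretendsto.prodMk_nhds hy)⟩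

lemma exists_rootPhase_slitRoot_mul_exp (hp : 0 < p) (hpN : p < N) (hc : 0 < c) (j : ℕ) :
    ∃ e : ℤ, ∀ δ ∈ Set.Ioo (-π) 0,
      rootPhase N p (slitRoot N p j (c * Complex.exp (δ * Complex.I))) = e + δ / π := by
  have hmem : ∀ δ ∈ Set.Ioo (-π) 0, ∃ m : ℤ, ((m + 1 : ℤ) : ZMod N) = (j : ℤ) ∧
      rootPhase N p (slitRoot N p j (c * Complex.exp (δ * Complex.I))) =
        (2 + 2 * m - p : ℤ) + δ / π ∧ -(N : ℤ) < 2 + 2 * m - p ∧ 2 + 2 * m - p ≤ N := by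
    intro δ hδ
    have hslit := neg_mul_exp_mem_slitPlane hc hδ
    obtain ⟨hroot, hphase⟩ := slitRoot_spec hp hpN hslit j
    obtain ⟨m, hm⟩ := exists_rootPhase_eq hpN hslit hroot
    obtain ⟨hlo, hhi⟩ := (offSegment_slitRoot hp hpN hslit j).rootPhase_mem_Ioc hp hpN
    rw [hm] at hphase hlo hhi
    rw [inPhaseInterval_iff (slitAngle_mem hslit)] at hphase
    rw [slitAngle_mul_exp hc hδ] at hm hlo hhi
    have hδ₀ : δ / π < 0 := div_neg_of_neg_of_pos hδ.2 Real.pi_pos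
    have hδ₁ : -1 < δ / π := by rw [lt_div_iff₀ Real.pi_pos]; linarith [hδ.1]
    refine ⟨m, hphase, by rw [hm]; push_cast; ring, ?_, Int.lt_add_one_iff.1 ?_⟩
    · exact_mod_cast (by linarith : -(N : ℝ) < 2 + 2 * m - p)
    · exact_mod_cast (by linarith : (2 : ℝ) + 2 * m - p < N + 1)
  have hmid : -(π / 2) ∈ Set.Ioo (-π) 0 := by constructor <;> linarith [Real.pi_pos]
  obtain ⟨m₀, hm₀, -, hlo₀, hhi₀⟩ := hmem _ hmid
  refine ⟨2 + 2 * m₀ - p, fun δ hδ => ?_⟩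
  obtain ⟨m, hm, hphase, hlo, hhi⟩ := hmem δ hδ
  rw [← hm₀, ZMod.intCast_eq_intCast_iff_dvd_sub] at hm
  obtain ⟨k, hk⟩ := hm
  have hk₀ : k = 0 := by
    have h₁ : (N : ℤ) * k < N * 1 := by omega
    have h₂ : (N : ℤ) * (-1) < N * k := by omega
    have h₃ := lt_of_mul_lt_mul_left h₁ (Int.natCast_nonneg N)
    have h₄ := lt_of_mul_lt_mul_left h₂ (Int.natCast_nonneg N)
    omega
  rw [hphase, show m = m₀ by rw [hk₀] at hk; omega]

lemma norm_slitRoot_mul_exp (hp : 0 < p) (hpN : p < N) (hc : 0 < c) (j : ℕ)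
    (hδ : δ ∈ Set.Ioo (-π) 0) :
    ‖betheMap N p (slitRoot N p j (c * Complex.exp (δ * Complex.I)))‖ = c := by
  rw [(slitRoot_spec hp hpN (neg_mul_exp_mem_slitPlane hc hδ) j).1, norm_mul_exp hc]

/-- Along the arc the absolute phase is monotone, and the larger it is, the smaller `‖1 + u‖`. -/
lemma monotoneOn_or_antitoneOn_norm_slitRoot (hp : 0 < p) (hpN : p < N) (hc : 0 < c) (j : ℕ) :
    (MonotoneOn (fun δ : ℝ => ‖1 + slitRoot N p j (c * Complex.exp (δ * Complex.I))‖)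
        (Set.Ioo (-π) 0) ∧
      ∀ δ ∈ Set.Ioo (-π) 0, (slitRoot N p j (c * Complex.exp (δ * Complex.I))).im ≤ 0) ∨
    (AntitoneOn (fun δ : ℝ => ‖1 + slitRoot N p j (c * Complex.exp (δ * Complex.I))‖)
        (Set.Ioo (-π) 0) ∧
      ∀ δ ∈ Set.Ioo (-π) 0, 0 ≤ (slitRoot N p j (c * Complex.exp (δ * Complex.I))).im) := by
  obtain ⟨e, he⟩ := exists_rootPhase_slitRoot_mul_exp hp hpN hc j
  have hoff {δ : ℝ} (hδ : δ ∈ Set.Ioo (-π) 0) :=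
    offSegment_slitRoot hp hpN (neg_mul_exp_mem_slitPlane hc hδ) j
  have hlt {x y : ℝ} (hx : x ∈ Set.Ioo (-π) 0) (hy : y ∈ Set.Ioo (-π) 0)
      (habs : |e + x / π| < |e + y / π|) :=
    (norm_one_add_lt_of_abs_rootPhase_lt hp hpN (hoff hx) (hoff hy)
      (by rw [norm_slitRoot_mul_exp hp hpN hc j hx, norm_slitRoot_mul_exp hp hpN hc j hy])
      (by rwa [he x hx, he y hy])).le
  have hδ₀ {δ : ℝ} (hδ : δ ∈ Set.Ioo (-π) 0) : δ / π < 0 :=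
    div_neg_of_neg_of_pos hδ.2 Real.pi_pos
  rcases le_or_gt e 0 with h₀ | h₀
  · have hneg {δ : ℝ} (hδ : δ ∈ Set.Ioo (-π) 0) : e + δ / π < 0 := by
      linarith [hδ₀ hδ, (Int.cast_nonpos (R := ℝ)).2 h₀]
    refine Or.inl ⟨fun x hx y hy hxy => ?_, fun δ hδ => ?_⟩
    · rcases hxy.eq_or_lt with rfl | hxy
      · exact le_rfl
      · refine hlt hy hx ?_
        rw [abs_of_neg (hneg hx), abs_of_neg (hneg hy)]
        linarith [div_lt_div_of_pos_right hxy Real.pi_pos]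
    · exact (((hoff hδ).rootPhase_lt_zero_iff hp hpN).1 (he δ hδ ▸ hneg hδ)).le
  · have hpos {δ : ℝ} (hδ : δ ∈ Set.Ioo (-π) 0) : 0 < e + δ / π := by
      have h₁ : (1 : ℝ) ≤ e := by exact_mod_cast h₀
      have h₂ : -1 < δ / π := by rw [lt_div_iff₀ Real.pi_pos]; linarith [hδ.1]
      linarith
    refine Or.inr ⟨fun x hx y hy hxy => ?_, fun δ hδ => ?_⟩
    · rcases hxy.eq_or_lt with rfl | hxy
      · exact le_rfl
      · refine hlt hx hy ?_
        rw [abs_of_pos (hpos hx), abs_of_pos (hpos hy)]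
        linarith [div_lt_div_of_pos_right hxy Real.pi_pos]
    · exact not_lt.1 fun h => (hpos hδ).not_gt <|
        he δ hδ ▸ ((hoff hδ).rootPhase_lt_zero_iff hp hpN).2 h

lemma tendsto_norm_one_sub_of_tendsto_norm_one_add {α : Type*} {l : Filter α} [l.NeBot]
    {f : α → ℂ} {s : ℝ} (hp : 0 < p) (hpN : p < N) (hc : 0 < c)
    (hf : ∀ᶠ x in l, ‖betheMap N p (f x)‖ = c) (hs : Tendsto (fun x => ‖1 + f x‖) l (𝓝 s)) :
    ∃ t, Tendsto (fun x => ‖1 - f x‖) l (𝓝 t) := by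
  have hn : N - p ≠ 0 := (Nat.sub_pos_of_lt hpN).ne'
  simp only [norm_betheMap] at hf
  have hs₀ : s ≠ 0 := by
    rintro rfl
    have htendsto := ((hs.const_add 2).pow p).mul (hs.pow (N - p))
    rw [zero_pow hn, mul_zero] at htendsto
    refine hc.not_ge (ge_of_tendsto htendsto (hf.mono fun x hx => ?_))
    rw [← hx]
    gcongr
    exact norm_one_sub_le_two_add (f x)
  refine ⟨(c / s ^ (N - p)) ^ (p⁻¹ : ℝ), ((tendsto_const_nhds.div (hs.pow _)
    (pow_ne_zero _ hs₀)).rpow_const (Or.inr (by positivity))).congr' (hf.mono fun x hx => ?_)⟩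
  have hx₀ : ‖1 + f x‖ ^ (N - p) ≠ 0 := right_ne_zero_of_mul (hx ▸ hc.ne')
  simp only [Pi.div_apply]
  rw [← hx, mul_div_cancel_right₀ _ hx₀, Real.pow_rpow_inv_natCast (norm_nonneg _) hp.ne']

lemma exists_tendsto_slitRoot_mul_exp (hp : 0 < p) (hpN : p < N) (hc : 0 < c) (j : ℕ) :
    ∃ w : ℂ, Tendsto (fun δ : ℝ => slitRoot N p j (c * Complex.exp (δ * Complex.I)))
      (𝓝[<] 0) (𝓝 w) := by
  have hIoo : Set.Ioo (-π) 0 ∈ 𝓝[<] (0 : ℝ) := Ioo_mem_nhdsLT (neg_neg_of_pos Real.pi_pos)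
  have hnonempty : (Set.Ioo (-π) 0).Nonempty := Set.nonempty_Ioo.2 (neg_neg_of_pos Real.pi_pos)
  have hnorm : ∀ᶠ δ : ℝ in 𝓝[<] 0,
      ‖betheMap N p (slitRoot N p j (c * Complex.exp (δ * Complex.I)))‖ = c :=
    mem_of_superset hIoo fun δ hδ => norm_slitRoot_mul_exp hp hpN hc j hδ
  obtain ⟨⟨s, hs⟩, hsign⟩ : (∃ s, Tendsto (fun δ : ℝ =>
      ‖1 + slitRoot N p j (c * Complex.exp (δ * Complex.I))‖) (𝓝[<] 0) (𝓝 s)) ∧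
      ((∀ᶠ δ : ℝ in 𝓝[<] 0, 0 ≤ (slitRoot N p j (c * Complex.exp (δ * Complex.I))).im) ∨
        ∀ᶠ δ : ℝ in 𝓝[<] 0, (slitRoot N p j (c * Complex.exp (δ * Complex.I))).im ≤ 0) := by
    rcases monotoneOn_or_antitoneOn_norm_slitRoot hp hpN hc j with
      ⟨hmono, hsign⟩ | ⟨hanti, hsign⟩
    · refine ⟨⟨_, hmono.tendsto_nhdsWithin_Ioo_left hnonempty ⟨c ^ (N⁻¹ : ℝ) + 2, ?_⟩⟩,
        Or.inr (mem_of_superset hIoo hsign)⟩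
      rintro _ ⟨δ, hδ, rfl⟩
      refine norm_one_add_le hp hpN (by positivity) ?_
      rw [norm_slitRoot_mul_exp hp hpN hc j hδ, Real.rpow_inv_natCast_pow hc.le (by omega)]
    · refine ⟨⟨_, hanti.tendsto_nhdsWithin_Ioo_left hnonempty ⟨0, ?_⟩⟩,
        Or.inl (mem_of_superset hIoo hsign)⟩
      rintro _ ⟨δ, -, rfl⟩
      exact norm_nonneg _
  obtain ⟨t, ht⟩ := tendsto_norm_one_sub_of_tendsto_norm_one_add hp hpN hc hnorm hs
  exact tendsto_of_tendsto_norm hs ht hsign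

lemma root_eq_slitRoot (hC : -C ∈ Complex.slitPlane) : root N p j C = slitRoot N p j C := by
  have hC₀ : C ≠ 0 := neg_ne_zero.1 (Complex.slitPlane_ne_zero hC)
  rw [root, if_neg hC₀, if_neg]
  rintro ⟨hre, him⟩
  rcases Complex.mem_slitPlane_iff.1 hC with h | h
  · exact hre.not_gt (neg_pos.1 h)
  · exact h (neg_eq_zero.2 him)

lemma tendsto_slitRoot_root (hp : 0 < p) (hpN : p < N) (hc : 0 < c) (j : ℕ) :
    Tendsto (fun δ : ℝ => slitRoot N p j (c * Complex.exp (δ * Complex.I)))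
      (𝓝[<] 0) (𝓝 (root N p j c)) := by
  rw [root, if_neg (Complex.ofReal_ne_zero.2 hc.ne'), if_pos ⟨hc, Complex.ofReal_im c⟩]
  exact tendsto_nhds_limUnder (exists_tendsto_slitRoot_mul_exp hp hpN hc j)

lemma neg_mem_slitPlane_or_exists_pos (hC : C ≠ 0) :
    -C ∈ Complex.slitPlane ∨ ∃ c : ℝ, 0 < c ∧ C = c := by
  rw [or_iff_not_imp_left, Complex.mem_slitPlane_iff, not_or, not_lt, not_not, Complex.neg_re,
    Complex.neg_im, neg_nonpos, neg_eq_zero]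
  rintro ⟨hre, him⟩
  exact ⟨C.re, hre.lt_of_ne fun h => hC (Complex.ext h.symm him), Complex.ext rfl him⟩

lemma root_mem_of_isClosed (hp : 0 < p) (hpN : p < N) (hC : C ≠ 0) {S : Set ((ℕ → ℂ) × ℂ)}
    (hS : IsClosed S)
    (h : ∀ D : ℂ, -D ∈ Complex.slitPlane → ‖D‖ = ‖C‖ → (fun j => slitRoot N p j D, D) ∈ S) :
    (fun j => root N p j C, C) ∈ S := by
  rcases neg_mem_slitPlane_or_exists_pos hC with hslit | ⟨c, hc, rfl⟩
  · simpa only [root_eq_slitRoot hslit] using h C hslit rfl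
  · have hroots : Tendsto (fun (δ : ℝ) j => slitRoot N p j (c * Complex.exp (δ * Complex.I)))
        (𝓝[<] 0) (𝓝 fun j => root N p j c) :=
      tendsto_pi_nhds.2 (tendsto_slitRoot_root hp hpN hc)
    have hvalue : Tendsto (fun δ : ℝ => c * Complex.exp (δ * Complex.I)) (𝓝[<] 0) (𝓝 c) := by
      have hcont : Continuous fun δ : ℝ => c * Complex.exp (δ * Complex.I) := by fun_prop
      simpa using (hcont.tendsto 0).mono_left nhdsWithin_le_nhds
    refine hS.mem_of_tendsto (hroots.prodMk_nhds hvalue) ?_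
    filter_upwards [Ioo_mem_nhdsLT (neg_neg_of_pos Real.pi_pos)] with δ hδ
    exact h _ (neg_mul_exp_mem_slitPlane hc hδ)
      ((norm_mul_exp hc δ).trans (Complex.norm_of_nonneg hc.le).symm)

lemma continuous_betheMap (N p : ℕ) : Continuous (betheMap N p) := by
  unfold betheMap
  fun_prop

lemma betheMap_root (hp : 0 < p) (hpN : p < N) (hC : C ≠ 0) (j : ℕ) :
    betheMap N p (root N p j C) = C :=
  root_mem_of_isClosed hp hpN hC (S := {q | betheMap N p (q.1 j) = q.2})
    (isClosed_eq ((continuous_betheMap N p).comp (by fun_prop)) continuous_snd)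
    fun _ hD _ => (slitRoot_spec hp hpN hD j).1

end PositiveAxis

section SymmetricFunctions

open Polynomial

lemma exists_eval_eq_aeval_of_isSymmetric {F : Type*} [Field F] {P : F[X]}
    (hP : 0 < P.natDegree) {f : MvPolynomial (Fin P.natDegree) F} (hf : f.IsSymmetric) :
    ∃ T : F[X], ∀ (c : F) (w : Fin P.natDegree → F),
      (P - C c).roots = Finset.univ.val.map w → MvPolynomial.aeval w f = T.eval c := by
  obtain ⟨g, hg⟩ := MvPolynomial.esymmAlgHom_surjective (σ := Fin P.natDegree) (R := F)
    (n := P.natDegree) (Fintype.card_fin _).le ⟨f, hf⟩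
  have hgf : MvPolynomial.aeval
      (fun i : Fin P.natDegree => MvPolynomial.esymm (Fin P.natDegree) F (i + 1)) g = f := by
    rw [← MvPolynomial.esymmAlgHom_apply, hg]
  have hcoeff (c : F) (k : ℕ) : (P - C c).coeff k = P.coeff k - if k = 0 then c else 0 := by
    rw [coeff_sub, coeff_C]
  have hlc (c : F) : (P - C c).leadingCoeff = P.leadingCoeff := by
    rw [leadingCoeff, natDegree_sub_C, hcoeff, if_neg hP.ne', sub_zero, leadingCoeff]
  have hlc₀ : P.leadingCoeff ≠ 0 := leadingCoeff_ne_zero.2 (ne_zero_of_natDegree_gt hP)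
  let e (i : Fin P.natDegree) : F[X] := C ((P.leadingCoeff * (-1) ^ (i + 1 : ℕ))⁻¹) *
    (C (P.coeff (P.natDegree - (i + 1))) - if P.natDegree - (i + 1 : ℕ) = 0 then X else 0)
  refine ⟨MvPolynomial.aeval e g, fun c w hw => ?_⟩
  have hvieta (i : Fin P.natDegree) :
      MvPolynomial.aeval w (MvPolynomial.esymm (Fin P.natDegree) F (i + 1)) = aeval c (e i) := by
    have hcard : (P - C c).roots.card = (P - C c).natDegree := by
      rw [hw, natDegree_sub_C, Multiset.card_map, Finset.card_val, Finset.card_univ,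
        Fintype.card_fin]
    have h := coeff_eq_esymm_roots_of_card hcard (k := P.natDegree - (i + 1))
      (by rw [natDegree_sub_C]; omega)
    rw [hw, hlc, natDegree_sub_C, ← MvPolynomial.aeval_esymm_eq_multiset_esymm (Fin P.natDegree) F,
      show P.natDegree - (P.natDegree - (i + 1 : ℕ)) = i + 1 by omega, hcoeff] at h
    have hsign : (-1 : F) ^ (i + 1 : ℕ) ≠ 0 := pow_ne_zero _ (neg_ne_zero.2 one_ne_zero)
    rw [coe_aeval_eq_eval, eval_mul, eval_C, eval_sub, eval_C, apply_ite (eval c), eval_X,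
      eval_zero, h]
    field_simp
  rw [← hgf, ← coe_aeval_eq_eval, ← AlgHom.comp_apply, ← AlgHom.comp_apply,
    MvPolynomial.comp_aeval, MvPolynomial.comp_aeval]
  exact congrArg (fun w => MvPolynomial.aeval w g) (funext hvieta)

lemma isSymmetric_aeval_aeval_X {R σ : Type*} [CommRing R] {f : MvPolynomial σ R}
    (hf : f.IsSymmetric) (q : R[X]) :
    (MvPolynomial.aeval (fun i => aeval (MvPolynomial.X (R := R) i) q) f).IsSymmetric := by
  intro e
  rw [← AlgHom.comp_apply, MvPolynomial.comp_aeval]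
  conv_rhs => rw [← hf e, MvPolynomial.aeval_rename]
  congr 2
  funext i
  rw [Function.comp_apply, ← aeval_algHom_apply, MvPolynomial.rename_X]

lemma exists_eval_eq_esymm_map_roots {F : Type*} [Field F] [IsAlgClosed F] {P : F[X]}
    (hP : 0 < P.natDegree) (q : F[X]) (n : ℕ) :
    ∃ T : F[X], ∀ c : F, ((P - C c).roots.map (eval · q)).esymm n = T.eval c := by
  obtain ⟨T, hT⟩ := exists_eval_eq_aeval_of_isSymmetric hP
    (isSymmetric_aeval_aeval_X (MvPolynomial.esymm_isSymmetric (Fin P.natDegree) F n) q)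
  refine ⟨T, fun c => ?_⟩
  have hcard : (P - C c).roots.toList.length = P.natDegree := by
    rw [Multiset.length_toList, IsAlgClosed.card_roots_eq_natDegree, natDegree_sub_C]
  obtain ⟨w, hw⟩ : ∃ w : Fin P.natDegree → F, (P - C c).roots = Finset.univ.val.map w :=
    ⟨fun i => (P - C c).roots.toList.get (i.cast hcard.symm), by
      rw [Fin.univ_val_map, ← List.ofFn_congr hcard, List.ofFn_get, Multiset.coe_toList]⟩
  rw [← hT c w hw, hw, Multiset.map_map, ← AlgHom.comp_apply, MvPolynomial.comp_aeval,
    Function.comp_def, ← MvPolynomial.aeval_esymm_eq_multiset_esymm (Fin P.natDegree) F]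
  congr 2
  funext i
  rw [← aeval_algHom_apply, MvPolynomial.aeval_X, coe_aeval_eq_eval]

lemma roots_bethePoly (N p : ℕ) :
    (bethePoly N p).roots = Multiset.replicate p 1 + Multiset.replicate (N - p) (-1) := by
  have h₁ : (1 - X : ℂ[X]) = -(X - C 1) := by simp
  have h₂ : (1 + X : ℂ[X]) = X - C (-1) := by simp [add_comm]
  rw [bethePoly, h₁, h₂, roots_mul (mul_ne_zero (pow_ne_zero _ (neg_ne_zero.2 (X_sub_C_ne_zero 1)))
    (pow_ne_zero _ (X_sub_C_ne_zero _))), roots_pow, roots_pow, roots_neg, roots_X_sub_C,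
    roots_X_sub_C, Multiset.nsmul_singleton, Multiset.nsmul_singleton]

lemma esymm_replicate_add_replicate_zero {R : Type*} [CommRing R] (n k : ℕ) (a : R) :
    (Multiset.replicate n a + Multiset.replicate k 0).esymm n = a ^ n := by
  have h := Multiset.prod_X_add_C_coeff (Multiset.replicate n a + Multiset.replicate k 0)
    (k := k) (by simp)
  rw [Multiset.card_add, Multiset.card_replicate, Multiset.card_replicate,
    Nat.add_sub_cancel] at h
  rw [← h]
  simp [coeff_mul_X_pow', coeff_zero_eq_eval_zero]

lemma roots_bethePoly_sub_C (hp : 0 < p) (hpN : p < N) {c : ℂ} (hc : -c ∈ Complex.slitPlane) :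
    (bethePoly N p - C c).roots = (Finset.Icc 1 N).val.map fun j => slitRoot N p j c := by
  refine (Multiset.eq_of_le_of_card_le ((Multiset.le_iff_subset ?_).2 fun w hw => ?_) ?_).symm
  · exact Multiset.Nodup.map_on (fun i hi j hj => injOn_slitRoot hp hpN hc hi hj)
      (Finset.Icc 1 N).nodup
  · obtain ⟨j, -, rfl⟩ := Multiset.mem_map.1 hw
    rw [mem_roots (bethePoly_sub_C_ne_zero hp hpN c), IsRoot.def, eval_sub, eval_C,
      eval_bethePoly, (slitRoot_spec hp hpN hc j).1, sub_self]
  · rw [IsAlgClosed.card_roots_eq_natDegree, natDegree_sub_C, natDegree_bethePoly hpN.le]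
    simp

lemma two_pow_pow_le_choose_mul (hp : 0 < p) (hpN : p < N) {r m : ℝ} (hr : 0 < r)
    (h : ∀ c : ℂ, -c ∈ Complex.slitPlane → ‖c‖ = r → ∀ S ⊆ Finset.Icc 1 N, S.card = p →
      ∏ j ∈ S, ‖1 + slitRoot N p j c‖ ≤ m) {k : ℕ} (hk : k ≠ 0) :
    ((2 : ℝ) ^ p) ^ k ≤ N.choose p * m ^ k := by
  obtain ⟨T, hT⟩ := exists_eval_eq_esymm_map_roots
    (P := bethePoly N p) (by rw [natDegree_bethePoly hpN.le]; omega) ((1 + X) ^ k) p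
  have hzero : T.eval 0 = (2 ^ p) ^ k := by
    rw [← hT, C_0, sub_zero, roots_bethePoly, Multiset.map_add, Multiset.map_replicate,
      Multiset.map_replicate]
    norm_num [hk, esymm_replicate_add_replicate_zero, pow_right_comm]
  have hslit (c : ℂ) (hc : -c ∈ Complex.slitPlane) (hcr : ‖c‖ = r) :
      ‖T.eval c‖ ≤ N.choose p * m ^ k := by
    rw [← hT, roots_bethePoly_sub_C hp hpN hc, Multiset.map_map, Finset.esymm_map_val]
    refine (norm_sum_le_of_le (n := fun _ => m ^ k) _ fun S hS => ?_).trans_eq ?_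
    · rw [Finset.mem_powersetCard] at hS
      simpa [Finset.prod_pow] using pow_le_pow_left₀
        (Finset.prod_nonneg fun _ _ => norm_nonneg _) (h c hc hcr S hS.1 hS.2) k
    · rw [Finset.sum_const, Finset.card_powersetCard, Nat.card_Icc, Nat.add_sub_cancel,
        nsmul_eq_mul]
  have hcircle (c : ℂ) (hcr : ‖c‖ = r) : ‖T.eval c‖ ≤ N.choose p * m ^ k :=
    root_mem_of_isClosed hp hpN (norm_pos_iff.1 (hcr ▸ hr))
      (S := {q | ‖T.eval q.2‖ ≤ N.choose p * m ^ k})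
      (isClosed_le (T.continuous.comp continuous_snd).norm continuous_const)
      fun D hD hDc => hslit D hD (hDc.trans hcr)
  have hmax := Complex.norm_le_of_forall_mem_frontier_norm_le (f := fun z => T.eval z)
    (U := Metric.ball 0 r) Metric.isBounded_ball T.differentiable.diffContOnCl
    (fun z hz => hcircle z <| by rwa [frontier_ball _ hr.ne', mem_sphere_zero_iff_norm] at hz)
    (subset_closure (Metric.mem_ball_self hr))
  simpa [hzero] using hmax

/-- On every circle, the products of `p` factors `1 + u_j` reach the modulus `2^p` that they have
at the centre. -/
lemma two_pow_le_of_forall_prod_norm_le (hp : 0 < p) (hpN : p < N) {r m : ℝ} (hr : 0 < r)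
    (hm : 0 < m)
    (h : ∀ c : ℂ, -c ∈ Complex.slitPlane → ‖c‖ = r → ∀ S ⊆ Finset.Icc 1 N, S.card = p →
      ∏ j ∈ S, ‖1 + slitRoot N p j c‖ ≤ m) :
    2 ^ p ≤ m := by
  by_contra! hlt
  obtain ⟨k, hk, hk₁⟩ := ((tendsto_pow_atTop_atTop_of_one_lt ((one_lt_div hm).2 hlt)
    ).eventually_gt_atTop (N.choose p : ℝ)).and (eventually_ge_atTop 1) |>.exists
  rw [div_pow, lt_div_iff₀ (by positivity)] at hk
  exact hk.not_ge (two_pow_pow_le_choose_mul hp hpN hr h (by omega))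

end SymmetricFunctions

section Interlacing

variable {i j : ℕ} {C D : ℂ}

lemma sum_le_card_mul_add_sum_max {ι : Type*} {S T : Finset ι} {d : ι → ℝ} {β : ℝ}
    (h : ∀ j ∈ S, j ∉ T → d j ≤ β) :
    ∑ j ∈ S, d j ≤ S.card * β + ∑ j ∈ T, max (d j - β) 0 := by
  classical
  calc ∑ j ∈ S, d j ≤ ∑ j ∈ S, (β + max (d j - β) 0) :=
        Finset.sum_le_sum fun j _ => by linarith [le_max_left (d j - β) 0]
    _ = S.card * β + ∑ j ∈ S with j ∈ T, max (d j - β) 0 := by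
        rw [Finset.sum_add_distrib, Finset.sum_const, nsmul_eq_mul, Finset.sum_filter_of_ne]
        intro j hj hne
        by_contra hjT
        exact hne (max_eq_right (sub_nonpos.2 (h j hj hjT)))
    _ ≤ S.card * β + ∑ j ∈ T, max (d j - β) 0 := by
        refine (add_le_add_iff_left _).2 ?_
        exact Finset.sum_le_sum_of_subset_of_nonneg (fun j hj => (Finset.mem_filter.1 hj).2)
          fun _ _ _ => le_max_right _ _

lemma sum_max_sub_le_of_injOn {ι κ : Type*} {S : Finset ι} {T : Finset κ} {σ : ι → κ} {d : ι → ℝ}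
    {b : κ → ℝ} {β : ℝ} (hσ : ∀ j ∈ S, σ j ∈ T) (hinj : Set.InjOn σ S)
    (hd : ∀ j ∈ S, d j ≤ b (σ j)) (hb : ∀ j ∈ T, β ≤ b j) :
    ∑ j ∈ S, max (d j - β) 0 ≤ ∑ j ∈ T, (b j - β) := by
  classical
  calc ∑ j ∈ S, max (d j - β) 0 ≤ ∑ j ∈ S, (b (σ j) - β) :=
        Finset.sum_le_sum fun j hj => max_le (sub_le_sub_right (hd j hj) β)
          (sub_nonneg.2 (hb _ (hσ j hj)))
    _ = ∑ j ∈ S.image σ, (b j - β) := (Finset.sum_image (f := fun j => b j - β) hinj).symm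
    _ ≤ ∑ j ∈ T, (b j - β) :=
        Finset.sum_le_sum_of_subset_of_nonneg (Finset.image_subset_iff.2 hσ)
          fun j hj _ => sub_nonneg.2 (hb j hj)

/-- The shift towards the middle of `{1, …, p}` is injective away from three middle indices. -/
lemma sum_max_sub_le_of_shift {b d : ℕ → ℝ} {β B : ℝ} (hβB : β ≤ B)
    (hb : ∀ j ∈ Finset.Icc 1 p, β ≤ b j) (hd : ∀ j ∈ Finset.Icc 1 p, d j ≤ B)
    (hleft : ∀ j, 1 ≤ j → 2 * j + 2 ≤ p → d j ≤ b (j + 1))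
    (hright : ∀ j ≤ p, p + 4 ≤ 2 * j → d j ≤ b (j - 1)) :
    ∑ j ∈ Finset.Icc 1 p, max (d j - β) 0 ≤ ∑ j ∈ Finset.Icc 1 p, (b j - β) + 3 * (B - β) := by
  let outer (j : ℕ) : Prop := p + 4 ≤ 2 * j ∨ 2 * j + 2 ≤ p
  let shift (j : ℕ) : ℕ := if p + 4 ≤ 2 * j then j - 1 else j + 1
  have hmaps : ∀ j ∈ (Finset.Icc 1 p).filter outer, shift j ∈ Finset.Icc 1 p := by
    intro j hj
    simp only [outer, Finset.mem_filter, Finset.mem_Icc] at hj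
    simp only [shift, Finset.mem_Icc]
    split_ifs <;> omega
  have hinj : Set.InjOn shift ((Finset.Icc 1 p).filter outer : Finset ℕ) := by
    intro x hx y hy hxy
    simp only [outer, Finset.coe_filter, Set.mem_ofPred_eq, Finset.mem_Icc] at hx hy
    simp only [shift] at hxy
    split_ifs at hxy <;> omega
  have hshift : ∀ j ∈ (Finset.Icc 1 p).filter outer, d j ≤ b (shift j) := by
    intro j hj
    simp only [outer, Finset.mem_filter, Finset.mem_Icc] at hj
    simp only [shift]
    split_ifs with h
    · exact hright j hj.1.2 h
    · exact hleft j hj.1.1 (hj.2.resolve_left h)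
  have hinner : ∑ j ∈ (Finset.Icc 1 p).filter (¬ outer ·), max (d j - β) 0 ≤ 3 * (B - β) := by
    have hcard : ((Finset.Icc 1 p).filter (¬ outer ·)).card ≤ 3 := by
      refine (Finset.card_le_card (t := Finset.Icc (p / 2) (p / 2 + 2)) fun j hj => ?_).trans ?_
      · simp only [outer, Finset.mem_filter, Finset.mem_Icc, not_or] at hj ⊢
        omega
      · rw [Nat.card_Icc]
        omega
    refine (Finset.sum_le_card_nsmul _ _ (B - β) fun j hj => ?_).trans ?_
    · exact max_le (sub_le_sub_right (hd j (Finset.mem_filter.1 hj).1) β) (sub_nonneg.2 hβB)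
    · rw [nsmul_eq_mul]
      exact mul_le_mul_of_nonneg_right (by exact_mod_cast hcard) (sub_nonneg.2 hβB)
  rw [← Finset.sum_filter_add_sum_filter_not (Finset.Icc 1 p) outer]
  exact add_le_add (sum_max_sub_le_of_injOn hmaps hinj hshift hb) hinner

lemma one_add_ne_zero_of_betheMap_ne_zero (hpN : p < N) (hu : betheMap N p u ≠ 0) :
    1 + u ≠ 0 := by
  rintro h
  rw [betheMap, h, zero_pow (Nat.sub_pos_of_lt hpN).ne', mul_zero] at hu
  exact hu rfl

lemma norm_one_add_slitRoot_pos (hp : 0 < p) (hpN : p < N) (hC : -C ∈ Complex.slitPlane)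
    (j : ℕ) : 0 < ‖1 + slitRoot N p j C‖ :=
  norm_pos_iff.2 <| one_add_ne_zero_of_betheMap_ne_zero hpN <| by
    rw [(slitRoot_spec hp hpN hC j).1]
    exact neg_ne_zero.1 (Complex.slitPlane_ne_zero hC)

lemma log_norm_one_add_slitRoot_le (hp : 0 < p) (hpN : p < N) (hC : -C ∈ Complex.slitPlane)
    (hD : -D ∈ Complex.slitPlane) (hCD : ‖D‖ = ‖C‖)
    (h : |rootPhase N p (slitRoot N p i C)| < |rootPhase N p (slitRoot N p j D)|) :
    Real.log ‖1 + slitRoot N p j D‖ ≤ Real.log ‖1 + slitRoot N p i C‖ :=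
  Real.log_le_log (norm_one_add_slitRoot_pos hp hpN hD j)
    (norm_one_add_lt_of_abs_rootPhase_lt hp hpN (offSegment_slitRoot hp hpN hC i)
      (offSegment_slitRoot hp hpN hD j)
      (by rw [(slitRoot_spec hp hpN hC i).1, (slitRoot_spec hp hpN hD j).1, hCD]) h).le

lemma abs_rootPhase_slitRoot_succ_lt (hp : 0 < p) (hpN : p < N) (hC : -C ∈ Complex.slitPlane)
    (hD : -D ∈ Complex.slitPlane) (hj : 1 ≤ j) (hjp : 2 * j + 2 ≤ p) :
    |rootPhase N p (slitRoot N p (j + 1) C)| < |rootPhase N p (slitRoot N p j D)| := by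
  rw [rootPhase_slitRoot_of_le hp hpN hC (by omega) (by omega),
    rootPhase_slitRoot_of_le hp hpN hD hj (by omega)]
  obtain ⟨hC₁, hC₂⟩ := slitAngle_mem hC
  obtain ⟨_, hD₂⟩ := slitAngle_mem hD
  have hjp' : 2 * (j : ℝ) + 2 ≤ p := by exact_mod_cast hjp
  push_cast
  rw [abs_of_neg (by linarith), abs_of_neg (by linarith)]
  linarith

lemma abs_rootPhase_slitRoot_pred_lt (hp : 0 < p) (hpN : p < N) (hC : -C ∈ Complex.slitPlane)
    (hD : -D ∈ Complex.slitPlane) (hj : j ≤ p) (hjp : p + 4 ≤ 2 * j) :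
    |rootPhase N p (slitRoot N p (j - 1) C)| < |rootPhase N p (slitRoot N p j D)| := by
  rw [rootPhase_slitRoot_of_le hp hpN hC (by omega) (by omega),
    rootPhase_slitRoot_of_le hp hpN hD (by omega) hj, Nat.cast_sub (by omega), Nat.cast_one]
  obtain ⟨hC₁, hC₂⟩ := slitAngle_mem hC
  obtain ⟨hD₁, _⟩ := slitAngle_mem hD
  have hjp' : (p : ℝ) + 4 ≤ 2 * j := by exact_mod_cast hjp
  rw [abs_of_pos (by linarith), abs_of_pos (by linarith)]
  linarith

/-- As `arg C` varies on a circle, the roots `u_1, …, u_p` interlace: the `p` largest factors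
`‖1 + u_j‖` change by at most one step of the ordering, up to three exceptional factors. -/
lemma sum_log_norm_one_add_le (hp : 0 < p) (hpN : p < N) (hC : -C ∈ Complex.slitPlane)
    (hD : -D ∈ Complex.slitPlane) (hCD : ‖D‖ = ‖C‖) {B : ℝ}
    (hBC : ∀ j, Real.log ‖1 + slitRoot N p j C‖ ≤ B)
    (hBD : ∀ j, Real.log ‖1 + slitRoot N p j D‖ ≤ B)
    {S : Finset ℕ} (hS : S ⊆ Finset.Icc 1 N) (hSp : S.card = p) :
    ∑ j ∈ S, Real.log ‖1 + slitRoot N p j D‖ ≤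
      ∑ j ∈ Finset.Icc 1 p, Real.log ‖1 + slitRoot N p j C‖
        + 3 * (B - Real.log ‖1 + slitRoot N p N C‖) := by
  obtain ⟨i, hi, hmin⟩ := Finset.exists_min_image (Finset.Icc 1 p)
    (fun j => Real.log ‖1 + slitRoot N p j C‖) ⟨1, Finset.mem_Icc.2 ⟨le_rfl, hp⟩⟩
  set β := Real.log ‖1 + slitRoot N p i C‖
  have hphase := abs_rootPhase_slitRoot_lt hp hpN hC (Finset.mem_Icc.1 hi).1 (Finset.mem_Icc.1 hi).2
  have hlast : Real.log ‖1 + slitRoot N p N C‖ ≤ β := log_norm_one_add_slitRoot_le hp hpN hC hC rfl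
    (hphase.trans (lt_abs_rootPhase_slitRoot hp hpN hC hpN le_rfl))
  have houter : ∀ j ∈ S, j ∉ Finset.Icc 1 p → Real.log ‖1 + slitRoot N p j D‖ ≤ β := by
    intro j hj hjp
    have hj' := Finset.mem_Icc.1 (hS hj)
    exact log_norm_one_add_slitRoot_le hp hpN hC hD hCD (hphase.trans
      (lt_abs_rootPhase_slitRoot hp hpN hD
        (not_le.1 fun h => hjp (Finset.mem_Icc.2 ⟨hj'.1, h⟩)) hj'.2))
  have hS' := sum_le_card_mul_add_sum_max houter
  have hmax := sum_max_sub_le_of_shift (hBC i) hmin (fun j _ => hBD j)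
    (fun j h₁ h₂ => log_norm_one_add_slitRoot_le hp hpN hC hD hCD
      (abs_rootPhase_slitRoot_succ_lt hp hpN hC hD h₁ h₂))
    (fun j h₁ h₂ => log_norm_one_add_slitRoot_le hp hpN hC hD hCD
      (abs_rootPhase_slitRoot_pred_lt hp hpN hC hD h₁ h₂))
  rw [Finset.sum_sub_distrib, Finset.sum_const, Nat.card_Icc, Nat.add_sub_cancel,
    nsmul_eq_mul] at hmax
  rw [hSp] at hS'
  linarith

lemma two_pow_mul_norm_one_add_slitRoot_le (hp : 0 < p) (hpN : p < N)
    (hC : -C ∈ Complex.slitPlane) {R : ℝ} (hR : 0 ≤ R) (hRC : ‖C‖ = R ^ N) :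
    2 ^ p * ‖1 + slitRoot N p N C‖ ^ 3 ≤
      (∏ j ∈ Finset.Icc 1 p, ‖1 + slitRoot N p j C‖) * (R + 2) ^ 3 := by
  have hpos {D : ℂ} (hD : -D ∈ Complex.slitPlane) := norm_one_add_slitRoot_pos hp hpN hD
  have hbound {D : ℂ} (hD : -D ∈ Complex.slitPlane) (hDC : ‖D‖ = ‖C‖) (j : ℕ) :
      Real.log ‖1 + slitRoot N p j D‖ ≤ Real.log (R + 2) :=
    Real.log_le_log (hpos hD j) <| norm_one_add_le hp hpN hR <| by
      rw [(slitRoot_spec hp hpN hD j).1, hDC, hRC]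
  have hprod : 0 < ∏ j ∈ Finset.Icc 1 p, ‖1 + slitRoot N p j C‖ :=
    Finset.prod_pos fun j _ => hpos hC j
  have hquot : 0 < ((R + 2) / ‖1 + slitRoot N p N C‖) ^ 3 :=
    pow_pos (div_pos (by positivity) (hpos hC N)) 3
  have hmax := two_pow_le_of_forall_prod_norm_le hp hpN
    (norm_pos_iff.2 (neg_ne_zero.1 (Complex.slitPlane_ne_zero hC))) (mul_pos hprod hquot) ?_
  · rwa [div_pow, ← mul_div_assoc, le_div_iff₀ (pow_pos (hpos hC N) 3)] at hmax
  · intro D hD hDC S hS hSp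
    have hlog := sum_log_norm_one_add_le hp hpN hC hD hDC (hbound hC rfl) (hbound hD hDC) hS hSp
    rw [← Real.log_le_log_iff (Finset.prod_pos fun j _ => hpos hD j) (mul_pos hprod hquot),
      Real.log_mul hprod.ne' hquot.ne', Real.log_pow,
      Real.log_div (by positivity) (hpos hC N).ne', Real.log_prod fun j _ => (hpos hD j).ne',
      Real.log_prod fun j _ => (hpos hC j).ne']
    exact_mod_cast hlog

lemma two_pow_mul_norm_one_add_root_le (hp : 0 < p) (hpN : p < N) (hC : C ≠ 0) {R : ℝ}
    (hR : 0 ≤ R) (hRC : ‖C‖ = R ^ N) :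
    2 ^ p * ‖1 + root N p N C‖ ^ 3 ≤
      (∏ j ∈ Finset.Icc 1 p, ‖1 + root N p j C‖) * (R + 2) ^ 3 :=
  Set.mem_ofPred.1 <| root_mem_of_isClosed hp hpN hC
    (S := {q | (2 : ℝ) ^ p * ‖1 + q.1 N‖ ^ 3 ≤
      (∏ j ∈ Finset.Icc 1 p, ‖1 + q.1 j‖) * (R + 2) ^ 3})
    (isClosed_le (by fun_prop) (by fun_prop)) fun _ hD hDC =>
      Set.mem_ofPred.2 (two_pow_mul_norm_one_add_slitRoot_le hp hpN hD hR (hDC.trans hRC))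

lemma norm_one_add_root_pow_four_le (hp : 0 < p) (hpN : p < N) (hC : C ≠ 0) {E R : ℝ}
    (hE : 0 ≤ E) (hR : 0 ≤ R) (hRC : ‖C‖ = R ^ N)
    (h : (∏ j ∈ Finset.Icc 1 p, ‖1 + root N p j C‖) * ‖1 + root N p N C‖
      = 2 ^ p * E * ‖1 + root N p p C‖) :
    ‖1 + root N p N C‖ ^ 4 ≤ E * (R + 2) ^ 4 := by
  have hp' : ‖1 + root N p p C‖ ≤ R + 2 :=
    norm_one_add_le hp hpN hR (by rw [betheMap_root hp hpN hC, hRC])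
  refine le_of_mul_le_mul_left ?_ (by positivity : (0 : ℝ) < 2 ^ p)
  calc 2 ^ p * ‖1 + root N p N C‖ ^ 4
      = 2 ^ p * ‖1 + root N p N C‖ ^ 3 * ‖1 + root N p N C‖ := by ring
    _ ≤ (∏ j ∈ Finset.Icc 1 p, ‖1 + root N p j C‖) * (R + 2) ^ 3 * ‖1 + root N p N C‖ := by
        exact mul_le_mul_of_nonneg_right
          (two_pow_mul_norm_one_add_root_le hp hpN hC hR hRC) (norm_nonneg _)
    _ = 2 ^ p * E * ‖1 + root N p p C‖ * (R + 2) ^ 3 := by rw [← h]; ring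
    _ ≤ 2 ^ p * E * (R + 2) * (R + 2) ^ 3 := by gcongr
    _ = 2 ^ p * (E * (R + 2) ^ 4) := by ring

/-- The a priori bound: the product of the selected factors `1 + u_j` can have modulus `2^p E`
with small `E` only if `C` is very small. -/
lemma norm_le_of_prod_norm_one_add_root_eq (hp : 0 < p) (hpN : p < N) (hC : C ≠ 0) {E κ : ℝ}
    (hE : 0 ≤ E) (hκ₀ : 0 ≤ κ) (hκ : κ ≤ 1 / 2) (hκE : κ ^ (4 * N) = E ^ (N - p))
    (h : (∏ j ∈ Finset.Icc 1 p, ‖1 + root N p j C‖) * ‖1 + root N p N C‖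
      = 2 ^ p * E * ‖1 + root N p p C‖) :
    ‖C‖ ≤ (8 * κ) ^ N := by
  obtain ⟨R, hR, hRC⟩ : ∃ R : ℝ, 0 ≤ R ∧ ‖C‖ = R ^ N := ⟨‖C‖ ^ (N⁻¹ : ℝ), by positivity,
    (Real.rpow_inv_natCast_pow (norm_nonneg _) (hp.trans hpN).ne').symm⟩
  have hroot := betheMap_root hp hpN hC N
  set w := root N p N C
  have hw : ‖1 + w‖ ≤ R + 2 := norm_one_add_le hp hpN hR (by rw [hroot, hRC])
  have hw₄ : ‖1 + w‖ ^ 4 ≤ E * (R + 4) ^ 4 :=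
    (norm_one_add_root_pow_four_le hp hpN hC hE hR hRC h).trans (by gcongr; norm_num)
  have hw' : ‖1 - w‖ ≤ R + 4 := (norm_one_sub_le_two_add w).trans (by linarith)
  have hpow : R ^ (4 * N) ≤ (κ * (R + 4)) ^ (4 * N) := by
    calc R ^ (4 * N) = (R ^ N) ^ 4 := by rw [← pow_mul, mul_comm]
      _ = (‖1 - w‖ ^ p) ^ 4 * (‖1 + w‖ ^ 4) ^ (N - p) := by
          rw [← hRC, ← hroot, norm_betheMap, mul_pow]
          ring
      _ ≤ ((R + 4) ^ p) ^ 4 * (E * (R + 4) ^ 4) ^ (N - p) := by gcongr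
      _ = κ ^ (4 * N) * (R + 4) ^ (4 * p + 4 * (N - p)) := by
          rw [mul_pow, hκE, pow_add, ← pow_mul, ← pow_mul, mul_comm p 4]
          ring
      _ = (κ * (R + 4)) ^ (4 * N) := by
          rw [mul_pow]
          congr 2
          omega
  have hlin : R ≤ κ * (R + 4) := le_of_pow_le_pow_left₀ (by omega) (by positivity) hpow
  rw [hRC]
  exact pow_le_pow_left₀ hR (by nlinarith) N

end Interlacing

/-! ### The local inverse of `x (1 - x/2)^a` -/

section LobeChart

variable {a : ℝ}

/-- The function `x (1 - x/2)^a` in the coordinate `w = log (1 - x/2)`, in which it is entire. With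
`a = (N - p)/p` and `x = 1 - u` its `p`-th power is `(1 - u)^p (1 + u)^(N - p) / 2^(N - p)`. -/
def lobeMap (a : ℝ) (w : ℂ) : ℂ := 2 * (1 - Complex.exp w) * Complex.exp (a * w)

/-- A local inverse `ℓ` of `lobeMap a` on the disc of radius `δ` about `0`, with
quantitative control; `K` is a Lipschitz constant at `0`. -/
structure LobeChart (a : ℝ) where
  ℓ : ℂ → ℂ
  δ : ℝ
  K : ℝ
  δ_pos : 0 < δ
  K_nonneg : 0 ≤ K
  differentiableAt_ℓ : ∀ {z}, ‖z‖ < δ → DifferentiableAt ℂ ℓ z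
  lobeMap_ℓ : ∀ {z}, ‖z‖ < δ → lobeMap a (ℓ z) = z
  norm_ℓ_le : ∀ {z}, ‖z‖ < δ → ‖ℓ z‖ ≤ K * ‖z‖
  mul_norm_ℓ_lt : ∀ {z}, ‖z‖ < δ → (1 + a) * ‖ℓ z‖ < 1 / 8
  ℓ_conj : ∀ {z}, ‖z‖ < δ → ℓ (conj z) = conj (ℓ z)

lemma lobeMap_zero (a : ℝ) : lobeMap a 0 = 0 := by simp [lobeMap]

lemma lobeMap_conj (a : ℝ) (w : ℂ) : lobeMap a (conj w) = conj (lobeMap a w) := by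
  simp [lobeMap, ← Complex.exp_conj, Complex.conj_ofNat]

lemma analyticAt_lobeMap (a : ℝ) (w : ℂ) : AnalyticAt ℂ (lobeMap a) w := by
  unfold lobeMap; fun_prop

lemma hasDerivAt_lobeMap_zero (a : ℝ) : HasDerivAt (lobeMap a) (-2) 0 := by
  have h := (((Complex.hasDerivAt_exp 0).const_sub 1).const_mul 2).fun_mul
    ((hasDerivAt_id (0 : ℂ)).const_mul (a : ℂ)).cexp
  change HasDerivAt (fun w => 2 * (1 - Complex.exp w) * Complex.exp (a * w)) _ _
  simpa using h

lemma nonempty_lobeChart (a : ℝ) : Nonempty (LobeChart a) := by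
  have han := analyticAt_lobeMap a 0
  have hd := han.hasStrictDerivAt
  have hne : deriv (lobeMap a) 0 ≠ 0 := by simp [(hasDerivAt_lobeMap_zero a).deriv]
  set ℓ := hd.localInverse _ _ _ hne
  have hleft : ∀ᶠ w in 𝓝 0, ℓ (lobeMap a w) = w := hd.eventually_left_inverse hne
  have hright : ∀ᶠ z in 𝓝 0, lobeMap a (ℓ z) = z := by
    simpa only [lobeMap_zero] using hd.eventually_right_inverse hne
  have hℓ₀ : ℓ 0 = 0 := by simpa only [lobeMap_zero] using hleft.self_of_nhds
  have hℓ : AnalyticAt ℂ ℓ 0 := by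
    simpa only [lobeMap_zero] using han.analyticAt_localInverse hne
  have hℓc : Tendsto ℓ (𝓝 0) (𝓝 0) := by simpa only [hℓ₀] using hℓ.continuousAt.tendsto
  have hconj : ∀ᶠ z in 𝓝 (0 : ℂ), ℓ (conj z) = conj (ℓ z) := by
    have hc : Tendsto (fun z => conj (ℓ z)) (𝓝 0) (𝓝 0) := by
      simpa only [map_zero, Function.comp_def] using (Complex.continuous_conj.tendsto 0).comp hℓc
    filter_upwards [hc.eventually hleft, hright] with z hz hz'
    rw [← hz, lobeMap_conj, hz']
  have hsmall : ∀ᶠ z in 𝓝 (0 : ℂ), (1 + a) * ‖ℓ z‖ < 1 / 8 := by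
    have h : Tendsto (fun z => (1 + a) * ‖ℓ z‖) (𝓝 0) (𝓝 0) := by
      simpa using hℓc.norm.const_mul (1 + a)
    exact h.eventually_lt_const (by norm_num)
  obtain ⟨K, hK₀, hK⟩ := hℓ.differentiableAt.isBigO_sub.exists_pos
  have hK' : ∀ᶠ z in 𝓝 (0 : ℂ), ‖ℓ z‖ ≤ K * ‖z‖ := by simpa [hℓ₀] using hK.bound
  have hdiff := hℓ.eventually_analyticAt.mono fun z hz => hz.differentiableAt
  obtain ⟨δ, hδ, hball⟩ := Metric.eventually_nhds_iff.1
    (hdiff.and (hright.and (hK'.and (hsmall.and hconj))))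
  simp only [dist_zero_right] at hball
  exact ⟨{ ℓ, δ, K
           δ_pos := hδ
           K_nonneg := hK₀.le
           differentiableAt_ℓ := fun hz => (hball hz).1
           lobeMap_ℓ := fun hz => (hball hz).2.1
           norm_ℓ_le := fun hz => (hball hz).2.2.1
           mul_norm_ℓ_lt := fun hz => (hball hz).2.2.2.1
           ℓ_conj := fun hz => (hball hz).2.2.2.2 }⟩

lemma abs_arg_one_sub_half_le {x : ℂ} (hx : ‖x‖ ≤ 1) :
    |Complex.arg (1 - x / 2)| ≤ π / 2 * |x.im| := by
  have hre : (1 - x / 2).re = 1 - x.re / 2 := by simp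
  have him : (1 - x / 2).im = -(x.im / 2) := by simp
  have hxre := (Complex.re_le_norm x).trans hx
  have hnorm : 1 / 2 ≤ ‖1 - x / 2‖ := by linarith [Complex.re_le_norm (1 - x / 2)]
  have harg : |Complex.arg (1 - x / 2)| ≤ π / 2 :=
    Complex.abs_arg_le_pi_div_two_iff.2 (by linarith)
  have hjordan := Real.mul_abs_le_abs_sin harg
  have hsin : |Real.sin (Complex.arg (1 - x / 2))| ≤ |x.im| := by
    rw [Complex.sin_arg, abs_div, abs_norm, him, abs_neg, abs_div, abs_two,
      div_le_iff₀ (by linarith)]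
    nlinarith [abs_nonneg x.im]
  calc |Complex.arg (1 - x / 2)| = π / 2 * (2 / π * |Complex.arg (1 - x / 2)|) := by field_simp
    _ ≤ π / 2 * |x.im| := by gcongr; exact hjordan.trans hsin

lemma mul_abs_arg_one_sub_half_lt (ha : 0 ≤ a) {x : ℂ} (hx : (1 + a) * ‖x‖ ≤ 1 / 2)
    (him : x.im ≠ 0) : a * |Complex.arg (1 - x / 2)| < |Complex.arg x| := by
  have hx₀ : 0 < ‖x‖ := norm_pos_iff.2 (by rintro rfl; simp at him)
  have hx₁ : ‖x‖ ≤ 1 := by nlinarith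
  calc a * |Complex.arg (1 - x / 2)| ≤ a * (π / 2 * |x.im|) := by
        gcongr; exact abs_arg_one_sub_half_le hx₁
    _ < |x.im| / ‖x‖ := by
        rw [lt_div_iff₀ hx₀]
        have : π / 2 * (a * ‖x‖) < 1 := by nlinarith [Real.pi_gt_three, Real.pi_lt_four]
        nlinarith [abs_pos.2 him]
    _ = |Real.sin (Complex.arg x)| := by rw [Complex.sin_arg, abs_div, abs_norm]
    _ ≤ |Complex.arg x| := Real.abs_sin_le_abs

namespace LobeChart

variable (c : LobeChart a) {z : ℂ}

/-- The local inverse of `x (1 - x/2)^a` at `0`. -/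
def φ (z : ℂ) : ℂ := 2 * (1 - Complex.exp (c.ℓ z))

lemma two_sub_φ (z : ℂ) : 2 - c.φ z = 2 * Complex.exp (c.ℓ z) := by rw [φ]; ring

lemma φ_eq (hz : ‖z‖ < c.δ) : c.φ z = z * Complex.exp (-(a * c.ℓ z)) := by
  have h : c.φ z * Complex.exp (a * c.ℓ z) = z := c.lobeMap_ℓ hz
  rw [Complex.exp_neg, eq_mul_inv_iff_mul_eq₀ (Complex.exp_ne_zero _), h]

lemma norm_ℓ_lt (ha : 0 ≤ a) (hz : ‖z‖ < c.δ) : ‖c.ℓ z‖ < 1 / 8 := by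
  nlinarith [c.mul_norm_ℓ_lt hz, norm_nonneg (c.ℓ z)]

lemma norm_mul_ℓ_lt (ha : 0 ≤ a) (hz : ‖z‖ < c.δ) : ‖a * c.ℓ z‖ < 1 / 8 := by
  rw [norm_mul, Complex.norm_real, Real.norm_of_nonneg ha]
  linarith [c.mul_norm_ℓ_lt hz, norm_nonneg (c.ℓ z)]

lemma norm_φ_sub_le (ha : 0 ≤ a) (hz : ‖z‖ < c.δ) :
    ‖c.φ z - z‖ ≤ 2 * a * c.K * ‖z‖ ^ 2 := by
  have hexp : ‖Complex.exp (-(a * c.ℓ z)) - 1‖ ≤ 2 * (a * ‖c.ℓ z‖) := by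
    have h := Complex.norm_exp_sub_one_le (x := -(a * c.ℓ z))
      (by rw [norm_neg]; linarith [c.norm_mul_ℓ_lt ha hz])
    rwa [norm_neg, norm_mul, Complex.norm_real, Real.norm_of_nonneg ha] at h
  calc ‖c.φ z - z‖ = ‖z‖ * ‖Complex.exp (-(a * c.ℓ z)) - 1‖ := by
        rw [c.φ_eq hz, ← norm_mul]; ring_nf
    _ ≤ ‖z‖ * (2 * (a * (c.K * ‖z‖))) := by
        gcongr; exact hexp.trans (by gcongr; exact c.norm_ℓ_le hz)
    _ = 2 * a * c.K * ‖z‖ ^ 2 := by ring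

lemma mul_norm_φ_le (ha : 0 ≤ a) (hz : ‖z‖ < c.δ) : (1 + a) * ‖c.φ z‖ ≤ 1 / 2 := by
  have h : ‖c.φ z‖ ≤ 2 * (2 * ‖c.ℓ z‖) := by
    rw [φ, norm_mul, norm_sub_rev, Complex.norm_two]
    gcongr
    exact Complex.norm_exp_sub_one_le (by linarith [c.norm_ℓ_lt ha hz])
  nlinarith [c.mul_norm_ℓ_lt hz]

lemma log_one_sub_φ_half (ha : 0 ≤ a) (hz : ‖z‖ < c.δ) :
    Complex.log (1 - c.φ z / 2) = c.ℓ z := by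
  have him := abs_lt.1 ((Complex.abs_im_le_norm _).trans_lt (c.norm_ℓ_lt ha hz))
  rw [show 1 - c.φ z / 2 = Complex.exp (c.ℓ z) by rw [φ]; ring,
    Complex.log_exp] <;> linarith [Real.pi_gt_three]

lemma injOn_φ (ha : 0 ≤ a) : Set.InjOn c.φ {z | ‖z‖ < c.δ} := by
  intro z hz w hw h
  rw [← c.lobeMap_ℓ hz, ← c.lobeMap_ℓ hw, ← c.log_one_sub_φ_half ha hz,
    ← c.log_one_sub_φ_half ha hw, h]

lemma continuousAt_φ (hz : ‖z‖ < c.δ) : ContinuousAt c.φ z := by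
  have := (c.differentiableAt_ℓ hz).continuousAt
  unfold φ
  fun_prop

end LobeChart

end LobeChart

/-! ### The roots for small `C` -/

section LobeVar

variable {s t : ℕ} {τ : ℂ}

/-- The logarithm of `(e^τ / 2^t)^(1/s)`. -/
def lobeLog (s t : ℕ) (τ : ℂ) : ℂ := (τ - t * Real.log 2) / s

/-- The number `(e^τ / 2^t)^(1/s)`: for `e^τ = C` and `{s, t} = {p, N - p}`, the parameter in which
the roots near `1` and near `-1` are analytic. -/
def lobeVar (s t : ℕ) (τ : ℂ) : ℂ := Complex.exp (lobeLog s t τ)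

lemma exp_natCast_mul_log_two (t : ℕ) : Complex.exp (t * (Real.log 2 : ℝ)) = 2 ^ t := by
  rw [Complex.exp_nat_mul, ← Complex.ofReal_exp, Real.exp_log two_pos, Complex.ofReal_ofNat]

lemma lobeVar_pow_mul (hs : s ≠ 0) (t : ℕ) (τ : ℂ) :
    lobeVar s t τ ^ s * 2 ^ t = Complex.exp τ := by
  have hs' : (s : ℂ) ≠ 0 := Nat.cast_ne_zero.2 hs
  rw [lobeVar, ← Complex.exp_nat_mul, ← exp_natCast_mul_log_two, ← Complex.exp_add, lobeLog,
    mul_div_cancel₀ _ hs', sub_add_cancel]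

lemma lobeLog_re (s t : ℕ) (τ : ℂ) : (lobeLog s t τ).re = (τ.re - t * Real.log 2) / s := by
  rw [lobeLog, Complex.div_natCast_re, ← Complex.ofReal_natCast, ← Complex.ofReal_mul,
    Complex.sub_re, Complex.ofReal_re]

lemma lobeLog_im (s t : ℕ) (τ : ℂ) : (lobeLog s t τ).im = τ.im / s := by
  rw [lobeLog, Complex.div_natCast_im, ← Complex.ofReal_natCast, ← Complex.ofReal_mul,
    Complex.sub_im, Complex.ofReal_im, sub_zero]

lemma norm_lobeVar (s t : ℕ) (τ : ℂ) :
    ‖lobeVar s t τ‖ = Real.exp ((τ.re - t * Real.log 2) / s) := by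
  rw [lobeVar, Complex.norm_exp, lobeLog_re]

lemma norm_lobeVar_add_mul_I (s t : ℕ) (τ : ℂ) (δ : ℝ) :
    ‖lobeVar s t (τ + δ * Complex.I)‖ = ‖lobeVar s t τ‖ := by
  simp [norm_lobeVar]

lemma tendsto_lobeVar (s t : ℕ) (τ : ℂ) :
    Tendsto (fun δ : ℝ => lobeVar s t (τ + δ * Complex.I)) (𝓝[<] 0) (𝓝 (lobeVar s t τ)) := by
  have h : Continuous fun δ : ℝ => lobeVar s t (τ + δ * Complex.I) := by
    unfold lobeVar lobeLog; fun_prop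
  simpa using (h.tendsto 0).mono_left (nhdsWithin_le_nhds (s := Set.Iio 0))

lemma nonneg_of_mul_natCast_eq {a : ℝ} (hs : s ≠ 0) (hst : a * s = t) : 0 ≤ a := by
  have hs' : (0 : ℝ) < s := Nat.cast_pos.2 (Nat.pos_of_ne_zero hs)
  exact le_of_mul_le_mul_right (by rw [zero_mul, hst]; positivity) hs'

namespace LobeChart

variable {a : ℝ} (c : LobeChart a) {z : ℂ}

lemma φ_pow_mul_two_sub_φ_pow (hst : a * s = t) (hz : ‖z‖ < c.δ) :
    c.φ z ^ s * (2 - c.φ z) ^ t = z ^ s * 2 ^ t := by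
  have hst' : (a : ℂ) * s = t := by exact_mod_cast hst
  have h : Complex.exp (s * -(a * c.ℓ z)) * Complex.exp (t * c.ℓ z) = 1 := by
    rw [← Complex.exp_add, Complex.exp_eq_one_iff]
    exact ⟨0, by rw [← hst']; push_cast; ring⟩
  rw [c.two_sub_φ, c.φ_eq hz, mul_pow, mul_pow, ← Complex.exp_nat_mul, ← Complex.exp_nat_mul]
  linear_combination (z ^ s * 2 ^ t) * h

lemma φ_lobeVar (hz : ‖lobeVar s t τ‖ < c.δ) :
    c.φ (lobeVar s t τ) = Complex.exp (lobeLog s t τ - a * c.ℓ (lobeVar s t τ)) := by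
  rw [c.φ_eq hz, sub_eq_add_neg, Complex.exp_add, ← lobeVar]

lemma abs_im_ℓ_lt (ha : 0 ≤ a) (hz : ‖z‖ < c.δ) : |(c.ℓ z).im| < 1 / 8 :=
  (Complex.abs_im_le_norm _).trans_lt (c.norm_ℓ_lt ha hz)

lemma abs_mul_im_ℓ_lt (ha : 0 ≤ a) (hz : ‖z‖ < c.δ) : |a * (c.ℓ z).im| < 1 / 8 := by
  rw [← Complex.im_ofReal_mul]
  exact (Complex.abs_im_le_norm _).trans_lt (c.norm_mul_ℓ_lt ha hz)

end LobeChart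

lemma abs_im_div_le (hs : 3 ≤ s) (hτ : τ.im ∈ Set.Ioc (-(2 * π)) 0) :
    |τ.im / s| ≤ 2 * π / 3 := by
  have hs' : (3 : ℝ) ≤ s := by exact_mod_cast hs
  rw [abs_div, abs_of_nonpos hτ.2, Nat.abs_cast]
  gcongr
  linarith [hτ.1]

namespace LobeChart

variable {a : ℝ} (c : LobeChart a) {z : ℂ}

lemma arg_φ_lobeVar (hst : a * s = t) (hs : 3 ≤ s) (hτ : τ.im ∈ Set.Ioc (-(2 * π)) 0)
    (hz : ‖lobeVar s t τ‖ < c.δ) :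
    Complex.arg (c.φ (lobeVar s t τ)) = τ.im / s - a * (c.ℓ (lobeVar s t τ)).im := by
  have ha := nonneg_of_mul_natCast_eq (by omega) hst
  have him : (lobeLog s t τ - a * c.ℓ (lobeVar s t τ)).im
      = τ.im / s - a * (c.ℓ (lobeVar s t τ)).im := by
    rw [Complex.sub_im, lobeLog_im, Complex.im_ofReal_mul]
  have h₁ := abs_le.1 (abs_im_div_le hs hτ)
  have h₂ := abs_lt.1 (c.abs_mul_im_ℓ_lt ha hz)
  rw [← Complex.log_im, c.φ_lobeVar hz, Complex.log_exp, him] <;> rw [him] <;>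
    linarith [Real.pi_gt_three]

lemma arg_two_sub_φ (ha : 0 ≤ a) (hz : ‖z‖ < c.δ) : Complex.arg (2 - c.φ z) = (c.ℓ z).im := by
  have h : 2 - c.φ z = (2 : ℝ) * (1 - c.φ z / 2) := by push_cast; ring
  rw [h, Complex.arg_real_mul _ two_pos, ← c.log_one_sub_φ_half ha hz, Complex.log_im]

lemma im_φ_lobeVar_neg (hst : a * s = t) (hs : 3 ≤ s) (hτ : τ.im ∈ Set.Ioo (-(2 * π)) 0)
    (hz : ‖lobeVar s t τ‖ < c.δ) : (c.φ (lobeVar s t τ)).im < 0 := by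
  have ha := nonneg_of_mul_natCast_eq (by omega) hst
  have harg := c.arg_φ_lobeVar hst hs (Set.Ioo_subset_Ioc_self hτ) hz
  rw [← c.log_one_sub_φ_half ha hz, Complex.log_im] at harg
  have hneg : τ.im / s < 0 := div_neg_of_neg_of_pos hτ.2 (Nat.cast_pos.2 (by omega))
  have hφ := c.mul_norm_φ_le ha hz
  set x := c.φ (lobeVar s t τ)
  by_contra! h
  have hx : 0 ≤ Complex.arg x := Complex.arg_nonneg_iff.2 h
  have hle : a * |Complex.arg (1 - x / 2)| ≤ |Complex.arg x| := by
    rcases h.eq_or_lt with him | him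
    · have h₀ := abs_arg_one_sub_half_le (x := x) (by nlinarith [norm_nonneg x])
      rw [← him, abs_zero, mul_zero] at h₀
      have h₁ := mul_le_mul_of_nonneg_left h₀ ha
      rw [mul_zero] at h₁
      exact h₁.trans (abs_nonneg _)
    · exact (mul_abs_arg_one_sub_half_lt ha hφ him.ne').le
  rw [abs_of_nonneg hx] at hle
  nlinarith [neg_abs_le (Complex.arg (1 - x / 2))]

end LobeChart

end LobeVar

section SmallRoots

variable {a b : ℝ} (ca : LobeChart a) (cb : LobeChart b) {τ z : ℂ}

lemma neg_exp_mem_slitPlane (hτ : τ.im ∈ Set.Ioo (-(2 * π)) 0) :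
    -Complex.exp τ ∈ Complex.slitPlane := by
  have harg : Complex.arg (-Complex.exp τ) = τ.im + π := by
    rw [← Complex.log_im, ← Complex.exp_add_pi_mul_I, Complex.log_exp] <;>
      simp <;> linarith [hτ.1, hτ.2]
  rw [Complex.mem_slitPlane_iff_arg, harg]
  exact ⟨by linarith [hτ.2], neg_ne_zero.2 (Complex.exp_ne_zero τ)⟩

lemma betheMap_one_sub (N p : ℕ) (x : ℂ) : betheMap N p (1 - x) = x ^ p * (2 - x) ^ (N - p) := by
  rw [betheMap]; ring

lemma betheMap_neg_one_add (N p : ℕ) (x : ℂ) :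
    betheMap N p (-1 + x) = x ^ (N - p) * (2 - x) ^ p := by
  rw [betheMap]; ring

lemma rootPhase_one_sub (hpN : p ≤ N) {x : ℂ} (hx : x.im < 0) : rootPhase N p (1 - x) =
    (p * (Complex.arg x + π) + (N - p : ℕ) * Complex.arg (2 - x)) / π := by
  rw [rootPhase_eq_div, show 1 - x - 1 = -x by ring, show 1 - x + 1 = 2 - x by ring,
    Complex.arg_neg_eq_arg_add_pi_of_im_neg hx, Nat.cast_sub hpN]

lemma rootPhase_neg_one_add (hpN : p ≤ N) {x : ℂ} (hx : x.im < 0) : rootPhase N p (-1 + x) =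
    (p * (Complex.arg (2 - x) - π) + (N - p : ℕ) * Complex.arg x) / π := by
  rw [rootPhase_eq_div, show -1 + x - 1 = -(2 - x) by ring, show -1 + x + 1 = x by ring,
    Complex.arg_neg_eq_arg_sub_pi_of_im_pos (by simpa using hx), Nat.cast_sub hpN]

lemma abs_rootPhase_one_sub_lt (hp : 0 < p) (hpN : p < N) (hap : a * p = (N - p : ℕ)) {x : ℂ}
    (hx : (1 + a) * ‖x‖ ≤ 1 / 2) (hoff : OffSegment (1 - x)) : |rootPhase N p (1 - x)| < p := by
  have ha := nonneg_of_mul_natCast_eq hp.ne' hap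
  have hp' : (0 : ℝ) < p := Nat.cast_pos.2 hp
  wlog him : x.im ≤ 0 generalizing x
  · have h := this (x := conj x) (by rwa [Complex.norm_conj])
      (by simpa using offSegment_conj hoff) (by simpa using (not_le.1 him).le)
    rwa [show 1 - conj x = conj (1 - x) by simp,
      rootPhase_conj N p (by simpa using (not_le.1 him).ne'), abs_neg] at h
  rcases him.eq_or_lt with him | him
  · have hre : -1 < x.re := by nlinarith [(abs_le.1 (Complex.abs_re_le_norm x)).1, norm_nonneg x]
    have hre' : x.re < 1 := by nlinarith [Complex.re_le_norm x, norm_nonneg x]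
    rw [rootPhase_of_one_lt N p (by simp [him]), abs_zero]
    · exact hp'
    · rcases hoff with h | h | h
      · simp [him] at h
      · exact h
      · rw [Complex.sub_re, Complex.one_re] at h; linarith
  · have harg := mul_abs_arg_one_sub_half_lt ha hx him.ne
    rw [abs_of_neg (Complex.arg_neg_iff.2 him)] at harg
    have harg₂ : Complex.arg (2 - x) = Complex.arg (1 - x / 2) := by
      rw [← Complex.arg_real_mul (1 - x / 2) two_pos]; congr 1; push_cast; ring
    rw [abs_of_pos (rootPhase_mem_Ioo hp hpN (by simpa using him)).1, rootPhase_one_sub hpN.le him,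
      harg₂, ← hap, div_lt_iff₀ Real.pi_pos]
    nlinarith [mul_le_mul_of_nonneg_left (le_abs_self (Complex.arg (1 - x / 2))) ha]

lemma slitRoot_p_exp (hp : 3 ≤ p) (hpN : p < N) (hap : a * p = (N - p : ℕ))
    (hτ : τ.im ∈ Set.Ioo (-(2 * π)) 0) (hz : ‖lobeVar p (N - p) τ‖ < ca.δ) :
    slitRoot N p p (Complex.exp τ) = 1 - ca.φ (lobeVar p (N - p) τ) := by
  have ha := nonneg_of_mul_natCast_eq (by omega) hap
  have hp' : (p : ℝ) ≠ 0 := Nat.cast_ne_zero.2 (by omega)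
  refine slitRoot_eq (by omega) hpN (neg_exp_mem_slitPlane hτ) ?_ ⟨0, ?_⟩
  · rw [betheMap_one_sub, ca.φ_pow_mul_two_sub_φ_pow hap hz, lobeVar_pow_mul (by omega)]
  · have hphase : rootPhase N p (1 - ca.φ (lobeVar p (N - p) τ)) = p + τ.im / π := by
      rw [rootPhase_one_sub hpN.le (ca.im_φ_lobeVar_neg hap hp hτ hz),
        ca.arg_φ_lobeVar hap hp (Set.Ioo_subset_Ioc_self hτ) hz, ca.arg_two_sub_φ ha hz, ← hap]
      field_simp
      ring
    have h₁ : -2 < τ.im / π := by rw [lt_div_iff₀ Real.pi_pos]; linarith [hτ.1]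
    have h₂ : τ.im / π < 0 := div_neg_of_neg_of_pos hτ.2 Real.pi_pos
    rw [hphase]
    constructor <;> push_cast <;> linarith

lemma slitRoot_N_exp (hp : 0 < p) (hpN : p + 3 ≤ N) (hbp : b * (N - p : ℕ) = p)
    (hτ : τ.im ∈ Set.Ioo (-(2 * π)) 0) (hz : ‖lobeVar (N - p) p τ‖ < cb.δ) :
    slitRoot N p N (Complex.exp τ) = -1 + cb.φ (lobeVar (N - p) p τ) := by
  have hn : 3 ≤ N - p := by omega
  have hb := nonneg_of_mul_natCast_eq (by omega) hbp
  have hn' : ((N - p : ℕ) : ℝ) ≠ 0 := Nat.cast_ne_zero.2 (by omega)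
  refine slitRoot_eq hp (by omega) (neg_exp_mem_slitPlane hτ) ?_ ⟨1, ?_⟩
  · rw [betheMap_neg_one_add, cb.φ_pow_mul_two_sub_φ_pow hbp hz, lobeVar_pow_mul (by omega)]
  · have hphase : rootPhase N p (-1 + cb.φ (lobeVar (N - p) p τ)) = -p + τ.im / π := by
      rw [rootPhase_neg_one_add (by omega) (cb.im_φ_lobeVar_neg hbp hn hτ hz),
        cb.arg_φ_lobeVar hbp hn (Set.Ioo_subset_Ioc_self hτ) hz, cb.arg_two_sub_φ hb hz, ← hbp]
      field_simp
      ring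
    have h₁ : -2 < τ.im / π := by rw [lt_div_iff₀ Real.pi_pos]; linarith [hτ.1]
    have h₂ : τ.im / π < 0 := div_neg_of_neg_of_pos hτ.2 Real.pi_pos
    rw [hphase]
    constructor <;> push_cast <;> linarith

lemma root_exp_eq_of_slitRoot (hp : 0 < p) (hpN : p < N) {j : ℕ} {f : ℂ → ℂ}
    (hτ : τ.im ∈ Set.Ioc (-(2 * π)) 0)
    (hf : Tendsto (fun δ : ℝ => f (τ + δ * Complex.I)) (𝓝[<] 0) (𝓝 (f τ)))
    (h : ∀ σ : ℂ, σ.re = τ.re → σ.im ∈ Set.Ioo (-(2 * π)) 0 →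
      slitRoot N p j (Complex.exp σ) = f σ) : root N p j (Complex.exp τ) = f τ := by
  rcases hτ.2.lt_or_eq with him | him
  · rw [root_eq_slitRoot (neg_exp_mem_slitPlane ⟨hτ.1, him⟩), h τ rfl ⟨hτ.1, him⟩]
  · have hexp : Complex.exp τ = (Real.exp τ.re : ℝ) := by
      rw [Complex.ofReal_exp]; congr 1; exact Complex.ext rfl (by simpa using him)
    have hlim := tendsto_slitRoot_root hp hpN (Real.exp_pos τ.re) j
    rw [← hexp] at hlim
    refine tendsto_nhds_unique hlim (hf.congr' ?_)
    filter_upwards [Ioo_mem_nhdsLT (show -(2 * π) < 0 by linarith [Real.pi_pos])] with δ hδ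
    rw [← Complex.exp_add, h _ (by simp) (by simpa [him] using hδ)]

lemma root_p_exp (hp : 3 ≤ p) (hpN : p < N) (hap : a * p = (N - p : ℕ))
    (hτ : τ.im ∈ Set.Ioc (-(2 * π)) 0) (hz : ‖lobeVar p (N - p) τ‖ < ca.δ) :
    root N p p (Complex.exp τ) = 1 - ca.φ (lobeVar p (N - p) τ) := by
  refine root_exp_eq_of_slitRoot (by omega) hpN
    (f := fun σ => 1 - ca.φ (lobeVar p (N - p) σ)) hτ
    (((ca.continuousAt_φ hz).tendsto.comp (tendsto_lobeVar _ _ τ)).const_sub 1) ?_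
  intro σ hσ hσ'
  exact slitRoot_p_exp ca hp hpN hap hσ' (by rwa [norm_lobeVar, hσ, ← norm_lobeVar])

lemma root_N_exp (hp : 0 < p) (hpN : p + 3 ≤ N) (hbp : b * (N - p : ℕ) = p)
    (hτ : τ.im ∈ Set.Ioc (-(2 * π)) 0) (hz : ‖lobeVar (N - p) p τ‖ < cb.δ) :
    root N p N (Complex.exp τ) = -1 + cb.φ (lobeVar (N - p) p τ) := by
  refine root_exp_eq_of_slitRoot hp (by omega)
    (f := fun σ => -1 + cb.φ (lobeVar (N - p) p σ)) hτ
    (((cb.continuousAt_φ hz).tendsto.comp (tendsto_lobeVar _ _ τ)).const_add (-1)) ?_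
  intro σ hσ hσ'
  exact slitRoot_N_exp cb hp hpN hbp hσ' (by rwa [norm_lobeVar, hσ, ← norm_lobeVar])

/-- The standard primitive `p`-th root of unity. -/
def unityRoot (p : ℕ) : ℂ := Complex.exp (2 * π * Complex.I / p)

lemma isPrimitiveRoot_unityRoot (hp : p ≠ 0) : IsPrimitiveRoot (unityRoot p) p :=
  Complex.isPrimitiveRoot_exp p hp

lemma norm_mul_unityRoot_pow (hp : p ≠ 0) (z : ℂ) (k : ℕ) : ‖z * unityRoot p ^ k‖ = ‖z‖ := by
  rw [norm_mul, norm_pow, (isPrimitiveRoot_unityRoot hp).norm'_eq_one hp, one_pow, mul_one]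

lemma map_slitRoot_exp (hp : 0 < p) (hpN : p < N) (hap : a * p = (N - p : ℕ))
    (hτ : -Complex.exp τ ∈ Complex.slitPlane) (hz : ‖lobeVar p (N - p) τ‖ < ca.δ) :
    (Finset.Icc 1 p).val.map (fun j => slitRoot N p j (Complex.exp τ))
      = (Finset.range p).val.map
          fun k => 1 - ca.φ (lobeVar p (N - p) τ * unityRoot p ^ k) := by
  have ha := nonneg_of_mul_natCast_eq hp.ne' hap
  have hprim := isPrimitiveRoot_unityRoot hp.ne'
  have hzk : ∀ k, ‖lobeVar p (N - p) τ * unityRoot p ^ k‖ < ca.δ := fun k => by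
    rwa [norm_mul_unityRoot_pow hp.ne']
  refine (Multiset.eq_of_le_of_card_le ((Multiset.le_iff_subset ?_).2 ?_) (by simp)).symm
  · refine Multiset.Nodup.map_on (fun k hk l hl hkl => ?_) (Finset.range p).nodup
    have h := ca.injOn_φ ha (hzk k) (hzk l) (sub_right_injective hkl)
    exact hprim.pow_inj (Finset.mem_range.1 hk) (Finset.mem_range.1 hl)
      (mul_left_cancel₀ (Complex.exp_ne_zero _) h)
  · intro u hu
    obtain ⟨k, -, rfl⟩ := Multiset.mem_map.1 hu
    have hroot : betheMap N p (1 - ca.φ (lobeVar p (N - p) τ * unityRoot p ^ k))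
        = Complex.exp τ := by
      rw [betheMap_one_sub, ca.φ_pow_mul_two_sub_φ_pow hap (hzk k), mul_pow, ← pow_mul,
        mul_comm k, pow_mul, hprim.pow_eq_one, one_pow, mul_one, lobeVar_pow_mul hp.ne']
    obtain ⟨j, hj, hju⟩ := exists_slitRoot_eq_of_abs_rootPhase_lt hp hpN hτ hroot
      (abs_rootPhase_one_sub_lt hp hpN hap (ca.mul_norm_φ_le ha (hzk k))
        (offSegment_of_betheMap_eq hτ hroot))
    exact Multiset.mem_map.2 ⟨j, hj, hju⟩

open Polynomial in
lemma map_val_eq_of_tendsto {ι κ α K : Type*} [Field K] [Infinite K] [TopologicalSpace K]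
    [IsTopologicalRing K] [T2Space K] {l : Filter α} [l.NeBot] {s : Finset ι} {t : Finset κ}
    {f : α → ι → K} {g : α → κ → K} {f' : ι → K} {g' : κ → K}
    (hf : ∀ i ∈ s, Tendsto (f · i) l (𝓝 (f' i))) (hg : ∀ k ∈ t, Tendsto (g · k) l (𝓝 (g' k)))
    (h : ∀ᶠ x in l, s.val.map (f x) = t.val.map (g x)) : s.val.map f' = t.val.map g' := by
  have hprod (z : K) : ∏ i ∈ s, (z - f' i) = ∏ k ∈ t, (z - g' k) := by
    refine tendsto_nhds_unique (tendsto_finsetProd s fun i hi => (hf i hi).const_sub z)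
      ((tendsto_finsetProd t fun k hk => (hg k hk).const_sub z).congr' ?_)
    filter_upwards [h] with x hx
    simpa only [Multiset.map_map, Function.comp_def, Finset.prod_map_val] using
      (congrArg (fun m => (m.map (z - ·)).prod) hx).symm
  have hpoly : ((s.val.map f').map (X - C ·)).prod = ((t.val.map g').map (X - C ·)).prod := by
    refine Polynomial.funext fun z => ?_
    simpa only [eval_prod, Multiset.map_map, Function.comp_def, Finset.prod_map_val,
      eval_sub, eval_X, eval_C] using hprod z
  rw [← roots_multiset_prod_X_sub_C (s.val.map f'), hpoly, roots_multiset_prod_X_sub_C]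

lemma map_root_exp (hp : 0 < p) (hpN : p < N) (hap : a * p = (N - p : ℕ))
    (hz : ‖lobeVar p (N - p) τ‖ < ca.δ) :
    (Finset.Icc 1 p).val.map (fun j => root N p j (Complex.exp τ))
      = (Finset.range p).val.map
          fun k => 1 - ca.φ (lobeVar p (N - p) τ * unityRoot p ^ k) := by
  rcases neg_mem_slitPlane_or_exists_pos (Complex.exp_ne_zero τ) with hτ | ⟨r, hr, hτ⟩
  · simpa only [root_eq_slitRoot hτ] using map_slitRoot_exp ca hp hpN hap hτ hz
  · rw [hτ]
    refine map_val_eq_of_tendsto (fun j _ => tendsto_slitRoot_root hp hpN hr j) (fun k _ =>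
      (((ca.continuousAt_φ (by rwa [norm_mul_unityRoot_pow hp.ne'])).tendsto.comp
        ((tendsto_lobeVar p (N - p) τ).mul_const _)).const_sub 1)) ?_
    filter_upwards [Ioo_mem_nhdsLT (neg_lt_zero.2 Real.pi_pos)] with δ hδ
    have hslit := neg_mul_exp_mem_slitPlane hr hδ
    rw [← hτ, ← Complex.exp_add] at hslit ⊢
    exact map_slitRoot_exp ca hp hpN hap hslit (by rwa [norm_lobeVar_add_mul_I])

lemma sum_root_exp (hp : 0 < p) (hpN : p < N) (hap : a * p = (N - p : ℕ))
    (hz : ‖lobeVar p (N - p) τ‖ < ca.δ) (f : ℂ → ℂ) :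
    ∑ j ∈ Finset.Icc 1 p, f (root N p j (Complex.exp τ))
      = ∑ k ∈ Finset.range p, f (1 - ca.φ (lobeVar p (N - p) τ * unityRoot p ^ k)) := by
  simpa only [Multiset.map_map, Function.comp_def, Finset.sum_map_val] using
    congrArg (fun m => (m.map f).sum) (map_root_exp ca hp hpN hap hz)

lemma prod_root_exp (hp : 0 < p) (hpN : p < N) (hap : a * p = (N - p : ℕ))
    (hz : ‖lobeVar p (N - p) τ‖ < ca.δ) (f : ℂ → ℂ) :
    ∏ j ∈ Finset.Icc 1 p, f (root N p j (Complex.exp τ))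
      = ∏ k ∈ Finset.range p, f (1 - ca.φ (lobeVar p (N - p) τ * unityRoot p ^ k)) := by
  simpa only [Multiset.map_map, Function.comp_def, Finset.prod_map_val] using
    congrArg (fun m => (m.map f).prod) (map_root_exp ca hp hpN hap hz)

end SmallRoots

/-! ### The consistency conditions as a fixed-point equation for `log C` -/

section FixedPoint

lemma prod_neg_unityRoot_pow (hp : p ≠ 0) : ∏ k ∈ Finset.range p, (-unityRoot p ^ k) = -1 := by
  have h := congrArg (Polynomial.eval 0) (X_pow_sub_C_eq_prod (isPrimitiveRoot_unityRoot hp)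
    (Nat.pos_of_ne_zero hp) (one_pow p))
  rw [Polynomial.eval_prod] at h
  simpa [hp] using h.symm

lemma exp_log_two : Complex.exp (Real.log 2 : ℝ) = 2 := by
  simpa only [Nat.cast_one, one_mul, pow_one] using exp_natCast_mul_log_two 1

namespace LobeChart

variable {a : ℝ} (c : LobeChart a) {z : ℂ}

lemma log_two_sub_φ (ha : 0 ≤ a) (hz : ‖z‖ < c.δ) :
    Complex.log (2 - c.φ z) = (Real.log 2 : ℝ) + c.ℓ z := by
  have him := abs_lt.1 (c.abs_im_ℓ_lt ha hz)
  rw [c.two_sub_φ, ← exp_log_two, ← Complex.exp_add, Complex.log_exp] <;>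
    rw [Complex.add_im, Complex.ofReal_im] <;> linarith [Real.pi_gt_three]

lemma one_sub_φ_sub_one_div_add_one (hz : ‖z‖ < c.δ) :
    (1 - c.φ z - 1) / (1 - c.φ z + 1)
      = -(z * Complex.exp (-((Real.log 2 : ℝ) + (1 + a) * c.ℓ z))) := by
  rw [show 1 - c.φ z + 1 = 2 - c.φ z by ring, show 1 - c.φ z - 1 = -c.φ z by ring,
    c.two_sub_φ, c.φ_eq hz, ← exp_log_two, ← Complex.exp_add, neg_div, mul_div_assoc,
    ← Complex.exp_sub]
  congr 3; ring

end LobeChart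

variable {a b γ : ℝ} {ca : LobeChart a} {cb : LobeChart b} {τ : ℂ}

/-- The conditions under which the roots near `1` and near `-1` at `C = e^τ` are given by the
charts `ca` and `cb`. -/
structure ChartDomain (ca : LobeChart a) (cb : LobeChart b) (N p : ℕ) (τ : ℂ) : Prop where
  three_le : 3 ≤ p
  add_three_le : p + 3 ≤ N
  mul_left : a * p = (N - p : ℕ)
  mul_right : b * (N - p : ℕ) = p
  im_mem : τ.im ∈ Set.Ioc (-(2 * π)) 0
  norm_left_lt : ‖lobeVar p (N - p) τ‖ < ca.δ
  norm_right_lt : ‖lobeVar (N - p) p τ‖ < cb.δ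

/-- The sum of `log ((1 + u) / 2)` over the `p` roots `u` near `1`. -/
def lobeSum (ca : LobeChart a) (N p : ℕ) (τ : ℂ) : ℂ :=
  ∑ k ∈ Finset.range p, ca.ℓ (lobeVar p (N - p) τ * unityRoot p ^ k)

/-- The correction to the leading order of `τ = log C` in the consistency equations. -/
def lobeShift (ca : LobeChart a) (cb : LobeChart b) (N p : ℕ) (τ : ℂ) : ℂ :=
  p * cb.ℓ (lobeVar (N - p) p τ)
    + (N - p : ℕ) * (ca.ℓ (lobeVar p (N - p) τ) - lobeSum ca N p τ)

/-- The leading order `γ p (N - p) + N log 2` of `log C`. -/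
def leadingLog (N p : ℕ) (γ : ℝ) : ℝ := p * (N - p : ℕ) * γ + N * Real.log 2

namespace ChartDomain

lemma pos (h : ChartDomain ca cb N p τ) : 0 < p := by have := h.three_le; omega

lemma lt (h : ChartDomain ca cb N p τ) : p < N := by have := h.add_three_le; omega

lemma sub_ne_zero (h : ChartDomain ca cb N p τ) : N - p ≠ 0 := by have := h.lt; omega

lemma left_nonneg (h : ChartDomain ca cb N p τ) : 0 ≤ a :=
  nonneg_of_mul_natCast_eq h.pos.ne' h.mul_left

lemma right_nonneg (h : ChartDomain ca cb N p τ) : 0 ≤ b :=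
  nonneg_of_mul_natCast_eq h.sub_ne_zero h.mul_right

lemma norm_mul_pow_lt (h : ChartDomain ca cb N p τ) (k : ℕ) :
    ‖lobeVar p (N - p) τ * unityRoot p ^ k‖ < ca.δ := by
  rw [norm_mul_unityRoot_pow h.pos.ne']; exact h.norm_left_lt

lemma root_p_eq (h : ChartDomain ca cb N p τ) :
    root N p p (Complex.exp τ) = 1 - ca.φ (lobeVar p (N - p) τ) :=
  root_p_exp ca h.three_le h.lt h.mul_left h.im_mem h.norm_left_lt

lemma root_N_eq (h : ChartDomain ca cb N p τ) :
    root N p N (Complex.exp τ) = -1 + cb.φ (lobeVar (N - p) p τ) :=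
  root_N_exp cb h.pos h.add_three_le h.mul_right h.im_mem h.norm_right_lt

lemma sum_log_one_add_root (h : ChartDomain ca cb N p τ) :
    ∑ j ∈ Finset.Icc 1 p, Complex.log (1 + root N p j (Complex.exp τ))
      = p * (Real.log 2 : ℝ) + lobeSum ca N p τ := by
  have hlog (k : ℕ) : Complex.log (1 + (1 - ca.φ (lobeVar p (N - p) τ * unityRoot p ^ k)))
      = (Real.log 2 : ℝ) + ca.ℓ (lobeVar p (N - p) τ * unityRoot p ^ k) := by
    rw [← ca.log_two_sub_φ h.left_nonneg (h.norm_mul_pow_lt k)]; congr 1; ring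
  rw [sum_root_exp ca h.pos h.lt h.mul_left h.norm_left_lt fun u => Complex.log (1 + u),
    Finset.sum_congr rfl fun k _ => hlog k, Finset.sum_add_distrib, Finset.sum_const,
    Finset.card_range, nsmul_eq_mul, lobeSum]

lemma log_root_N_div_root_p (h : ChartDomain ca cb N p τ) :
    Complex.log ((root N p N (Complex.exp τ) + 1) / (root N p p (Complex.exp τ) + 1))
      = lobeLog (N - p) p τ - b * cb.ℓ (lobeVar (N - p) p τ)
        - ((Real.log 2 : ℝ) + ca.ℓ (lobeVar p (N - p) τ)) := by
  have hquot : (root N p N (Complex.exp τ) + 1) / (root N p p (Complex.exp τ) + 1)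
      = Complex.exp (lobeLog (N - p) p τ - b * cb.ℓ (lobeVar (N - p) p τ)
        - ((Real.log 2 : ℝ) + ca.ℓ (lobeVar p (N - p) τ))) := by
    rw [h.root_p_eq, h.root_N_eq, neg_add_cancel_comm, cb.φ_lobeVar h.norm_right_lt,
      show 1 - ca.φ (lobeVar p (N - p) τ) + 1 = 2 - ca.φ (lobeVar p (N - p) τ) by ring,
      ca.two_sub_φ, ← exp_log_two, ← Complex.exp_add, ← Complex.exp_sub]
  have him : (lobeLog (N - p) p τ - b * cb.ℓ (lobeVar (N - p) p τ)
        - ((Real.log 2 : ℝ) + ca.ℓ (lobeVar p (N - p) τ))).im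
      = τ.im / (N - p : ℕ) - b * (cb.ℓ (lobeVar (N - p) p τ)).im
        - (ca.ℓ (lobeVar p (N - p) τ)).im := by
    rw [Complex.sub_im, Complex.sub_im, lobeLog_im, Complex.im_ofReal_mul, Complex.add_im,
      Complex.ofReal_im, zero_add]
  have h₀ := abs_le.1 (abs_im_div_le (s := N - p) (by have := h.add_three_le; omega) h.im_mem)
  have h₁ := abs_lt.1 (cb.abs_mul_im_ℓ_lt h.right_nonneg h.norm_right_lt)
  have h₂ := abs_lt.1 (ca.abs_im_ℓ_lt h.left_nonneg h.norm_left_lt)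
  rw [hquot, Complex.log_exp] <;> rw [him] <;> linarith [Real.pi_gt_three]

lemma logConsistency_iff (h : ChartDomain ca cb N p τ) :
    LogConsistency N p γ (Complex.exp τ) ↔ τ = leadingLog N p γ + lobeShift ca cb N p τ := by
  have hp : (p : ℂ) ≠ 0 := Nat.cast_ne_zero.2 h.pos.ne'
  have hn : ((N - p : ℕ) : ℂ) ≠ 0 := Nat.cast_ne_zero.2 h.sub_ne_zero
  have hb : (b : ℂ) * (N - p : ℕ) = p := by exact_mod_cast h.mul_right
  have hN : (N : ℂ) = p + (N - p : ℕ) := by rw [Nat.cast_sub h.lt.le]; ring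
  have hlog : Complex.log 2 = (Real.log 2 : ℝ) := by
    rw [Complex.ofReal_log two_pos.le, Complex.ofReal_ofNat]
  have hdiff : 1 / (p : ℂ) * Complex.log ((root N p N (Complex.exp τ) + 1) /
        (root N p p (Complex.exp τ) + 1)) + G N p (Complex.exp τ) - γ
      = (τ - (leadingLog N p γ + lobeShift ca cb N p τ)) / (p * (N - p : ℕ)) := by
    rw [G, h.sum_log_one_add_root, h.log_root_N_div_root_p, hlog, leadingLog, lobeShift, lobeLog]
    push_cast [-Nat.cast_sub]
    rw [hN]
    generalize ((N - p : ℕ) : ℂ) = n at *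
    field_simp
    linear_combination (-cb.ℓ (lobeVar (N - p) p τ)) * hb
  rw [LogConsistency, ← sub_eq_zero, hdiff, div_eq_zero_iff, or_iff_left (mul_ne_zero hp hn),
    sub_eq_zero]

end ChartDomain

lemma prod_negSelection {M : Type*} [CommMonoid M] (hp : 0 < p) (hpN : p < N) (f : ℕ → M) :
    (∏ j ∈ negSelection N p, f j) * f p = f N * ∏ j ∈ Finset.Icc 1 p, f j := by
  obtain ⟨q, rfl⟩ := Nat.exists_eq_add_of_lt hp
  rw [negSelection, Finset.prod_insert (by simp; omega), Finset.prod_Icc_succ_top (by omega),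
    Nat.add_sub_cancel, mul_assoc]

lemma sum_negSelection {M : Type*} [AddCommMonoid M] (hp : 0 < p) (hpN : p < N) (f : ℕ → M) :
    (∑ j ∈ negSelection N p, f j) + f p = f N + ∑ j ∈ Finset.Icc 1 p, f j :=
  congrArg Multiplicative.toAdd
    (prod_negSelection hp hpN fun j => Multiplicative.ofAdd (f j))

namespace ChartDomain

lemma root_p_sub_one_div_add_one (h : ChartDomain ca cb N p τ) :
    (root N p p (Complex.exp τ) - 1) / (root N p p (Complex.exp τ) + 1)
      = -Complex.exp (lobeLog p (N - p) τ
        - ((Real.log 2 : ℝ) + (1 + a) * ca.ℓ (lobeVar p (N - p) τ))) := by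
  rw [h.root_p_eq, ca.one_sub_φ_sub_one_div_add_one h.norm_left_lt, sub_eq_add_neg (lobeLog _ _ _),
    Complex.exp_add, ← lobeVar]

lemma root_N_sub_one_div_add_one (h : ChartDomain ca cb N p τ) :
    (root N p N (Complex.exp τ) - 1) / (root N p N (Complex.exp τ) + 1)
      = -Complex.exp ((Real.log 2 : ℝ) + (1 + b) * cb.ℓ (lobeVar (N - p) p τ)
        - lobeLog (N - p) p τ) := by
  rw [h.root_N_eq, neg_add_cancel_comm,
    show -1 + cb.φ (lobeVar (N - p) p τ) - 1 = -(2 - cb.φ (lobeVar (N - p) p τ)) by ring,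
    cb.two_sub_φ, cb.φ_lobeVar h.norm_right_lt, ← exp_log_two, ← Complex.exp_add, neg_div,
    ← Complex.exp_sub]
  congr 2; ring

lemma prod_sub_one_div_add_one (h : ChartDomain ca cb N p τ) :
    ∏ j ∈ Finset.Icc 1 p, (root N p j (Complex.exp τ) - 1) / (root N p j (Complex.exp τ) + 1)
      = -Complex.exp (τ - N * (Real.log 2 : ℝ) - (1 + a) * lobeSum ca N p τ) := by
  have hpow : lobeVar p (N - p) τ ^ p = Complex.exp (τ - (N - p : ℕ) * (Real.log 2 : ℝ)) := by
    rw [Complex.exp_sub, exp_natCast_mul_log_two, eq_div_iff (pow_ne_zero _ two_ne_zero),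
      lobeVar_pow_mul h.pos.ne']
  have hfactor (k : ℕ) : (1 - ca.φ (lobeVar p (N - p) τ * unityRoot p ^ k) - 1) /
        (1 - ca.φ (lobeVar p (N - p) τ * unityRoot p ^ k) + 1)
      = lobeVar p (N - p) τ * -unityRoot p ^ k * Complex.exp
        (-((Real.log 2 : ℝ) + (1 + a) * ca.ℓ (lobeVar p (N - p) τ * unityRoot p ^ k))) := by
    rw [ca.one_sub_φ_sub_one_div_add_one (h.norm_mul_pow_lt k)]; ring
  rw [prod_root_exp ca h.pos h.lt h.mul_left h.norm_left_lt fun u => (u - 1) / (u + 1),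
    Finset.prod_congr rfl fun k _ => hfactor k, Finset.prod_mul_distrib, Finset.prod_mul_distrib,
    prod_neg_unityRoot_pow h.pos.ne', Finset.prod_const, Finset.card_range, ← Complex.exp_sum,
    Finset.sum_neg_distrib, Finset.sum_add_distrib, ← Finset.mul_sum, ← lobeSum, Finset.sum_const,
    Finset.card_range, nsmul_eq_mul, hpow, mul_neg_one, neg_mul, ← Complex.exp_add,
    Nat.cast_sub h.lt.le]
  congr 2; ring

lemma prod_negSelection_eq (h : ChartDomain ca cb N p τ) :
    2 ^ N * Complex.exp (γ * N) * ∏ j ∈ negSelection N p,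
        (root N p j (Complex.exp τ) - 1) / (root N p j (Complex.exp τ) + 1)
      = -(Complex.exp (-((N / (p * (N - p : ℕ)) : ℝ) *
        (τ - (leadingLog N p γ + lobeShift ca cb N p τ)))) * Complex.exp τ) := by
  have hp : (p : ℂ) ≠ 0 := Nat.cast_ne_zero.2 h.pos.ne'
  have hn : ((N - p : ℕ) : ℂ) ≠ 0 := Nat.cast_ne_zero.2 h.sub_ne_zero
  have hb : (b : ℂ) = p / (N - p : ℕ) := by
    rw [eq_div_iff hn]; exact_mod_cast h.mul_right
  have ha : (a : ℂ) = (N - p : ℕ) / p := by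
    rw [eq_div_iff hp]; exact_mod_cast h.mul_left
  have hN : (N : ℂ) = p + (N - p : ℕ) := by rw [Nat.cast_sub h.lt.le]; ring
  have hprod := prod_negSelection h.pos h.lt
    fun j => (root N p j (Complex.exp τ) - 1) / (root N p j (Complex.exp τ) + 1)
  rw [h.prod_sub_one_div_add_one, h.root_p_sub_one_div_add_one, h.root_N_sub_one_div_add_one,
    neg_mul_neg, ← eq_div_iff (neg_ne_zero.2 (Complex.exp_ne_zero _)), div_neg, ← Complex.exp_add,
    ← Complex.exp_sub] at hprod
  rw [hprod, ← exp_natCast_mul_log_two, ← Complex.exp_add, mul_neg, ← Complex.exp_add,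
    ← Complex.exp_add, lobeShift, leadingLog, lobeLog, lobeLog]
  congr 2
  push_cast [-Nat.cast_sub]
  rw [hb, ha]
  generalize ((N - p : ℕ) : ℂ) = n at *
  rw [hN]
  field_simp
  ring

lemma consistency_iff_exp (h : ChartDomain ca cb N p τ) :
    Consistency N p γ (negSelection N p) (Complex.exp τ) ↔
      Complex.exp (-((N / (p * (N - p : ℕ)) : ℝ) *
        (τ - (leadingLog N p γ + lobeShift ca cb N p τ)))) = 1 := by
  have hne : ∀ j ∈ negSelection N p, root N p j (Complex.exp τ) + 1 ≠ 0 := fun j _ => by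
    rw [add_comm]
    refine one_add_ne_zero_of_betheMap_ne_zero h.lt ?_
    rw [betheMap_root h.pos h.lt (Complex.exp_ne_zero τ)]
    exact Complex.exp_ne_zero τ
  rw [Consistency, and_iff_right hne, h.prod_negSelection_eq, neg_add_eq_zero,
    mul_eq_right₀ (Complex.exp_ne_zero τ)]

end ChartDomain

lemma exp_eq_one_iff_of_abs_im_lt {z : ℂ} (hz : |z.im| < 2 * π) : Complex.exp z = 1 ↔ z = 0 := by
  refine ⟨fun h => ?_, fun h => by rw [h, Complex.exp_zero]⟩
  obtain ⟨m, rfl⟩ := Complex.exp_eq_one_iff.1 h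
  rw [show ((m : ℂ) * (2 * π * Complex.I)).im = m * (2 * π) by simp, abs_mul,
    abs_of_pos Real.two_pi_pos] at hz
  have hm : |(m : ℝ)| < 1 := lt_of_mul_lt_mul_right (by rwa [one_mul]) Real.two_pi_pos.le
  have hm' : m = 0 := Int.abs_lt_one_iff.1 (by exact_mod_cast hm)
  rw [hm', Int.cast_zero, zero_mul]

lemma ChartDomain.consistency_iff (h : ChartDomain ca cb N p τ) (hp : 4 ≤ p) (hpN : p + 4 ≤ N)
    (hshift : ‖lobeShift ca cb N p τ‖ ≤ 1) :
    Consistency N p γ (negSelection N p) (Complex.exp τ) ↔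
      τ = leadingLog N p γ + lobeShift ca cb N p τ := by
  have hp' : (4 : ℝ) ≤ p := by exact_mod_cast hp
  have hn : (4 : ℝ) ≤ (N - p : ℕ) := by exact_mod_cast (by omega : 4 ≤ N - p)
  have hN : (N : ℝ) = p + (N - p : ℕ) := by rw [Nat.cast_sub (by omega)]; ring
  have hr₀ : (N : ℝ) / (p * (N - p : ℕ)) > 0 := by rw [hN]; positivity
  have hr : (N : ℝ) / (p * (N - p : ℕ)) ≤ 1 / 2 := by
    rw [hN, div_le_iff₀ (by positivity)]; nlinarith
  have him : |(τ - (leadingLog N p γ + lobeShift ca cb N p τ)).im| ≤ 2 * π + 1 := by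
    have h₁ := abs_le.1 ((Complex.abs_im_le_norm _).trans hshift)
    rw [Complex.sub_im, Complex.add_im, Complex.ofReal_im, abs_le]
    constructor <;> linarith [h.im_mem.1, h.im_mem.2, Real.pi_pos]
  rw [h.consistency_iff_exp, exp_eq_one_iff_of_abs_im_lt, neg_eq_zero, mul_eq_zero,
    Complex.ofReal_eq_zero, or_iff_right hr₀.ne', sub_eq_zero]
  rw [Complex.neg_im, abs_neg, Complex.im_ofReal_mul, abs_mul, abs_of_pos hr₀]
  calc _ ≤ 1 / 2 * (2 * π + 1) := by gcongr
    _ < 2 * π := by linarith [Real.pi_gt_three]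

end FixedPoint

section LobeShift

variable {a b : ℝ} (ca : LobeChart a) (cb : LobeChart b) {τ : ℂ}

lemma lobeVar_conj (s t : ℕ) (τ : ℂ) : lobeVar s t (conj τ) = conj (lobeVar s t τ) := by
  rw [lobeVar, lobeVar, ← Complex.exp_conj, lobeLog, lobeLog, map_div₀, map_sub, map_mul,
    Complex.conj_ofReal, Complex.conj_natCast, Complex.conj_natCast]

lemma differentiable_lobeVar (s t : ℕ) : Differentiable ℂ (lobeVar s t) := by
  unfold lobeVar lobeLog; fun_prop

lemma sum_conj_unityRoot_pow {M : Type*} [AddCommGroup M] (hp : p ≠ 0) (f : ℂ → M) :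
    ∑ k ∈ Finset.range p, f (conj (unityRoot p ^ k))
      = ∑ k ∈ Finset.range p, f (unityRoot p ^ k) := by
  have hprim := isPrimitiveRoot_unityRoot hp
  have hconj : ∀ k ∈ Finset.range p, f (conj (unityRoot p ^ k))
      = f (unityRoot p ^ (p - 1 - k + 1)) := fun k hk => by
    have hk' := Finset.mem_range.1 hk
    rw [map_pow, ← Complex.inv_eq_conj (hprim.norm'_eq_one hp), inv_pow]
    refine congrArg f (inv_eq_of_mul_eq_one_right ?_)
    rw [← pow_add, show k + (p - 1 - k + 1) = p by omega, hprim.pow_eq_one]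
  have hshift := Finset.sum_range_succ (fun k => f (unityRoot p ^ k)) p
  rw [Finset.sum_range_succ', hprim.pow_eq_one, pow_zero] at hshift
  rw [Finset.sum_congr rfl hconj, Finset.sum_range_reflect (fun k => f (unityRoot p ^ (k + 1))) p]
  exact add_right_cancel hshift

lemma lobeSum_conj (hp : p ≠ 0) (hζ : ‖lobeVar p (N - p) τ‖ < ca.δ) :
    lobeSum ca N p (conj τ) = conj (lobeSum ca N p τ) := by
  rw [lobeSum, lobeSum, map_sum, lobeVar_conj,
    ← sum_conj_unityRoot_pow hp fun w => ca.ℓ (conj (lobeVar p (N - p) τ) * w)]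
  refine Finset.sum_congr rfl fun k _ => ?_
  rw [← map_mul, ca.ℓ_conj (by rwa [norm_mul_unityRoot_pow hp])]

lemma lobeShift_conj (hp : p ≠ 0) (hζ : ‖lobeVar p (N - p) τ‖ < ca.δ)
    (hξ : ‖lobeVar (N - p) p τ‖ < cb.δ) :
    lobeShift ca cb N p (conj τ) = conj (lobeShift ca cb N p τ) := by
  rw [lobeShift, lobeShift, lobeSum_conj ca hp hζ, lobeVar_conj, lobeVar_conj, cb.ℓ_conj hξ,
    ca.ℓ_conj hζ]
  simp only [map_add, map_mul, map_sub, map_natCast]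

lemma differentiableAt_lobeSum (hp : p ≠ 0) (hζ : ‖lobeVar p (N - p) τ‖ < ca.δ) :
    DifferentiableAt ℂ (lobeSum ca N p) τ :=
  DifferentiableAt.fun_sum fun k _ =>
    (ca.differentiableAt_ℓ (by rwa [norm_mul_unityRoot_pow hp])).comp τ
      ((differentiable_lobeVar p (N - p) τ).mul_const (unityRoot p ^ k))

lemma differentiableAt_lobeShift (hp : p ≠ 0) (hζ : ‖lobeVar p (N - p) τ‖ < ca.δ)
    (hξ : ‖lobeVar (N - p) p τ‖ < cb.δ) : DifferentiableAt ℂ (lobeShift ca cb N p) τ :=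
  (((cb.differentiableAt_ℓ hξ).comp τ (differentiable_lobeVar _ _ τ)).const_mul _).add
    ((((ca.differentiableAt_ℓ hζ).comp τ (differentiable_lobeVar _ _ τ)).sub
      (differentiableAt_lobeSum ca hp hζ)).const_mul _)

lemma norm_lobeSum_le (hp : p ≠ 0) (hζ : ‖lobeVar p (N - p) τ‖ < ca.δ) :
    ‖lobeSum ca N p τ‖ ≤ p * (ca.K * ‖lobeVar p (N - p) τ‖) := by
  have hterm (k : ℕ) : ‖ca.ℓ (lobeVar p (N - p) τ * unityRoot p ^ k)‖
      ≤ ca.K * ‖lobeVar p (N - p) τ‖ := by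
    simpa only [norm_mul_unityRoot_pow hp] using
      ca.norm_ℓ_le (z := lobeVar p (N - p) τ * unityRoot p ^ k)
        (by rwa [norm_mul_unityRoot_pow hp])
  simpa [lobeSum] using norm_sum_le_of_le (Finset.range p) fun k _ => hterm k

lemma norm_lobeShift_le (hp : p ≠ 0) (hζ : ‖lobeVar p (N - p) τ‖ < ca.δ)
    (hξ : ‖lobeVar (N - p) p τ‖ < cb.δ) :
    ‖lobeShift ca cb N p τ‖ ≤ p * (cb.K * ‖lobeVar (N - p) p τ‖)
      + (N - p : ℕ) * ((1 + p) * (ca.K * ‖lobeVar p (N - p) τ‖)) := by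
  refine (norm_add_le _ _).trans (add_le_add ?_ ?_)
  · rw [norm_mul, Complex.norm_natCast]
    gcongr
    exact cb.norm_ℓ_le hξ
  · rw [norm_mul, Complex.norm_natCast, add_mul, one_mul]
    gcongr
    exact (norm_sub_le _ _).trans (add_le_add (ca.norm_ℓ_le hζ) (norm_lobeSum_le ca hp hζ))

end LobeShift

/-! ### Existence and uniqueness of the solution -/

section Solution

variable {γ : ℝ} {C : ℂ}

lemma exists_exp_eq_of_im_mem_Ioc (hC : C ≠ 0) :
    ∃ τ : ℂ, Complex.exp τ = C ∧ τ.re = Real.log ‖C‖ ∧ τ.im ∈ Set.Ioc (-(2 * π)) 0 := by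
  have hpi := Real.pi_pos
  rcases le_or_gt (Complex.arg C) 0 with h | h
  · refine ⟨Complex.log C, Complex.exp_log hC, Complex.log_re C, ?_⟩
    rw [Complex.log_im]
    exact ⟨by linarith [Complex.neg_pi_lt_arg C], h⟩
  · refine ⟨Complex.log C - 2 * π * Complex.I, ?_, by simp [Complex.log_re], ?_⟩
    · rw [Complex.exp_sub, Complex.exp_log hC, Complex.exp_two_pi_mul_I, div_one]
    · have him : (Complex.log C - 2 * π * Complex.I).im = Complex.arg C - 2 * π := by
        simp [Complex.log_im]
      rw [him]
      exact ⟨by linarith, by linarith [Complex.arg_le_pi C]⟩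

/-- The equality of moduli that either consistency condition imposes on the selected factors
`1 + u_j(C)`. -/
def ModulusCondition (N p : ℕ) (γ : ℝ) (C : ℂ) : Prop :=
  (∏ j ∈ Finset.Icc 1 p, ‖1 + root N p j C‖) * ‖1 + root N p N C‖
    = 2 ^ p * Real.exp (γ * p) * ‖1 + root N p p C‖

lemma prod_norm_one_sub_root_pow_mul (hp : 0 < p) (hpN : p < N) (hC : C ≠ 0) (A : Finset ℕ) :
    (∏ j ∈ A, ‖1 - root N p j C‖) ^ p * (∏ j ∈ A, ‖1 + root N p j C‖) ^ (N - p)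
      = ‖C‖ ^ A.card := by
  rw [← Finset.prod_pow, ← Finset.prod_pow, ← Finset.prod_mul_distrib, ← Finset.prod_const]
  refine Finset.prod_congr rfl fun j _ => ?_
  rw [← norm_betheMap, betheMap_root hp hpN hC]

lemma Consistency.prod_norm_one_sub_root {A : Finset ℕ} (h : Consistency N p γ A C) :
    2 ^ N * Real.exp (γ * N) * ∏ j ∈ A, ‖1 - root N p j C‖
      = ‖C‖ * ∏ j ∈ A, ‖1 + root N p j C‖ := by
  have hW : ∏ j ∈ A, ‖1 + root N p j C‖ ≠ 0 := Finset.prod_ne_zero_iff.2 fun j hj =>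
    norm_ne_zero_iff.2 (by rw [add_comm]; exact h.1 j hj)
  have hnorm := congrArg norm (eq_neg_of_add_eq_zero_left h.2)
  have hratio : ∏ j ∈ A, ‖(root N p j C - 1) / (root N p j C + 1)‖
      = (∏ j ∈ A, ‖1 - root N p j C‖) / ∏ j ∈ A, ‖1 + root N p j C‖ := by
    rw [← Finset.prod_div_distrib]
    refine Finset.prod_congr rfl fun j _ => ?_
    rw [norm_div, norm_sub_rev, add_comm]
  rw [norm_neg, norm_mul, norm_mul, norm_prod, hratio, norm_pow, Complex.norm_ofNat,
    Complex.norm_exp, Complex.re_ofReal_mul, Complex.natCast_re, ← mul_div_assoc,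
    div_eq_iff hW] at hnorm
  exact hnorm

/-- Raising the condition to the `p`-th power, the Bethe equation eliminates the factors
`1 - u_j`. -/
lemma Consistency.prod_norm_one_add_root (hp : 0 < p) (hpN : p < N) (hC : C ≠ 0) {A : Finset ℕ}
    (hA : A.card = p) (h : Consistency N p γ A C) :
    ∏ j ∈ A, ‖1 + root N p j C‖ = 2 ^ p * Real.exp (γ * p) := by
  have hbethe := prod_norm_one_sub_root_pow_mul hp hpN hC A
  have hcons := h.prod_norm_one_sub_root
  set W := ∏ j ∈ A, ‖1 + root N p j C‖
  set V := ∏ j ∈ A, ‖1 - root N p j C‖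
  set E := (2 : ℝ) ^ N * Real.exp (γ * N) with hE
  have hpow : E ^ p = W ^ N := by
    refine mul_left_cancel₀ (pow_ne_zero p (norm_ne_zero_iff.2 hC)) ?_
    calc ‖C‖ ^ p * E ^ p = (E * V) ^ p * W ^ (N - p) := by rw [← hA, ← hbethe, hA]; ring
      _ = ‖C‖ ^ p * (W ^ p * W ^ (N - p)) := by rw [hcons]; ring
      _ = ‖C‖ ^ p * W ^ N := by rw [← pow_add, Nat.add_sub_cancel' hpN.le]
  refine (pow_left_inj₀ (Finset.prod_nonneg fun _ _ => norm_nonneg _) (by positivity)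
    (by omega : N ≠ 0)).1 ?_
  rw [← hpow, hE, mul_pow, mul_pow, ← pow_mul, ← pow_mul, ← Real.exp_nat_mul, ← Real.exp_nat_mul,
    mul_comm N p]
  congr 2; ring

lemma card_negSelection (hp : 0 < p) (hpN : p < N) : (negSelection N p).card = p := by
  rw [negSelection, Finset.card_insert_of_notMem (by simp; omega), Nat.card_Icc]; omega

lemma Consistency.modulusCondition (hp : 0 < p) (hpN : p < N) (hC : C ≠ 0)
    (h : Consistency N p γ (negSelection N p) C) : ModulusCondition N p γ C := by
  rw [ModulusCondition, mul_comm, ← prod_negSelection hp hpN fun j => ‖1 + root N p j C‖,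
    h.prod_norm_one_add_root hp hpN hC (card_negSelection hp hpN)]

lemma LogConsistency.modulusCondition (hp : 0 < p) (hpN : p < N) (hC : C ≠ 0)
    (h : LogConsistency N p γ C) : ModulusCondition N p γ C := by
  have hne (j : ℕ) : 1 + root N p j C ≠ 0 :=
    one_add_ne_zero_of_betheMap_ne_zero hpN (by rwa [betheMap_root hp hpN hC])
  have hp' : (p : ℂ) ≠ 0 := Nat.cast_ne_zero.2 hp.ne'
  have hlog : Complex.log ((1 + root N p N C) / (1 + root N p p C))
      + ∑ j ∈ Finset.Icc 1 p, Complex.log (1 + root N p j C)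
      = p * Complex.log 2 + (γ * p : ℝ) := by
    rw [LogConsistency, G, add_comm (root N p N C), add_comm (root N p p C)] at h
    field_simp at h
    push_cast
    linear_combination h
  have hexp := congrArg norm (congrArg Complex.exp hlog)
  rw [Complex.exp_add, Complex.exp_add, Complex.exp_log (div_ne_zero (hne N) (hne p)),
    Complex.exp_sum, Finset.prod_congr rfl fun j _ => Complex.exp_log (hne j), Complex.exp_nat_mul,
    Complex.exp_log two_ne_zero, norm_mul, norm_div, norm_prod, norm_mul, norm_pow,
    Complex.norm_exp_ofReal, Complex.norm_ofNat, div_mul_eq_mul_div,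
    div_eq_iff (norm_ne_zero_iff.2 (hne p))] at hexp
  rw [ModulusCondition, mul_comm, hexp]

lemma root_N_zero (hpN : p < N) : root N p N 0 = -1 := by
  rw [root, if_pos rfl, if_neg (by omega)]

lemma not_consistency_zero (hpN : p < N) : ¬ Consistency N p γ (negSelection N p) 0 := fun h =>
  h.1 N (Finset.mem_insert_self _ _) (by rw [root_N_zero hpN, neg_add_cancel])

/-- At `C = 0` the left-hand side of the logarithmic condition vanishes: the first logarithm is
evaluated at `0`, where it is `0` by convention. -/
lemma not_logConsistency_zero (hp : 0 < p) (hpN : p < N) (hγ : γ ≠ 0) :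
    ¬ LogConsistency N p γ 0 := by
  intro h
  have hp' : (p : ℂ) ≠ 0 := Nat.cast_ne_zero.2 hp.ne'
  have hlog : ∀ j ∈ Finset.Icc 1 p, Complex.log (1 + root N p j 0) = Complex.log 2 := by
    intro j hj
    rw [root, if_pos rfl, if_pos (Finset.mem_Icc.1 hj).2, one_add_one_eq_two]
  rw [LogConsistency, G, root_N_zero hpN, Finset.sum_congr rfl hlog, Finset.sum_const,
    Nat.card_Icc, Nat.add_sub_cancel, nsmul_eq_mul, neg_add_cancel, zero_div, Complex.log_zero,
    mul_zero, zero_add, one_div, inv_mul_cancel_left₀ hp', sub_self] at h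
  exact hγ (by exact_mod_cast h.symm)

lemma norm_sub_le_of_norm_le_halfPlane {g : ℂ → ℂ} {s r M : ℝ} (hr : 0 < r)
    (hd : ∀ τ : ℂ, τ.re ≤ s + r → DifferentiableAt ℂ g τ)
    (hM : ∀ τ : ℂ, τ.re ≤ s + r → ‖g τ‖ ≤ M) {τ σ : ℂ} (hτ : τ.re ≤ s) (hσ : σ.re ≤ s) :
    ‖g σ - g τ‖ ≤ M / r * ‖σ - τ‖ := by
  have hball : ∀ x : ℂ, x.re ≤ s → ∀ z ∈ Metric.closedBall x r, z.re ≤ s + r := by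
    intro x hx z hz
    have h := (Complex.re_le_norm (z - x)).trans (mem_closedBall_iff_norm.1 hz)
    rw [Complex.sub_re] at h
    linarith
  refine Convex.norm_image_sub_le_of_norm_deriv_le (s := {x : ℂ | x.re ≤ s})
    (fun x hx => hd x ?_) (fun x hx => ?_) (convex_halfSpace_re_le s) hτ hσ
  · linarith [Set.mem_ofPred.1 hx]
  · refine Complex.norm_deriv_le_of_forall_mem_sphere_norm_le hr
      (DifferentiableOn.diffContOnCl_ball (U := Metric.closedBall x r)
        (fun z hz => (hd z (hball x hx z hz)).differentiableWithinAt) subset_rfl)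
      fun z hz => hM z (hball x hx z (Metric.sphere_subset_closedBall hz))

lemma exists_ofReal_eq_add {g : ℂ → ℂ} {T : ℝ} (hg : ∀ t : ℝ, t ≤ T + 1 → ContinuousAt g t)
    (hreal : ∀ t : ℝ, t ≤ T + 1 → (g t).im = 0) (hb : ∀ t : ℝ, t ≤ T + 1 → ‖g t‖ ≤ 1) :
    ∃ t : ℝ, t ≤ T + 1 ∧ (t : ℂ) = T + g t := by
  have hcont : ContinuousOn (fun t : ℝ => t - T - (g t).re) (Set.Icc (T - 1) (T + 1)) :=
    fun t ht => by
      have h : ContinuousAt (fun t : ℝ => g t) t :=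
        (hg t ht.2).comp Complex.continuous_ofReal.continuousAt
      exact ((continuousAt_id.sub continuousAt_const).sub
        (Complex.continuous_re.continuousAt.comp h)).continuousWithinAt
  have hre (t : ℝ) (ht : t ≤ T + 1) := abs_le.1 ((Complex.abs_re_le_norm _).trans (hb t ht))
  obtain ⟨t, ht, hzero⟩ := intermediate_value_Icc (by linarith : T - 1 ≤ T + 1) hcont
    (show (0 : ℝ) ∈ _ from
      ⟨by linarith [(hre (T - 1) (by linarith)).1], by linarith [(hre (T + 1) le_rfl).2]⟩)
  refine ⟨t, ht.2, Complex.ext ?_ ?_⟩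
  · rw [Complex.add_re, Complex.ofReal_re, Complex.ofReal_re]
    linarith
  · rw [Complex.add_im, Complex.ofReal_im, Complex.ofReal_im, hreal t ht.2, add_zero]

/-- The charts `ca` and `cb` describe the roots at `C = e^τ` for all `τ` with `re τ ≤ s + 1`, and
`lobeShift` is uniformly small there. -/
structure ChartHalfPlane {a b : ℝ} (ca : LobeChart a) (cb : LobeChart b) (N p : ℕ) (s : ℝ) :
    Prop where
  four_le : 4 ≤ p
  add_four_le : p + 4 ≤ N
  mul_left : a * p = (N - p : ℕ)
  mul_right : b * (N - p : ℕ) = p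
  norm_left_lt : ∀ {τ : ℂ}, τ.re ≤ s + 1 → ‖lobeVar p (N - p) τ‖ < ca.δ
  norm_right_lt : ∀ {τ : ℂ}, τ.re ≤ s + 1 → ‖lobeVar (N - p) p τ‖ < cb.δ
  norm_lobeShift_le : ∀ {τ : ℂ}, τ.re ≤ s + 1 → ‖lobeShift ca cb N p τ‖ ≤ 1 / 4

namespace ChartHalfPlane

variable {a b s : ℝ} {ca : LobeChart a} {cb : LobeChart b} {τ σ : ℂ}

lemma pos (h : ChartHalfPlane ca cb N p s) : 0 < p := by have := h.four_le; omega

lemma lt (h : ChartHalfPlane ca cb N p s) : p < N := by have := h.add_four_le; omega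

lemma chartDomain (h : ChartHalfPlane ca cb N p s) (hτ : τ.re ≤ s + 1)
    (him : τ.im ∈ Set.Ioc (-(2 * π)) 0) : ChartDomain ca cb N p τ where
  three_le := by have := h.four_le; omega
  add_three_le := by have := h.add_four_le; omega
  mul_left := h.mul_left
  mul_right := h.mul_right
  im_mem := him
  norm_left_lt := h.norm_left_lt hτ
  norm_right_lt := h.norm_right_lt hτ

lemma differentiableAt_lobeShift (h : ChartHalfPlane ca cb N p s) (hτ : τ.re ≤ s + 1) :
    DifferentiableAt ℂ (lobeShift ca cb N p) τ :=
  TASEP.differentiableAt_lobeShift ca cb h.pos.ne' (h.norm_left_lt hτ) (h.norm_right_lt hτ)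

lemma exists_ofReal_eq (h : ChartHalfPlane ca cb N p s) (hs : leadingLog N p γ + 1 ≤ s) :
    ∃ t : ℝ, t ≤ s ∧ (t : ℂ) = leadingLog N p γ + lobeShift ca cb N p t := by
  have hre {t : ℝ} (ht : t ≤ leadingLog N p γ + 1) : (t : ℂ).re ≤ s + 1 := by
    rw [Complex.ofReal_re]; linarith
  obtain ⟨t, ht, h_eq⟩ := exists_ofReal_eq_add (g := lobeShift ca cb N p)
    (fun t ht => (h.differentiableAt_lobeShift (hre ht)).continuousAt)
    (fun t ht => by
      rw [← Complex.conj_eq_iff_im, ← lobeShift_conj ca cb h.pos.ne' (h.norm_left_lt (hre ht))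
        (h.norm_right_lt (hre ht)), Complex.conj_ofReal])
    fun t ht => (h.norm_lobeShift_le (hre ht)).trans (by norm_num)
  exact ⟨t, ht.trans hs, h_eq⟩

lemma eq_of_eq (h : ChartHalfPlane ca cb N p s) (hτ : τ.re ≤ s) (hσ : σ.re ≤ s) {z : ℂ}
    (hτ' : τ = z + lobeShift ca cb N p τ) (hσ' : σ = z + lobeShift ca cb N p σ) : τ = σ := by
  have hlip := norm_sub_le_of_norm_le_halfPlane one_pos
    (fun τ hτ => h.differentiableAt_lobeShift hτ) (fun τ hτ => h.norm_lobeShift_le hτ) hσ hτ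
  rw [show lobeShift ca cb N p τ - lobeShift ca cb N p σ = τ - σ by
    linear_combination hσ' - hτ'] at hlip
  exact sub_eq_zero.1 (norm_eq_zero.1 (by linarith [norm_nonneg (τ - σ)]))

lemma iff_eq_exp (h : ChartHalfPlane ca cb N p s) {t : ℝ} {z : ℂ} (hts : t ≤ s)
    (ht : (t : ℂ) = z + lobeShift ca cb N p t) {P : ℂ → Prop} (hzero : ¬ P 0)
    (hbound : ∀ C ≠ 0, P C → Real.log ‖C‖ ≤ s)
    (hP : ∀ τ : ℂ, τ.re ≤ s → τ.im ∈ Set.Ioc (-(2 * π)) 0 →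
      (P (Complex.exp τ) ↔ τ = z + lobeShift ca cb N p τ)) (C : ℂ) :
    P C ↔ C = (Real.exp t : ℝ) := by
  rw [Complex.ofReal_exp]
  refine ⟨fun hC => ?_, ?_⟩
  · have hC₀ : C ≠ 0 := fun h₀ => hzero (h₀ ▸ hC)
    obtain ⟨τ, rfl, hre, him⟩ := exists_exp_eq_of_im_mem_Ioc hC₀
    have hτ : τ.re ≤ s := hre.trans_le (hbound _ hC₀ hC)
    rw [h.eq_of_eq hτ (by simpa using hts) ((hP τ hτ him).1 hC) ht]
  · rintro rfl
    exact (hP t (by simpa using hts) (by simp [Real.pi_pos])).2 ht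

lemma exists_solution (h : ChartHalfPlane ca cb N p s) (hγ : γ ≠ 0)
    (hs : leadingLog N p γ + 1 ≤ s)
    (hbound : ∀ C : ℂ, C ≠ 0 → ModulusCondition N p γ C → Real.log ‖C‖ ≤ s) :
    ∃ t : ℝ, t ≤ s ∧ (t : ℂ) = leadingLog N p γ + lobeShift ca cb N p t ∧
      (∀ C : ℂ, Consistency N p γ (negSelection N p) C ↔ C = (Real.exp t : ℝ)) ∧
      ∀ C : ℂ, LogConsistency N p γ C ↔ C = (Real.exp t : ℝ) := by
  obtain ⟨t, hts, ht⟩ := h.exists_ofReal_eq hs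
  refine ⟨t, hts, ht, h.iff_eq_exp hts ht (not_consistency_zero h.lt) (fun C hC hcons => ?_)
    fun τ hτ him => ?_, h.iff_eq_exp hts ht (not_logConsistency_zero h.pos h.lt hγ)
    (fun C hC hlog => ?_) fun τ hτ him => ?_⟩
  · exact hbound C hC (hcons.modulusCondition h.pos h.lt hC)
  · exact (h.chartDomain (by linarith) him).consistency_iff h.four_le h.add_four_le
      ((h.norm_lobeShift_le (by linarith)).trans (by norm_num))
  · exact hbound C hC (hlog.modulusCondition h.pos h.lt hC)
  · exact (h.chartDomain (by linarith) him).logConsistency_iff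

end ChartHalfPlane

end Solution

/-! ### Approximation of the solution and of the eigenvalue -/

section Approximation

variable {a b c γ ε : ℝ} {ca : LobeChart a} {cb : LobeChart b} {τ g : ℂ}

lemma norm_lobeVar_le {s : ℕ} (t : ℕ) (hs : 1 ≤ s) (hsN : s ≤ N) (hc : 0 ≤ c)
    (hτ : τ.re ≤ -c * N ^ 2 + 1) : ‖lobeVar s t τ‖ ≤ Real.exp (1 - c * N) := by
  have hs₁ : (1 : ℝ) ≤ s := by exact_mod_cast hs
  have hsN' : (s : ℝ) ≤ N := by exact_mod_cast hsN
  have hlog : 0 ≤ t * Real.log 2 := mul_nonneg (Nat.cast_nonneg t) (Real.log_nonneg one_le_two)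
  have hcs : c * N * s ≤ c * N * N := by gcongr
  rw [norm_lobeVar, Real.exp_le_exp, div_le_iff₀ (by linarith)]
  nlinarith

lemma norm_lobeShift_le_of_norm_lobeVar_le (hp : 0 < p) (hpN : p < N) (hε : 0 ≤ ε)
    (hζ : ‖lobeVar p (N - p) τ‖ < ca.δ) (hξ : ‖lobeVar (N - p) p τ‖ < cb.δ)
    (hζε : ‖lobeVar p (N - p) τ‖ ≤ ε) (hξε : ‖lobeVar (N - p) p τ‖ ≤ ε) :
    ‖lobeShift ca cb N p τ‖ ≤ (ca.K + cb.K) * N ^ 2 * ε := by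
  have hKa := ca.K_nonneg
  have hKb := cb.K_nonneg
  have hpN₂ : (p : ℝ) ≤ N ^ 2 := by
    exact_mod_cast hpN.le.trans (Nat.le_self_pow two_ne_zero N)
  have hsub : ((N - p : ℕ) : ℝ) * (1 + p) ≤ N ^ 2 := by
    exact_mod_cast (Nat.mul_le_mul (Nat.sub_le N p) (by omega : 1 + p ≤ N)).trans_eq (sq N).symm
  calc ‖lobeShift ca cb N p τ‖ ≤ p * (cb.K * ‖lobeVar (N - p) p τ‖)
        + (N - p : ℕ) * ((1 + p) * (ca.K * ‖lobeVar p (N - p) τ‖)) :=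
        norm_lobeShift_le ca cb hp.ne' hζ hξ
    _ ≤ p * (cb.K * ε) + (N - p : ℕ) * ((1 + p) * (ca.K * ε)) := by gcongr
    _ = p * (cb.K * ε) + ((N - p : ℕ) * (1 + p)) * (ca.K * ε) := by ring
    _ ≤ N ^ 2 * (cb.K * ε) + N ^ 2 * (ca.K * ε) := by gcongr
    _ = (ca.K + cb.K) * N ^ 2 * ε := by ring

lemma norm_lobeVar_sub_le {s t : ℕ} (hs : s ≠ 0)
    (hτ : τ = (s * t * γ + (s + t : ℕ) * Real.log 2 : ℝ) + g) (hg : ‖g‖ ≤ 1) :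
    ‖lobeVar s t τ - 2 * Real.exp (t * γ)‖ ≤ 4 * ‖g‖ * Real.exp (t * γ) := by
  have hs₀ : (s : ℂ) ≠ 0 := Nat.cast_ne_zero.2 hs
  have hvar : lobeVar s t τ = 2 * Real.exp (t * γ) * Complex.exp (g / s) := by
    rw [lobeVar, lobeLog, Complex.ofReal_exp, ← exp_log_two, ← Complex.exp_add,
      ← Complex.exp_add, hτ]
    congr 1
    push_cast
    field_simp
    ring
  have hgs : ‖g / s‖ ≤ ‖g‖ := by
    rw [norm_div, Complex.norm_natCast]
    exact div_le_self (norm_nonneg g) (by exact_mod_cast Nat.one_le_iff_ne_zero.2 hs)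
  have hexp := Complex.norm_exp_sub_one_le (hgs.trans hg)
  rw [hvar, ← mul_sub_one, norm_mul, norm_mul, Complex.norm_ofNat, Complex.norm_real,
    Real.norm_of_nonneg (Real.exp_pos _).le]
  calc 2 * Real.exp (t * γ) * ‖Complex.exp (g / s) - 1‖
      ≤ 2 * Real.exp (t * γ) * (2 * ‖g‖) := by gcongr; linarith
    _ = 4 * ‖g‖ * Real.exp (t * γ) := by ring

lemma norm_lobeVar_le_three_mul {s t : ℕ} (hs : s ≠ 0)
    (hτ : τ = (s * t * γ + (s + t : ℕ) * Real.log 2 : ℝ) + g) (hg : ‖g‖ ≤ 1 / 4) :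
    ‖lobeVar s t τ‖ ≤ 3 * Real.exp (t * γ) := by
  have hsub := norm_lobeVar_sub_le hs hτ (hg.trans (by norm_num))
  have hnorm := norm_le_norm_sub_add (lobeVar s t τ) (2 * Real.exp (t * γ) : ℂ)
  rw [norm_mul, Complex.norm_ofNat, Complex.norm_real,
    Real.norm_of_nonneg (Real.exp_pos _).le] at hnorm
  nlinarith [Real.exp_pos (t * γ)]

lemma norm_lobeVar_sq_le {s t : ℕ} (hs : s ≠ 0)
    (hτ : τ = (s * t * γ + (s + t : ℕ) * Real.log 2 : ℝ) + g) (hg : ‖g‖ ≤ 1 / 4)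
    (hε : ‖lobeVar s t τ‖ ≤ ε) : ‖lobeVar s t τ‖ ^ 2 ≤ 3 * ε * Real.exp (t * γ) := by
  have h := mul_le_mul hε (norm_lobeVar_le_three_mul hs hτ hg) (norm_nonneg _)
    ((norm_nonneg _).trans hε)
  linarith

namespace LobeChart

variable {a : ℝ} (c : LobeChart a)

lemma norm_φ_lobeVar_sub_le (ha : 0 ≤ a) {s t : ℕ} (hs : s ≠ 0)
    (hτ : τ = (s * t * γ + (s + t : ℕ) * Real.log 2 : ℝ) + g) (hg : ‖g‖ ≤ 1 / 4)
    (hδ : ‖lobeVar s t τ‖ < c.δ) (hε : ‖lobeVar s t τ‖ ≤ ε) :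
    ‖c.φ (lobeVar s t τ) - 2 * Real.exp (t * γ)‖
      ≤ (6 * (a * c.K) * ε + 4 * ‖g‖) * Real.exp (t * γ) := by
  have hK := c.K_nonneg
  have hsq := norm_lobeVar_sq_le hs hτ hg hε
  calc ‖c.φ (lobeVar s t τ) - 2 * Real.exp (t * γ)‖
      ≤ ‖c.φ (lobeVar s t τ) - lobeVar s t τ‖ + ‖lobeVar s t τ - 2 * Real.exp (t * γ)‖ :=
        norm_sub_le_norm_sub_add_norm_sub _ _ _
    _ ≤ 2 * a * c.K * (3 * ε * Real.exp (t * γ)) + 4 * ‖g‖ * Real.exp (t * γ) := by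
        refine add_le_add ((c.norm_φ_sub_le ha hδ).trans (by gcongr)) ?_
        exact norm_lobeVar_sub_le hs hτ (hg.trans (by norm_num))
    _ = (6 * (a * c.K) * ε + 4 * ‖g‖) * Real.exp (t * γ) := by ring

/-- The linear terms of `φ` cancel in the sum over the roots of unity. -/
lemma norm_sum_φ_mul_unityRoot_pow_le (ha : 0 ≤ a) (hp : 1 < p) {z : ℂ} (hz : ‖z‖ < c.δ) :
    ‖∑ k ∈ Finset.range p, c.φ (z * unityRoot p ^ k)‖ ≤ p * (2 * a * c.K * ‖z‖ ^ 2) := by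
  have hp₀ : p ≠ 0 := by omega
  have hsum : ∑ k ∈ Finset.range p, z * unityRoot p ^ k = 0 := by
    rw [← Finset.mul_sum, (isPrimitiveRoot_unityRoot hp₀).geom_sum_eq_zero hp, mul_zero]
  have hterm (k : ℕ) :
      ‖c.φ (z * unityRoot p ^ k) - z * unityRoot p ^ k‖ ≤ 2 * a * c.K * ‖z‖ ^ 2 := by
    simpa only [norm_mul_unityRoot_pow hp₀] using
      c.norm_φ_sub_le ha (z := z * unityRoot p ^ k) (by rwa [norm_mul_unityRoot_pow hp₀])
  rw [← sub_zero (∑ k ∈ Finset.range p, c.φ (z * unityRoot p ^ k)), ← hsum,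
    ← Finset.sum_sub_distrib]
  simpa using norm_sum_le_of_le (Finset.range p) fun k _ => hterm k

end LobeChart

namespace ChartDomain

lemma betheEigenvalue_negSelection (h : ChartDomain ca cb N p τ) :
    betheEigenvalue N p (negSelection N p) (Complex.exp τ)
      = -1 + 1 / 2 * (cb.φ (lobeVar (N - p) p τ) + ca.φ (lobeVar p (N - p) τ)
        - ∑ k ∈ Finset.range p, ca.φ (lobeVar p (N - p) τ * unityRoot p ^ k)) := by
  have hsel := sum_negSelection h.pos h.lt fun j => root N p j (Complex.exp τ) - 1
  rw [sum_root_exp ca h.pos h.lt h.mul_left h.norm_left_lt fun u => u - 1, h.root_p_eq,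
    h.root_N_eq] at hsel
  simp only [sub_sub_cancel_left, Finset.sum_neg_distrib] at hsel
  rw [betheEigenvalue]
  linear_combination (1 / 2 : ℂ) * hsel

lemma eq_left_add_lobeShift (h : ChartDomain ca cb N p τ)
    (hτ : τ = leadingLog N p γ + lobeShift ca cb N p τ) :
    τ = (p * (N - p : ℕ) * γ + (p + (N - p) : ℕ) * Real.log 2 : ℝ) + lobeShift ca cb N p τ := by
  rwa [Nat.add_sub_cancel' h.lt.le]

lemma eq_right_add_lobeShift (h : ChartDomain ca cb N p τ)
    (hτ : τ = leadingLog N p γ + lobeShift ca cb N p τ) :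
    τ = ((N - p : ℕ) * p * γ + (N - p + p : ℕ) * Real.log 2 : ℝ) + lobeShift ca cb N p τ := by
  rwa [Nat.sub_add_cancel h.lt.le, mul_comm ((N - p : ℕ) : ℝ)]

lemma norm_betheEigenvalue_sub_le (h : ChartDomain ca cb N p τ)
    (hτ : τ = leadingLog N p γ + lobeShift ca cb N p τ)
    (hshift : ‖lobeShift ca cb N p τ‖ ≤ 1 / 4)
    (hζε : ‖lobeVar p (N - p) τ‖ ≤ ε) (hξε : ‖lobeVar (N - p) p τ‖ ≤ ε) :
    ‖betheEigenvalue N p (negSelection N p) (Complex.exp τ)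
        - (-1 + Real.exp (p * γ) + Real.exp ((N - p : ℕ) * γ))‖
      ≤ (3 * (b * cb.K) * ε + 2 * ‖lobeShift ca cb N p τ‖) * Real.exp (p * γ)
        + ((1 + p) * (3 * (a * ca.K) * ε) + 2 * ‖lobeShift ca cb N p τ‖)
          * Real.exp ((N - p : ℕ) * γ) := by
  have ha := h.left_nonneg
  have hp : 1 < p := by have := h.three_le; omega
  have hτζ := h.eq_left_add_lobeShift hτ
  have hζ := ca.norm_φ_lobeVar_sub_le ha h.pos.ne' hτζ hshift h.norm_left_lt hζε
  have hξ := cb.norm_φ_lobeVar_sub_le h.right_nonneg h.sub_ne_zero (h.eq_right_add_lobeShift hτ)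
    hshift h.norm_right_lt hξε
  have hsum : ‖∑ k ∈ Finset.range p, ca.φ (lobeVar p (N - p) τ * unityRoot p ^ k)‖
      ≤ p * (2 * a * ca.K * (3 * ε * Real.exp ((N - p : ℕ) * γ))) := by
    refine (ca.norm_sum_φ_mul_unityRoot_pow_le ha hp h.norm_left_lt).trans ?_
    gcongr
    · exact mul_nonneg (mul_nonneg zero_le_two ha) ca.K_nonneg
    · exact norm_lobeVar_sq_le h.pos.ne' hτζ hshift hζε
  rw [h.betheEigenvalue_negSelection]
  set X := Real.exp ((N - p : ℕ) * γ)
  set Y := Real.exp (p * γ)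
  set x := ca.φ (lobeVar p (N - p) τ)
  set y := cb.φ (lobeVar (N - p) p τ)
  set S := ∑ k ∈ Finset.range p, ca.φ (lobeVar p (N - p) τ * unityRoot p ^ k)
  calc ‖-1 + 1 / 2 * (y + x - S) - (-1 + Y + X)‖
      = 1 / 2 * ‖(y - 2 * Y) + (x - 2 * X) - S‖ := by
        rw [show -1 + 1 / 2 * (y + x - S) - (-1 + Y + X)
          = 1 / 2 * ((y - 2 * Y) + (x - 2 * X) - S) by ring, norm_mul]
        norm_num
    _ ≤ 1 / 2 * (‖y - 2 * Y‖ + ‖x - 2 * X‖ + ‖S‖) := by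
        gcongr
        exact (norm_sub_le _ _).trans (by gcongr; exact norm_add_le _ _)
    _ ≤ _ := by linarith

lemma norm_betheEigenvalue_sub_le_mul_sq (h : ChartDomain ca cb N p τ)
    (hτ : τ = leadingLog N p γ + lobeShift ca cb N p τ)
    (hshift : ‖lobeShift ca cb N p τ‖ ≤ 1 / 4)
    (hζε : ‖lobeVar p (N - p) τ‖ ≤ ε) (hξε : ‖lobeVar (N - p) p τ‖ ≤ ε) :
    ‖betheEigenvalue N p (negSelection N p) (Complex.exp τ)
        - (-1 + Real.exp (p * γ) + Real.exp ((N - p : ℕ) * γ))‖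
      ≤ (3 * (a * ca.K + b * cb.K) + 2 * (ca.K + cb.K)) * N ^ 2 * ε
        * (Real.exp (p * γ) + Real.exp ((N - p : ℕ) * γ)) := by
  have hε : 0 ≤ ε := (norm_nonneg _).trans hζε
  have hA : 0 ≤ 3 * (a * ca.K) * ε :=
    mul_nonneg (mul_nonneg zero_le_three (mul_nonneg h.left_nonneg ca.K_nonneg)) hε
  have hB : 0 ≤ 3 * (b * cb.K) * ε :=
    mul_nonneg (mul_nonneg zero_le_three (mul_nonneg h.right_nonneg cb.K_nonneg)) hε
  have hN : 1 + (p : ℝ) ≤ N ^ 2 := by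
    exact_mod_cast (show 1 + p ≤ N from by have := h.lt; omega).trans
      (Nat.le_self_pow two_ne_zero N)
  have hN₁ : (1 : ℝ) ≤ N ^ 2 := (le_add_of_nonneg_right (Nat.cast_nonneg p)).trans hN
  have hg := norm_lobeShift_le_of_norm_lobeVar_le h.pos h.lt hε h.norm_left_lt h.norm_right_lt
    hζε hξε
  refine (h.norm_betheEigenvalue_sub_le hτ hshift hζε hξε).trans ?_
  rw [mul_add]
  gcongr
  · linarith [le_mul_of_one_le_left hB hN₁, mul_nonneg (sq_nonneg (N : ℝ)) hA]
  · linarith [mul_le_mul_of_nonneg_right hN hA, mul_nonneg (sq_nonneg (N : ℝ)) hB]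

end ChartDomain

end Approximation

section ApproxSolution

variable {a b c γ : ℝ} {ca : LobeChart a} {cb : LobeChart b}

/-- `e^t` is the only solution of either consistency condition, `t` agrees with its leading order up
to `ε`, and the eigenvalue at `e^t` agrees with its leading order up to the relative error `ε`. -/
structure IsApproxSolution (N p : ℕ) (γ ε t : ℝ) : Prop where
  logConsistency_iff : ∀ C : ℂ, LogConsistency N p γ C ↔ C = (Real.exp t : ℝ)
  consistency_iff : ∀ C : ℂ, Consistency N p γ (negSelection N p) C ↔ C = (Real.exp t : ℝ)
  abs_sub_leadingLog_le : |t - leadingLog N p γ| ≤ ε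
  norm_betheEigenvalue_sub_le :
    ‖betheEigenvalue N p (negSelection N p) (Real.exp t : ℝ)
        - (-1 + Real.exp (p * γ) + Real.exp ((N - p : ℕ) * γ))‖
      ≤ ε * (Real.exp (p * γ) + Real.exp ((N - p : ℕ) * γ))

lemma ModulusCondition.log_norm_le {C : ℂ} (h : ModulusCondition N p γ C) (hp : 0 < p)
    (hpN : p < N) (hC : C ≠ 0) (hc : p * (N - p : ℕ) * γ = -(8 * c) * N ^ 2)
    (hcN : Real.log 8 ≤ c * N) : Real.log ‖C‖ ≤ -c * N ^ 2 := by
  have hκ : Real.exp (-(2 * c * N)) ≤ 1 / 2 := by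
    have hlog : Real.log 2 ≤ Real.log 8 := Real.log_le_log two_pos (by norm_num)
    have hlog₂ : 0 < Real.log 2 := Real.log_pos one_lt_two
    calc Real.exp (-(2 * c * N)) ≤ Real.exp (-Real.log 2) := Real.exp_le_exp.2 (by linarith)
      _ = 1 / 2 := by rw [Real.exp_neg, Real.exp_log two_pos, one_div]
  have hκγ : Real.exp (-(2 * c * N)) ^ (4 * N) = Real.exp (γ * p) ^ (N - p) := by
    rw [← Real.exp_nat_mul, ← Real.exp_nat_mul]
    congr 1
    push_cast [-Nat.cast_sub]
    linear_combination -hc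
  have hle := Real.log_le_log (norm_pos_iff.2 hC) (norm_le_of_prod_norm_one_add_root_eq hp hpN hC
    (Real.exp_pos _).le (Real.exp_pos _).le hκ hκγ h)
  rw [Real.log_pow, Real.log_mul (by norm_num) (Real.exp_ne_zero _), Real.log_exp] at hle
  calc Real.log ‖C‖ ≤ N * (Real.log 8 + -(2 * c * N)) := hle
    _ ≤ N * (c * N + -(2 * c * N)) := by gcongr
    _ = -c * N ^ 2 := by ring

lemma leadingLog_add_one_le (hN : 1 ≤ N) (hc : p * (N - p : ℕ) * γ = -(8 * c) * N ^ 2)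
    (hcN : Real.log 8 ≤ c * N) : leadingLog N p γ + 1 ≤ -c * N ^ 2 := by
  have hN' : (1 : ℝ) ≤ N := by exact_mod_cast hN
  have hlog : Real.log 8 = 3 * Real.log 2 := by
    rw [show (8 : ℝ) = 2 ^ 3 by norm_num, Real.log_pow]; norm_num
  have hlog₂ := Real.log_two_gt_d9
  have hmul := mul_le_mul_of_nonneg_left hcN (Nat.cast_nonneg (α := ℝ) N)
  rw [leadingLog, hc]
  nlinarith

lemma chartHalfPlane_of_exp_lt (hp : 4 ≤ p) (hpN : p + 4 ≤ N) (hap : a * p = (N - p : ℕ))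
    (hbp : b * (N - p : ℕ) = p) (hc : 0 ≤ c) (hca : Real.exp (1 - c * N) < ca.δ)
    (hcb : Real.exp (1 - c * N) < cb.δ)
    (hsmall : (ca.K + cb.K) * N ^ 2 * Real.exp (1 - c * N) ≤ 1 / 4) :
    ChartHalfPlane ca cb N p (-c * N ^ 2) := by
  have hζ {τ : ℂ} (hτ : τ.re ≤ -c * N ^ 2 + 1) :
      ‖lobeVar p (N - p) τ‖ ≤ Real.exp (1 - c * N) :=
    norm_lobeVar_le _ (by omega) (by omega) hc hτ
  have hξ {τ : ℂ} (hτ : τ.re ≤ -c * N ^ 2 + 1) :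
      ‖lobeVar (N - p) p τ‖ ≤ Real.exp (1 - c * N) :=
    norm_lobeVar_le _ (by omega) (by omega) hc hτ
  refine ⟨hp, hpN, hap, hbp, fun hτ => (hζ hτ).trans_lt hca, fun hτ => (hξ hτ).trans_lt hcb,
    fun hτ => ?_⟩
  exact (norm_lobeShift_le_of_norm_lobeVar_le (by omega) (by omega) (Real.exp_pos _).le
    ((hζ hτ).trans_lt hca) ((hξ hτ).trans_lt hcb) (hζ hτ) (hξ hτ)).trans hsmall

lemma ChartHalfPlane.exists_isApproxSolution (h : ChartHalfPlane ca cb N p (-c * N ^ 2))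
    (hγ : γ ≠ 0) (hc : 0 ≤ c) (hcγ : p * (N - p : ℕ) * γ = -(8 * c) * N ^ 2)
    (hcN : Real.log 8 ≤ c * N) : ∃ t : ℝ, IsApproxSolution N p γ
      ((3 * (a * ca.K + b * cb.K) + 2 * (ca.K + cb.K)) * N ^ 2 * Real.exp (1 - c * N)) t := by
  have hp := h.four_le
  have hpN := h.add_four_le
  obtain ⟨t, hts, ht, hcons, hlog⟩ := h.exists_solution hγ
    (leadingLog_add_one_le (by omega) hcγ hcN)
    fun C hC hmod => hmod.log_norm_le h.pos h.lt hC hcγ hcN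
  have hre : (t : ℂ).re ≤ -c * N ^ 2 + 1 := by rw [Complex.ofReal_re]; linarith
  have hdom := h.chartDomain hre (by simp [Real.pi_pos])
  have hζ := norm_lobeVar_le (N - p) (s := p) (by omega) (by omega) hc hre
  have hξ := norm_lobeVar_le p (s := N - p) (by omega) (by omega) hc hre
  refine ⟨t, hlog, hcons, ?_, ?_⟩
  · have hshift : ((t - leadingLog N p γ : ℝ) : ℂ) = lobeShift ca cb N p t := by
      rw [Complex.ofReal_sub]; linear_combination ht
    rw [← Real.norm_eq_abs, ← Complex.norm_real, hshift]
    refine (norm_lobeShift_le_of_norm_lobeVar_le h.pos h.lt (Real.exp_pos _).le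
      hdom.norm_left_lt hdom.norm_right_lt hζ hξ).trans ?_
    have hKa := mul_nonneg hdom.left_nonneg ca.K_nonneg
    have hKb := mul_nonneg hdom.right_nonneg cb.K_nonneg
    have hK : ca.K + cb.K ≤ 3 * (a * ca.K + b * cb.K) + 2 * (ca.K + cb.K) := by
      linarith [ca.K_nonneg, cb.K_nonneg]
    exact mul_le_mul_of_nonneg_right (mul_le_mul_of_nonneg_right hK (sq_nonneg _))
      (Real.exp_pos _).le
  · rw [Complex.ofReal_exp]
    exact hdom.norm_betheEigenvalue_sub_le_mul_sq ht (h.norm_lobeShift_le hre) hζ hξ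

end ApproxSolution

/-! ### The thermodynamic limit -/

section ThermodynamicLimit

variable {γ : ℝ} {ρ : ℚ}

lemma tendsto_fst_thermodynamicLimit (ρ : ℚ) :
    Tendsto Prod.fst (thermodynamicLimit ρ) (atTop : Filter ℕ) :=
  tendsto_comap.mono_left inf_le_left

lemma tendsto_natCast_fst_thermodynamicLimit (ρ : ℚ) :
    Tendsto (fun q : ℕ × ℕ => (q.1 : ℝ)) (thermodynamicLimit ρ) atTop :=
  tendsto_natCast_atTop_atTop.comp (tendsto_fst_thermodynamicLimit ρ)

lemma eventually_snd_eq_mul (ρ : ℚ) :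
    ∀ᶠ q in thermodynamicLimit ρ, (q.2 : ℝ) = ρ * q.1 := by
  have h : ∀ᶠ q in thermodynamicLimit ρ, (q.2 : ℚ) = ρ * q.1 :=
    (inf_le_right : thermodynamicLimit ρ ≤ _) (mem_principal_self _)
  filter_upwards [h] with q hq
  exact_mod_cast hq

lemma eventually_natCast_sub_eq_mul (hρ : ρ ≤ 1) :
    ∀ᶠ q in thermodynamicLimit ρ, ((q.1 - q.2 : ℕ) : ℝ) = (1 - ρ) * q.1 := by
  filter_upwards [eventually_snd_eq_mul ρ] with q hq
  have hle : (q.2 : ℝ) ≤ q.1 := by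
    rw [hq]
    exact mul_le_of_le_one_left (Nat.cast_nonneg _) (by exact_mod_cast hρ)
  rw [Nat.cast_sub (by exact_mod_cast hle), hq]
  ring

lemma tendsto_mul_sq_mul_exp (M : ℝ) {c : ℝ} (hc : 0 < c) :
    Tendsto (fun N : ℕ => M * N ^ 2 * Real.exp (1 - c * N)) atTop (𝓝 0) := by
  have h := ((Real.tendsto_pow_mul_exp_neg_atTop_nhds_zero 2).comp
    (tendsto_natCast_atTop_atTop.const_mul_atTop hc)).const_mul (M * Real.exp 1 / c ^ 2)
  rw [mul_zero] at h
  refine h.congr fun N => ?_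
  rw [Function.comp_apply, sub_eq_add_neg, Real.exp_add]
  field_simp

lemma eventually_exp_lt {c δ : ℝ} (hc : 0 < c) (hδ : 0 < δ) :
    ∀ᶠ N : ℕ in atTop, Real.exp (1 - c * N) < δ := by
  have h : Tendsto (fun N : ℕ => 1 - c * (N : ℝ)) atTop atBot :=
    tendsto_const_nhds.add_atBot
      (tendsto_neg_atTop_atBot.comp (tendsto_natCast_atTop_atTop.const_mul_atTop hc))
  exact (Real.tendsto_exp_atBot.comp h).eventually_lt_const hδ

lemma exists_tendsto_isApproxSolution (hγ : γ < 0) (hρ₀ : 0 < ρ) (hρ₁ : ρ < 1) :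
    ∃ ε : ℕ → ℝ, Tendsto ε atTop (𝓝 0) ∧
      ∀ᶠ q in thermodynamicLimit ρ, ∃ t, IsApproxSolution q.1 q.2 γ (ε q.1) t := by
  have hr₀ : (0 : ℝ) < ρ := by exact_mod_cast hρ₀
  have hr₁ : (0 : ℝ) < 1 - ρ := sub_pos.2 (by exact_mod_cast hρ₁)
  obtain ⟨ca⟩ := nonempty_lobeChart ((1 - ρ) / ρ)
  obtain ⟨cb⟩ := nonempty_lobeChart (ρ / (1 - ρ))
  set c : ℝ := ρ * (1 - ρ) * -γ / 8 with hc
  have hc₀ : 0 < c := by have := neg_pos.2 hγ; positivity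
  refine ⟨_, tendsto_mul_sq_mul_exp
    (3 * ((1 - ρ) / ρ * ca.K + ρ / (1 - ρ) * cb.K) + 2 * (ca.K + cb.K)) hc₀, ?_⟩
  have hlarge (x : ℝ) := (tendsto_natCast_fst_thermodynamicLimit ρ).eventually_ge_atTop x
  have hfst := tendsto_fst_thermodynamicLimit ρ
  filter_upwards [eventually_snd_eq_mul ρ, eventually_natCast_sub_eq_mul hρ₁.le,
    hlarge (4 / ρ), hlarge (4 / (1 - ρ)), hlarge (Real.log 8 / c),
    hfst.eventually (eventually_exp_lt hc₀ ca.δ_pos),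
    hfst.eventually (eventually_exp_lt hc₀ cb.δ_pos),
    hfst.eventually ((tendsto_mul_sq_mul_exp (ca.K + cb.K) hc₀).eventually_le_const
      (by norm_num : (0 : ℝ) < 1 / 4))] with ⟨N, p⟩ hp hn hN₀ hN₁ hcN hca hcb hsmall
  rw [div_le_iff₀' hr₀, ← hp] at hN₀
  rw [div_le_iff₀' hr₁, ← hn] at hN₁
  rw [div_le_iff₀' hc₀] at hcN
  have hp₄ : 4 ≤ p := by exact_mod_cast hN₀
  have hn₄ : 4 ≤ N - p := by exact_mod_cast hN₁
  have hhalf : ChartHalfPlane ca cb N p (-c * N ^ 2) := chartHalfPlane_of_exp_lt hp₄ (by omega)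
    (by rw [hp, hn]; field_simp) (by rw [hp, hn]; field_simp) hc₀.le hca hcb hsmall
  exact hhalf.exists_isApproxSolution hγ.ne hc₀.le (by rw [hp, hn, hc]; ring) hcN

lemma eventually_leadingLog_eq (γ : ℝ) (hρ : ρ ≤ 1) : ∀ᶠ q in thermodynamicLimit ρ,
    leadingLog q.1 q.2 γ = (q.1 : ℝ) ^ 2 * γ * ρ * (1 - ρ) + q.1 * Real.log 2 := by
  filter_upwards [eventually_snd_eq_mul ρ, eventually_natCast_sub_eq_mul hρ] with q hp hn
  rw [leadingLog, hp, hn]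
  ring

lemma eventually_leadingLog_le (hγ : γ < 0) (hρ₀ : 0 < ρ) (hρ₁ : ρ < 1) :
    ∀ᶠ q in thermodynamicLimit ρ, leadingLog q.1 q.2 γ ≤ -1 * q.1 := by
  have hr₀ : (0 : ℝ) < ρ := by exact_mod_cast hρ₀
  have hr₁ : (0 : ℝ) < 1 - ρ := sub_pos.2 (by exact_mod_cast hρ₁)
  have hκ : 0 < -γ * ρ * (1 - ρ) := mul_pos (mul_pos (neg_pos.2 hγ) hr₀) hr₁
  filter_upwards [eventually_leadingLog_eq γ hρ₁.le,
    (tendsto_natCast_fst_thermodynamicLimit ρ).eventually_ge_atTop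
      ((1 + Real.log 2) / (-γ * ρ * (1 - ρ)))] with q hq hN
  rw [div_le_iff₀ hκ] at hN
  rw [hq]
  nlinarith [mul_le_mul_of_nonneg_left hN (Nat.cast_nonneg (α := ℝ) q.1)]

lemma eventually_exp_leadingLog_eq (γ : ℝ) (hρ : ρ ≤ 1) : ∀ᶠ q in thermodynamicLimit ρ,
    Real.exp (leadingLog q.1 q.2 γ)
      = Real.exp ((q.1 : ℝ) ^ 2 * γ * ρ * (1 - ρ)) * 2 ^ q.1 := by
  filter_upwards [eventually_leadingLog_eq γ hρ] with q hq
  rw [hq, Real.exp_add, Real.exp_nat_mul, Real.exp_log two_pos]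

lemma isEquivalent_exp_of_tendsto_sub {α : Type*} {l : Filter α} {f g : α → ℝ}
    (h : Tendsto (fun x => f x - g x) l (𝓝 0)) :
    (fun x => Real.exp (f x)) ~[l] fun x => Real.exp (g x) := by
  refine isEquivalent_of_tendsto_one ?_
  have hexp := (Real.continuous_exp.tendsto 0).comp h
  rw [Real.exp_zero] at hexp
  exact hexp.congr fun x => Real.exp_sub _ _

lemma isEquivalent_exp_leadingLog {ε : ℕ → ℝ} {t : ℕ × ℕ → ℝ} (hε : Tendsto ε atTop (𝓝 0))
    (ht : ∀ᶠ q in thermodynamicLimit ρ, IsApproxSolution q.1 q.2 γ (ε q.1) (t q)) :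
    (fun q => Real.exp (t q)) ~[thermodynamicLimit ρ] fun q => Real.exp (leadingLog q.1 q.2 γ) :=
  isEquivalent_exp_of_tendsto_sub <| squeeze_zero_norm'
    (ht.mono fun _ hq => hq.abs_sub_leadingLog_le) (hε.comp (tendsto_fst_thermodynamicLimit ρ))

lemma isLittleO_betheEigenvalue {ε : ℕ → ℝ} {t : ℕ × ℕ → ℝ} (hε : Tendsto ε atTop (𝓝 0))
    (ht : ∀ᶠ q in thermodynamicLimit ρ, IsApproxSolution q.1 q.2 γ (ε q.1) (t q)) (hρ : ρ ≤ 1) :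
    (fun q => betheEigenvalue q.1 q.2 (negSelection q.1 q.2) (Real.exp (t q) : ℝ)
        - (-1 + Complex.exp ((q.1 : ℂ) * γ * ρ) + Complex.exp ((q.1 : ℂ) * γ * (1 - ρ))))
      =o[thermodynamicLimit ρ]
        fun q => Real.exp ((q.1 : ℝ) * γ * ρ) + Real.exp ((q.1 : ℝ) * γ * (1 - ρ)) := by
  refine isLittleO_iff.2 fun δ hδ => ?_
  filter_upwards [ht, eventually_snd_eq_mul ρ, eventually_natCast_sub_eq_mul hρ,
    (tendsto_fst_thermodynamicLimit ρ).eventually (hε.eventually_le_const hδ)] with q hq hp hn hle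
  have hbound := hq.norm_betheEigenvalue_sub_le
  rw [show (q.2 : ℝ) * γ = q.1 * γ * ρ by rw [hp]; ring,
    show ((q.1 - q.2 : ℕ) : ℝ) * γ = q.1 * γ * (1 - ρ) by rw [hn]; ring] at hbound
  rw [Real.norm_of_nonneg (by positivity)]
  push_cast at hbound ⊢
  exact hbound.trans (by gcongr)

end ThermodynamicLimit

end TASEP

end

theorem proposition4p6 (γ : ℝ) (hγ : γ < 0) (ρ : ℚ) (hρ₀ : 0 < ρ) (hρ₁ : ρ < 1) :
    (∃ Cstar : ℕ × ℕ → ℝ,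
      (∀ᶠ q in TASEP.thermodynamicLimit ρ, 0 < Cstar q ∧
        (∀ C : ℂ, TASEP.LogConsistency q.1 q.2 γ C ↔ C = (Cstar q : ℂ)) ∧
        (∀ C : ℂ, TASEP.Consistency q.1 q.2 γ (TASEP.negSelection q.1 q.2) C ↔
          C = (Cstar q : ℂ))) ∧
      (∃ c : ℝ, 0 < c ∧
        Cstar =O[TASEP.thermodynamicLimit ρ] fun q => Real.exp (-c * (q.1 : ℝ))) ∧
      (fun q => Cstar q - Real.exp ((q.1 : ℝ) ^ 2 * γ * ρ * (1 - ρ)) * 2 ^ q.1)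
        =o[TASEP.thermodynamicLimit ρ]
          fun q => Real.exp ((q.1 : ℝ) ^ 2 * γ * ρ * (1 - ρ)) * (2 : ℝ) ^ q.1) ∧
    (TASEP.RootSelection γ ρ → ∀ lam : ℕ × ℕ → ℂ,
      (∀ᶠ q in TASEP.thermodynamicLimit ρ, TASEP.IsLargestEigenvalue q.1 q.2 γ (lam q)) →
      (fun q => lam q -
          (-1 + Complex.exp ((q.1 : ℂ) * γ * ρ) + Complex.exp ((q.1 : ℂ) * γ * (1 - ρ))))
        =o[TASEP.thermodynamicLimit ρ]
          fun q => Real.exp ((q.1 : ℝ) * γ * ρ) + Real.exp ((q.1 : ℝ) * γ * (1 - ρ))) := by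
  obtain ⟨ε, hε, hsol⟩ := TASEP.exists_tendsto_isApproxSolution hγ hρ₀ hρ₁
  obtain ⟨t, ht⟩ := Filter.skolem.1 hsol
  have hequiv := TASEP.isEquivalent_exp_leadingLog hε ht
  refine ⟨⟨fun q => Real.exp (t q), ?_, ⟨1, one_pos, ?_⟩, ?_⟩, fun hsel lam hlam => ?_⟩
  · filter_upwards [ht] with q hq
    exact ⟨Real.exp_pos _, hq.logConsistency_iff, hq.consistency_iff⟩
  · refine hequiv.isBigO.trans (IsBigO.of_norm_eventuallyLE ?_)
    filter_upwards [TASEP.eventually_leadingLog_le hγ hρ₀ hρ₁] with q hq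
    rw [Real.norm_of_nonneg (Real.exp_pos _).le]
    exact Real.exp_le_exp.2 hq
  · exact hequiv.congr_right (TASEP.eventually_exp_leadingLog_eq γ hρ₁.le)
  · refine (TASEP.isLittleO_betheEigenvalue hε ht hρ₁.le).congr' ?_ EventuallyEq.rfl
    filter_upwards [ht, hsel, hlam] with q hq hsel_q hlam_q
    obtain ⟨C, hC, hlam_eq⟩ := hsel_q _ hlam_q
    rw [hlam_eq, (hq.consistency_iff C).1 hC]
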